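/- Let $d\ge 2$. Take the distance-$d$ rectified cubic lattice: its vertices are the $p\in\{0,\dots,2d-2\}^3$ of parity type (even, even, even), (odd, even, odd) or (even, odd, odd). The $g$-cells are the octahedra with vertices $p\pm e_i$ centred at points $p$ of type (even, even, odd). The $r$- and $b$-cells are the cuboctahedra with vertices $p\pm e_i\pm e_j$ centred at points $p$ of type (odd, odd, even), with coordinate sum $\equiv 2$ (for $r$) or $\equiv 0$ (for $b$) mod $4$. All cells are cut down to the cube $[0,2d-2]^3$. The cells of the lattice are those centred in the cube, together with the $r$-cuboctahedra centred at distance $1$ outside the sides $y=0,\,2d-2$ and the $b$-cuboctahedra centred at distance $1$ outside the sides $x=0,\,2d-2$ (flattened onto those sides). Its faces are the common faces, cut down to the cube, of two cells of the lattice, together with the squares between cuboctahedra of the infinite lattice whose centre lies in the cube. The two $r$-, $b$-, $g$-boundaries are the sides $x$, $y$, $z\in\{0,2d-2\}$ respectively. Let $n=3d^3-4d^2+2d$ be the number of vertices. For $c\in\{r,g,b\}$ let $\{c,c',c''\}=\{r,g,b\}$. The surface code $\mathcal{SC}_c$ has one qubit per vertex, an $X$ stabilizer on every $c$-cell and a $Z$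 stabilizer on every $c'c''$-face. Its $c$-boundaries consist of the vertices that lie in exactly one $c$-cell (every other vertex lies in exactly two). It has $n-1$ independent stabilizer generators and encodes one logical qubit. The stack consists of the three codes, with three qubits at every vertex. The cube code has one qubit on each corner of a cube, the stabilizer $X^{\otimes 8}$ and a $Z$ stabilizer on each face. It is an $[[8,3,2]]$ code with $5$ independent generators. The three pairs of opposite faces are labelled by $r,g,b$; the logical $\overline X_{cy}$ is $X$ on either $c$-face, and $\overline Z_{cy}$ is $Z$ on any edge linking the two $c$-faces. Replace each vertex $v$ by such a cube (a $y$-cell) whose $c$-faces point towards the two $c$-cells at $v$ in the infinite lattice, and let $E$ be the map that encodes, at every vertex, the qubit of $\mathcal{SC}_c$ as the $c$-qubit of the cube code. Then: 1. **Lattice.** The $8n$ new qubits are in bijection with the vertices, in these cubes, of a cantitruncated cubic lattice (combinatorially: truncated cuboctahedra replacing the cuboctahedra, truncated octahedra replacing the octahedra, cubes replacing the vertices). Each qubit is in exactly one cube and in at most one cell of the lattice of each colour $r,g,b$. Each qubit is joined by edges to at most four others, and to exactly four if it lies in a cell of each colour. 2. **Code.** $E$ is an isometry which maps the code space of the stack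 onto the code space of the colour code on this lattice, that is, the code with an $X$ stabilizer on every cell and a $Z$ stabilizer on every face (including all faces of the cubes). The stabilizer group of the concatenated code equals that of the colour code. 3. **Parameters.** The colour code has $8n$ qubits and $8n-3$ independent stabilizer generators, so it encodes three logical qubits. 4. **Stabilizers.** $E$ carries the $X$ stabilizer of $\mathcal{SC}_c$ on a $c$-cell to the $X$ stabilizer of the colour code on the corresponding truncated $c$-cell, and the $Z$ stabilizer of $\mathcal{SC}_c$ on a $c'c''$-face to the $Z$ stabilizer of the colour code on the corresponding $c'c''$-face. 5. **Boundaries.** The $c$-boundaries of the colour code, i.e. the qubits that lie in no $c$-cell of the lattice, consist of exactly one $c$-face of the cube at each vertex of the $c$-boundaries of the stack. They split into two disjoint parts, over the two $c$-boundaries of the stack. 6. **Logical operators.** For every set $A$ of vertices, $E$ carries $X_A$ (resp. $Z_A$) in $\mathcal{SC}_c$ to the operator obtained by replacing each $X$ by some $\overline X_{cy}$ (resp. each $Z$ by some $\overline Z_{cy}$). The one is a stabilizer, or a nontrivial logical operator, if and only if the other is. In particular, the membrane $X$ on all qubits of a $c$-boundary of the stack, and the string $Z$ along the line where a $c'$-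 and a $c''$-boundary meet, are nontrivial logical operators of $\mathcal{SC}_c$. They are carried to $X$ on all qubits of the corresponding $c$-boundary of the colour code, and to $Z$ on all qubits common to the corresponding $c'$- and $c''$-boundaries. These are nontrivial logical operators $\overline X_c,\overline Z_c$ of the colour code, with $\overline X_c$ and $\overline Z_{c_1}$ anticommuting if $c=c_1$ and commuting otherwise. Any three boundaries of the colour code of different colours have a qubit in common, so the string $\overline Z_c$ reaches both $c$-boundaries and the membrane $\overline X_c$ reaches all the $c'$- and $c''$-boundaries. -/

import Mathlib

/-! ### Qubits, Pauli operators and stabilizer codes of CSS type -/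

/-- State vectors of a family of qubits labelled by `Q` (coordinates in the computational basis). -/
abbrev QState (Q : Type) : Type := (Q → ZMod 2) → ℂ

open scoped Classical in
/-- The bit string which is `1` exactly on `S`. -/
noncomputable def bits {Q : Type} (S : Set Q) : Q → ZMod 2 := fun q => if q ∈ S then 1 else 0

open scoped Classical in
/-- The eigenvalue of the tensor product of `Z` over `S` on the basis vector `s`. -/
noncomputable def zPhase {Q : Type} [Fintype Q] (S : Set Q) (s : Q → ZMod 2) : ℂ :=
  ∏ q, if q ∈ S ∧ s q = 1 then -1 else 1

theorem add_bits_add_bits {Q : Type} (S : Set Q) (s : Q → ZMod 2) :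
    s + bits S + bits S = s := by
  have h : ∀ t : ZMod 2, t + t = 0 := by decide
  funext q
  simp [add_assoc, h]

theorem zPhase_mul_self {Q : Type} [Fintype Q] (S : Set Q) (s : Q → ZMod 2) :
    zPhase S s * zPhase S s = 1 := by
  unfold zPhase
  rw [← Finset.prod_mul_distrib]
  apply Finset.prod_eq_one
  intro q _
  split_ifs <;> norm_num

/-- The Pauli operator acting as `X` on the qubits of `S`, and trivially elsewhere. -/
noncomputable def pauliX {Q : Type} (S : Set Q) : QState Q ≃ₗ[ℂ] QState Q :=
  LinearEquiv.ofInvolutive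
    { toFun := fun ψ s => ψ (s + bits S)
      map_add' := fun _ _ => rfl
      map_smul' := fun _ _ => rfl }
    (fun ψ => by
      funext s
      simp only [LinearMap.coe_mk, AddHom.coe_mk, add_bits_add_bits])

/-- The Pauli operator acting as `Z` on the qubits of `S`, and trivially elsewhere. -/
noncomputable def pauliZ {Q : Type} [Fintype Q] (S : Set Q) : QState Q ≃ₗ[ℂ] QState Q :=
  LinearEquiv.ofInvolutive
    { toFun := fun ψ s => zPhase S s * ψ s
      map_add' := fun ψ φ => by funext s; simp [mul_add]
      map_smul' := fun a ψ => by funext s; simp [mul_left_comm] }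
    (fun ψ => by
      funext s
      simp only [LinearMap.coe_mk, AddHom.coe_mk, ← mul_assoc, zPhase_mul_self, one_mul])

/-- The supports of the `X`-type and of the `Z`-type generators of a CSS code. -/
structure CSSCode (Q : Type) where
  xSupports : Set (Set Q)
  zSupports : Set (Set Q)

namespace CSSCode

variable {Q : Type} [Fintype Q]

/-- The (possibly redundant) stabilizer generators. -/
def generators (C : CSSCode Q) : Set (QState Q ≃ₗ[ℂ] QState Q) :=
  pauliX '' C.xSupports ∪ pauliZ '' C.zSupports

/-- The stabilizer group. -/
def stabilizer (C : CSSCode Q) : Subgroup (QState Q ≃ₗ[ℂ] QState Q) :=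
  Subgroup.closure C.generators

/-- The stabilizer group is abelian and does not contain `-1`. -/
def IsValid (C : CSSCode Q) : Prop :=
  (∀ g ∈ C.stabilizer, ∀ h ∈ C.stabilizer, g * h = h * g) ∧
    LinearEquiv.neg ℂ ∉ C.stabilizer

/-- The space of encoded states: the vectors fixed by the whole stabilizer group. -/
def codeSpace (C : CSSCode Q) : Submodule ℂ (QState Q) where
  carrier := {ψ | ∀ g ∈ C.stabilizer, g ψ = ψ}
  add_mem' := fun hψ hφ g hg => by rw [map_add, hψ g hg, hφ g hg]
  zero_mem' := fun g _ => map_zero g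
  smul_mem' := fun a ψ hψ g hg => by rw [map_smul, hψ g hg]

/-- The code encodes `k` logical qubits. -/
def EncodesQubits (C : CSSCode Q) (k : ℕ) : Prop :=
  Module.finrank ℂ C.codeSpace = 2 ^ k

/-- Some `m` of the generators are independent and generate the stabilizer group. -/
def HasIndependentGenerators (C : CSSCode Q) (m : ℕ) : Prop :=
  ∃ T : Set (QState Q ≃ₗ[ℂ] QState Q), T ⊆ C.generators ∧ T.Finite ∧ T.ncard = m ∧
    Subgroup.closure T = C.stabilizer ∧ ∀ g ∈ T, g ∉ Subgroup.closure (T \ {g})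

/-- The Pauli operator `X(A) Z(B)` is a nontrivial logical operator: it commutes with every
stabilizer and is not a scalar multiple of a stabilizer. -/
def IsLogical (C : CSSCode Q) (A B : Set Q) : Prop :=
  (∀ g ∈ C.stabilizer, pauliX A * pauliZ B * g = g * (pauliX A * pauliZ B)) ∧
    ¬ ∃ g ∈ C.stabilizer, ∃ μ : ℂ, ∀ ψ, (pauliX A * pauliZ B) ψ = μ • g ψ

/-- `δ` is the code distance: the least weight of a nontrivial logical Pauli operator. -/
def HasDistance (C : CSSCode Q) (δ : ℕ) : Prop :=
  IsLeast {w | ∃ A B : Set Q, C.IsLogical A B ∧ (A ∪ B).ncard = w} δ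

end CSSCode

/-! ### The rectified cubic lattice

The lattice is realised in `ℤ³`. Each kind of site is a union of classes of points modulo `2`
(modulo `4` for the two colours of cuboctahedra). -/

/-- The three cell colours of the rectified cubic lattice. -/
inductive Colour : Type
  | r
  | g
  | b
  deriving DecidableEq

instance : Fintype Colour where
  elems := {.r, .g, .b}
  complete := by intro c; cases c <;> decide

abbrev Point : Type := ℤ × ℤ × ℤ

/-- The squared Euclidean distance. -/
def sqDist (p q : Point) : ℤ :=
  (p.1 - q.1) ^ 2 + (p.2.1 - q.2.1) ^ 2 + (p.2.2 - q.2.2) ^ 2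

/-- Vertices of the (infinite) rectified cubic lattice. -/
def IsVertex (p : Point) : Prop :=
  (Even p.1 ∧ Even p.2.1 ∧ Even p.2.2) ∨ (Odd p.1 ∧ Even p.2.1 ∧ Odd p.2.2) ∨
    (Even p.1 ∧ Odd p.2.1 ∧ Odd p.2.2)

/-- Centres of the cells of each colour: the `g`-cells are the octahedra, and the `r`-cells and
`b`-cells are the cuboctahedra, coloured so that those sharing a square have different colours. -/
def IsCentre : Colour → Point → Prop
  | .g, p => Even p.1 ∧ Even p.2.1 ∧ Odd p.2.2
  | .r, p => Odd p.1 ∧ Odd p.2.1 ∧ Even p.2.2 ∧ (p.1 + p.2.1 + p.2.2) % 4 = 2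
  | .b, p => Odd p.1 ∧ Odd p.2.1 ∧ Even p.2.2 ∧ (p.1 + p.2.1 + p.2.2) % 4 = 0

/-- The squared circumradius of the cells: an octahedron has its vertices at `±eᵢ`, and a
cuboctahedron has its vertices at `±eᵢ ± eⱼ`, relative to the centre. -/
def cellRadius : Colour → ℤ
  | .g => 1
  | .r => 2
  | .b => 2

/-- The cube of the distance `d` lattice. -/
def InBox (d : ℕ) (p : Point) : Prop :=
  (0 ≤ p.1 ∧ p.1 ≤ 2 * d - 2) ∧ (0 ≤ p.2.1 ∧ p.2.1 ≤ 2 * d - 2) ∧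
    (0 ≤ p.2.2 ∧ p.2.2 ≤ 2 * d - 2)

open scoped Classical in
/-- The vertices of the distance `d` lattice. -/
noncomputable def latticeVertices (d : ℕ) : Finset Point :=
  (Finset.Icc ((0, 0, 0) : Point) (2 * d - 2, 2 * d - 2, 2 * d - 2)).filter IsVertex

abbrev Vertex (d : ℕ) : Type := {p : Point // p ∈ latticeVertices d}

/-- The `c`-cells of the distance `d` lattice, given by their centres. These are the cells centred
in the cube, together with the cells centred just outside a side of the cube that are flattened onto
that side: flattened `r`-cells on the `b`-boundaries (`y`-sides) and flattened `b`-cells on the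
`r`-boundaries (`x`-sides). -/
def IsCell (d : ℕ) (c : Colour) (p : Point) : Prop :=
  IsCentre c p ∧
    match c with
    | .g => InBox d p
    | .r => (0 ≤ p.1 ∧ p.1 ≤ 2 * d - 2) ∧ (-1 ≤ p.2.1 ∧ p.2.1 ≤ 2 * d - 1) ∧
        (0 ≤ p.2.2 ∧ p.2.2 ≤ 2 * d - 2)
    | .b => (-1 ≤ p.1 ∧ p.1 ≤ 2 * d - 1) ∧ (0 ≤ p.2.1 ∧ p.2.1 ≤ 2 * d - 2) ∧
        (0 ≤ p.2.2 ∧ p.2.2 ≤ 2 * d - 2)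

/-- Two differently coloured cells of the infinite lattice share a face: an octahedron and a
cuboctahedron share a triangle, and two cuboctahedra share a square. -/
def ShareFace (c₁ : Colour) (p₁ : Point) (c₂ : Colour) (p₂ : Point) : Prop :=
  c₁ ≠ c₂ ∧ IsCentre c₁ p₁ ∧ IsCentre c₂ p₂ ∧
    sqDist p₁ p₂ = if c₁ = .g ∨ c₂ = .g then 3 else 4

/-- The common face of the two cells is a face of the distance `d` lattice: both cells are cells of
that lattice (this includes the one-dimensional flattenings), or the midpoint of their centres lies
in the cube (this includes the squares on a side of the cube that are part of only one cell). -/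
def IsFace (d : ℕ) (c₁ : Colour) (p₁ : Point) (c₂ : Colour) (p₂ : Point) : Prop :=
  ShareFace c₁ p₁ c₂ p₂ ∧
    ((IsCell d c₁ p₁ ∧ IsCell d c₂ p₂) ∨
      ((0 ≤ p₁.1 + p₂.1 ∧ p₁.1 + p₂.1 ≤ 2 * (2 * d - 2)) ∧
        (0 ≤ p₁.2.1 + p₂.2.1 ∧ p₁.2.1 + p₂.2.1 ≤ 2 * (2 * d - 2)) ∧
        (0 ≤ p₁.2.2 + p₂.2.2 ∧ p₁.2.2 + p₂.2.2 ≤ 2 * (2 * d - 2))))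

/-- The vertices of the distance `d` lattice on the `c`-cell centred at `p`. -/
def cellVertices (d : ℕ) (c : Colour) (p : Point) : Set (Vertex d) :=
  {v | sqDist v.1 p = cellRadius c}

/-- The surface code of colour `c`: `X` stabilizers on `c`-cells, and `Z` stabilizers on the faces
between cells of the two other colours. -/
def surfaceCode (d : ℕ) (c : Colour) : CSSCode (Vertex d) where
  xSupports := {S | ∃ p, IsCell d c p ∧ S = cellVertices d c p}
  zSupports := {S | ∃ c₁ p₁ c₂ p₂, c₁ ≠ c ∧ c₂ ≠ c ∧ IsFace d c₁ p₁ c₂ p₂ ∧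
    S = cellVertices d c₁ p₁ ∩ cellVertices d c₂ p₂}

/-- The qubits at the vertices in `A` which belong to the surface code of colour `c`. -/
def inCode {d : ℕ} (c : Colour) (A : Set (Vertex d)) : Set (Vertex d × Colour) :=
  {q | q.1 ∈ A ∧ q.2 = c}

/-- The stack of the three surface codes, with three qubits at every vertex. -/
def stackCode (d : ℕ) : CSSCode (Vertex d × Colour) where
  xSupports := {S | ∃ c, ∃ A ∈ (surfaceCode d c).xSupports, S = inCode c A}
  zSupports := {S | ∃ c, ∃ A ∈ (surfaceCode d c).zSupports, S = inCode c A}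

/-- The coordinate which is constant on the `c`-boundaries. -/
def coord : Colour → Point → ℤ
  | .r, p => p.1
  | .b, p => p.2.1
  | .g, p => p.2.2

/-- The two opposite `c`-boundaries of the distance `d` lattice. -/
def surfaceBoundary (d : ℕ) (c : Colour) (i : Bool) : Set (Vertex d) :=
  {v | coord c v.1 = if i then 2 * (d : ℤ) - 2 else 0}

/-! ### The code on a single cube and the concatenation -/

/-- The corners of a cube whose three pairs of opposite faces are labelled by the three colours: the
two faces labelled `c` are `{s | s c = 0}` and `{s | s c = 1}`. -/
abbrev Corner : Type := Colour → ZMod 2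

/-- The support of a logical `X` operator of encoded qubit `c`: one of the two `c`-faces. -/
def cubeFace (c : Colour) (k : ZMod 2) : Set Corner := {s | s c = k}

/-- The support of a logical `Z` operator of encoded qubit `c`: an edge linking the two `c`-faces
(the one through the corner `k`). -/
def cubeEdge (c : Colour) (k : Corner) : Set Corner := {s | ∀ c', c' ≠ c → s c' = k c'}

/-- The code on a cube: one `X` stabilizer on all corners, and a `Z` stabilizer on each face. -/
def cubeCode : CSSCode Corner where
  xSupports := {Set.univ}
  zSupports := {S | ∃ c k, S = cubeFace c k}

open scoped Classical in
/-- The encoder of the cube code. The basis state `x` of the three qubits is sent to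
`(|w⟩ + |w + 1⟩) / √2`, where `w = ∑ x_c · (indicator of the c-face s c = 1)`; that is, to the state
obtained from `(|0⋯0⟩ + |1⋯1⟩) / √2` by the logical `X` operators of the `c` with `x c = 1`. -/
noncomputable def cubeAmplitude : Matrix (Corner → ZMod 2) (Colour → ZMod 2) ℂ :=
  Matrix.of fun t x =>
    if ∃ e : ZMod 2, ∀ s, t s = e + ∑ c, x c * s c then ((1 / √2 : ℝ) : ℂ) else 0

noncomputable def cubeEncoder : QState Colour →ₗ[ℂ] QState Corner := cubeAmplitude.mulVecLin

/-- Encode the three qubits at every vertex into a cube code: the tensor product of the cube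
encoders over all vertices. -/
noncomputable def encoder (d : ℕ) : QState (Vertex d × Colour) →ₗ[ℂ] QState (Vertex d × Corner) :=
  (Matrix.of fun (t : Vertex d × Corner → ZMod 2) (x : Vertex d × Colour → ZMod 2) =>
    ∏ v, cubeAmplitude (fun s => t (v, s)) (fun c => x (v, c))).mulVecLin

/-- `X` on `A` in the surface code of colour `c` becomes `X` on a `c`-face of each cube in `A`. -/
def liftX {d : ℕ} (c : Colour) (k : Vertex d → ZMod 2) (A : Set (Vertex d)) :
    Set (Vertex d × Corner) :=
  {q | q.1 ∈ A ∧ q.2 ∈ cubeFace c (k q.1)}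

/-- `Z` on `A` in the surface code of colour `c` becomes `Z` on an edge linking the `c`-faces of
each cube in `A`. -/
def liftZ {d : ℕ} (c : Colour) (k : Vertex d → Corner) (A : Set (Vertex d)) :
    Set (Vertex d × Corner) :=
  {q | q.1 ∈ A ∧ q.2 ∈ cubeEdge c (k q.1)}

/-- The concatenated code: the stabilizers of the cube code at every vertex, and the stabilizers
of the surface codes with every physical operator replaced by a logical one of the cube code. -/
def concatenatedCode (d : ℕ) : CSSCode (Vertex d × Corner) where
  xSupports := {S | (∃ v, ∃ B ∈ cubeCode.xSupports, S = {q | q.1 = v ∧ q.2 ∈ B}) ∨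
    ∃ c k, ∃ A ∈ (surfaceCode d c).xSupports, S = liftX c k A}
  zSupports := {S | (∃ v, ∃ B ∈ cubeCode.zSupports, S = {q | q.1 = v ∧ q.2 ∈ B}) ∨
    ∃ c k, ∃ A ∈ (surfaceCode d c).zSupports, S = liftZ c k A}

/-! ### The cantitruncated cubic lattice and the colour code

The scale is four times that of the rectified lattice: its vertex `v` is replaced by a cube
centred at `4v`, and its cell with centre `p` by a truncated cell with centre `4p`. -/

/-- The point `4p`. -/
def scaled (p : Point) : Point := (4 * p.1, 4 * p.2.1, 4 * p.2.2)

/-- The squared circumradius of the truncated cells. Relative to its centre, a truncated octahedron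
has as vertices the signed permutations of `(0, 2, 3)`, and a truncated cuboctahedron those of
`(1, 2, 4)`. -/
def truncatedRadius : Colour → ℤ
  | .g => 13
  | .r => 21
  | .b => 21

/-- Vertices of the infinite cantitruncated cubic lattice in the cube (`y`-cell) centred at `4v`:
the cube has squared circumradius `5`, and each of its corners is a vertex of one truncated cell of
each colour. -/
def IsCubeVertex (v : Point) (P : Point) : Prop :=
  sqDist P (scaled v) = 5 ∧
    ∀ c, ∃ p, IsCentre c p ∧ sqDist P (scaled p) = truncatedRadius c

open scoped Classical in
/-- The vector from a vertex of the rectified lattice to the centre of one of the two `c`-cells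
containing it (the other one is opposite). -/
noncomputable def cellDirection (c : Colour) (v : Point) : Point :=
  let axis : Point := if Even v.2.2 then (0, 0, 1) else if Odd v.1 then (1, 0, 0) else (0, 1, 0)
  let diag : Point := if Even v.2.2 then (1, 1, 0) else if Odd v.1 then (0, 1, 1) else (1, 0, 1)
  let anti : Point := if Even v.2.2 then (1, -1, 0) else if Odd v.1 then (0, 1, -1) else (1, 0, -1)
  match c with
  | .g => axis
  | .r => if IsCentre .r (v + diag) then diag else anti
  | .b => if IsCentre .b (v + diag) then diag else anti

/-- The point of the cantitruncated lattice at the corner `s` of the cube replacing the vertex `v`;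
the face `s c = 1` of the cube points in direction `cellDirection c v`, and the face `s c = 0` in
the opposite direction. -/
noncomputable def position {d : ℕ} (q : Vertex d × Corner) : Point :=
  scaled q.1.1 + ∑ c, (if q.2 c = 1 then (1 : ℤ) else -1) • cellDirection c q.1.1

/-- The qubits on the `y`-cell (cube) replacing the vertex `v`. -/
def cubeQubits (d : ℕ) (v : Point) : Set (Vertex d × Corner) :=
  {q | sqDist (position q) (scaled v) = 5}

/-- The qubits on the truncated `c`-cell which replaces the `c`-cell centred at `p`. -/
def cellQubits (d : ℕ) (c : Colour) (p : Point) : Set (Vertex d × Corner) :=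
  {q | sqDist (position q) (scaled p) = truncatedRadius c}

/-- The colour code: `X` stabilizers on all cells, and `Z` stabilizers on all faces; the faces are
those between a cube and a truncated cell, and those between two truncated cells. -/
def colourCode (d : ℕ) : CSSCode (Vertex d × Corner) where
  xSupports := {S | (∃ v : Vertex d, S = cubeQubits d v.1) ∨
    ∃ c p, IsCell d c p ∧ S = cellQubits d c p}
  zSupports := {S | (∃ v : Vertex d, ∃ c p, IsCentre c p ∧ sqDist v.1 p = cellRadius c ∧
      S = cubeQubits d v.1 ∩ cellQubits d c p) ∨
    ∃ c₁ p₁ c₂ p₂, IsFace d c₁ p₁ c₂ p₂ ∧ S = cellQubits d c₁ p₁ ∩ cellQubits d c₂ p₂}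

/-- Two qubits lie on a common cell of the given colour (`none` stands for `y`) of the infinite
cantitruncated lattice. -/
def SameCell {d : ℕ} (q q' : Vertex d × Corner) : Option Colour → Prop
  | none => ∃ v, IsVertex v ∧ q ∈ cubeQubits d v ∧ q' ∈ cubeQubits d v
  | some c => ∃ p, IsCentre c p ∧ q ∈ cellQubits d c p ∧ q' ∈ cellQubits d c p

/-- Two qubits are joined by an edge: they are distinct and lie on common cells of three of the
four colours. -/
def AreJoined {d : ℕ} (q q' : Vertex d × Corner) : Prop :=
  q ≠ q' ∧ ∃ c₀, ∀ c, c ≠ c₀ → SameCell q q' c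

/-- The part of the `c`-boundary of the colour code (where no `c`-cell is present) that lies over
one of the two `c`-boundaries of the surface codes. -/
def colourBoundary (d : ℕ) (c : Colour) (i : Bool) : Set (Vertex d × Corner) :=
  {q | q.1 ∈ surfaceBoundary d c i ∧ ∀ p, IsCell d c p → q ∉ cellQubits d c p}

open Matrix Module

/-! ### The stabilizer formalism in terms of linear algebra over the field with two elements -/

/-! Over the field with two elements a CSS code is a pair of subspaces, `xSpace` and `zSpace`,
spanned by the supports of its generators. If these are orthogonal, the stabilizers are exactly X on
a vector of the first times Z on a vector of the second (`mem_stabilizer_iff`), being logical is a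
membership condition (`isLogical_iff`), and the encoded states are the functions on the quotient of
the complement of `zSpace` by `xSpace` (`codeSpaceEquiv`). All parameters reduce to the dimension of
this quotient, recorded in `HasLogicalDim`.

For one cube, the vectors orthogonal to all faces are the affine functions of three bits
(`exists_cubeAffine_iff`). The constant term is the X stabilizer, the linear coefficients are the
three encoded bits, and pairing with an edge in direction `c` reads off the coefficient of `c`. In a
concatenation, a vector commuting with the Z stabilizers is therefore affine on each cube, with its
three coefficient functions commuting with the Z stabilizers of the three surface codes; the X
stabilizers have the same shape (`IsConcatenation.xSpace_eq`, `IsConcatenation.orthSub_zSpace_eq`).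
Neither description depends on the faces and edges chosen as representatives, so all such
concatenations have one stabilizer group. The colour code is among them
(`colourCode_isConcatenation`) because the three cell directions at a vertex are orthogonal: a
truncated cell takes from each of its cubes the face pointing towards it, and the common face of two
truncated cells takes the edge where two such faces meet.

It remains that each surface code encodes one qubit. Regard the `c`-cells as nodes, the vertices as
edges joining two of them, and the Z stabilizers as cycles, relative to the outside where they are
cut off. A vector orthogonal to the Z stabilizers is then a closed cochain, and summing along
columns from one `c`-boundary gives a primitive (`exists_coboundary_eq_g`,
`exists_coboundary_eq_of_ne`). The faces make the sum independent of the path and equal on all full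
columns, so the primitive vanishes beyond the first boundary and is constant beyond the second.
Removing that constant leaves a combination of cells: modulo stabilizers there is only the boundary
membrane (`orthSub_zSpace_le`). Conversely, coboundaries of functions constant beyond each boundary
are closed (`coboundary_mem_orthSub`). The membrane is no stabilizer, since the line where the two
other boundaries meet crosses it once (`boundaryLine_dotProduct`) but meets every `c`-cell evenly
(`boundaryLine_mem_orthSub`). The same intersection parity gives the nontriviality of the string and
the anticommutation. -/

theorem zmod_two_cases (a : ZMod 2) : a = 0 ∨ a = 1 := by
  revert a; decide

theorem zmod_two_add_self (a : ZMod 2) : a + a = 0 := by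
  revert a; decide

theorem pi_zmod_two_add_self {Q : Type} (a : Q → ZMod 2) : a + a = 0 :=
  funext fun q => zmod_two_add_self (a q)

/-- The subset with a given indicator function. -/
def onesOf {Q : Type} (a : Q → ZMod 2) : Set Q := {q | a q = 1}

theorem bits_onesOf {Q : Type} (a : Q → ZMod 2) : bits (onesOf a) = a := by
  funext q
  rcases zmod_two_cases (a q) with h | h <;> simp [bits, onesOf, h]

theorem onesOf_bits {Q : Type} (S : Set Q) : onesOf (bits S) = S := by
  ext q
  simp [bits, onesOf]

theorem bits_empty {Q : Type} : bits (∅ : Set Q) = 0 := by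
  funext q; simp [bits]

/-- The sign character of the field with two elements. -/
noncomputable def sgn (t : ZMod 2) : ℂ := if t = 1 then -1 else 1

theorem sgn_zero : sgn 0 = 1 := by simp [sgn]

theorem sgn_one : sgn 1 = -1 := by simp [sgn]

theorem sgn_add (s t : ZMod 2) : sgn (s + t) = sgn s * sgn t := by
  rcases zmod_two_cases s with rfl | rfl <;> rcases zmod_two_cases t with rfl | rfl <;>
    simp [sgn_zero, sgn_one, zmod_two_add_self]

theorem sgn_eq_one_iff {t : ZMod 2} : sgn t = 1 ↔ t = 0 := by
  rcases zmod_two_cases t with rfl | rfl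
  · simp [sgn_zero]
  · simp only [sgn_one, one_ne_zero, iff_false]; norm_num

theorem sgn_mul_self (t : ZMod 2) : sgn t * sgn t = 1 := by
  rw [← sgn_add, zmod_two_add_self, sgn_zero]

theorem sgn_sum {ι : Type} (s : Finset ι) (f : ι → ZMod 2) :
    sgn (∑ i ∈ s, f i) = ∏ i ∈ s, sgn (f i) := by
  classical
  induction s using Finset.induction_on with
  | empty => simp [sgn_zero]
  | insert i s hi ih => rw [Finset.sum_insert hi, Finset.prod_insert hi, sgn_add, ih]

theorem pauliX_apply {Q : Type} (S : Set Q) (ψ : QState Q) (s : Q → ZMod 2) :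
    pauliX S ψ s = ψ (s + bits S) := rfl

theorem pauliX_empty {Q : Type} : pauliX (∅ : Set Q) = 1 := by
  ext ψ s; simp [pauliX_apply, bits_empty]

section

variable {Q : Type} [Fintype Q]

theorem zPhase_eq_sgn (S : Set Q) (s : Q → ZMod 2) : zPhase S s = sgn (bits S ⬝ᵥ s) := by
  rw [dotProduct, sgn_sum]
  refine Finset.prod_congr rfl fun q _ => ?_
  by_cases h : q ∈ S <;> simp [h, bits, sgn]

theorem pauliZ_apply (S : Set Q) (ψ : QState Q) (s : Q → ZMod 2) :
    pauliZ S ψ s = sgn (bits S ⬝ᵥ s) * ψ s := by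
  rw [← zPhase_eq_sgn]; rfl

/-- The operator `X` on the qubits where `a` is one, times `Z` on those where `b` is one. -/
noncomputable def pauliOp (a b : Q → ZMod 2) : QState Q ≃ₗ[ℂ] QState Q :=
  pauliX (onesOf a) * pauliZ (onesOf b)

theorem pauliOp_apply (a b : Q → ZMod 2) (ψ : QState Q) (s : Q → ZMod 2) :
    pauliOp a b ψ s = sgn (b ⬝ᵥ (s + a)) * ψ (s + a) := by
  rw [pauliOp, LinearEquiv.mul_apply, pauliX_apply, pauliZ_apply, bits_onesOf, bits_onesOf]

theorem pauliX_mul_pauliZ (A B : Set Q) : pauliX A * pauliZ B = pauliOp (bits A) (bits B) := by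
  rw [pauliOp, onesOf_bits, onesOf_bits]

theorem pauliZ_empty : pauliZ (∅ : Set Q) = 1 := by
  ext ψ s; simp [pauliZ_apply, bits_empty, sgn_zero]

theorem pauliX_eq (A : Set Q) : pauliX A = pauliOp (bits A) 0 := by
  rw [← bits_empty, ← pauliX_mul_pauliZ, pauliZ_empty, mul_one]

theorem pauliZ_eq (B : Set Q) : pauliZ B = pauliOp 0 (bits B) := by
  rw [← bits_empty, ← pauliX_mul_pauliZ, pauliX_empty, one_mul]

theorem pauliOp_zero : pauliOp (0 : Q → ZMod 2) 0 = 1 := by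
  ext ψ s; simp [pauliOp_apply, sgn_zero]

/-- The sign is the price of moving the Z part of the first factor past the X part of the second. -/
theorem pauliOp_mul_apply (a b a' b' : Q → ZMod 2) (ψ : QState Q) (s : Q → ZMod 2) :
    (pauliOp a b * pauliOp a' b') ψ s = sgn (b ⬝ᵥ a') * pauliOp (a + a') (b + b') ψ s := by
  rw [LinearEquiv.mul_apply, pauliOp_apply, pauliOp_apply, pauliOp_apply, ← mul_assoc, ← mul_assoc,
    ← sgn_add, ← sgn_add, add_assoc]
  congr 2
  simp only [add_dotProduct, dotProduct_add]
  have := zmod_two_add_self (b ⬝ᵥ a')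
  linear_combination -this

theorem pauliOp_mul {a b a' b' : Q → ZMod 2} (h : b ⬝ᵥ a' = 0) :
    pauliOp a b * pauliOp a' b' = pauliOp (a + a') (b + b') := by
  refine LinearEquiv.ext fun ψ => funext fun s => ?_
  rw [pauliOp_mul_apply, h, sgn_zero, one_mul]

theorem pauliOp_commute_iff (a b a' b' : Q → ZMod 2) :
    pauliOp a b * pauliOp a' b' = pauliOp a' b' * pauliOp a b ↔ b ⬝ᵥ a' = b' ⬝ᵥ a := by
  constructor
  · intro h
    -- On the constant function both products have the same value at `0` up to the two signs, so
    -- this evaluation compares the signs.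
    have h1 := congrFun (LinearEquiv.congr_fun h (fun _ => 1)) 0
    rw [pauliOp_mul_apply, pauliOp_mul_apply, add_comm a', add_comm b', pauliOp_apply, mul_one,
      ← sgn_add, ← sgn_add] at h1
    have h2 := congrArg (· * sgn ((b + b') ⬝ᵥ (0 + (a + a')))) h1
    simp only [← sgn_add] at h2
    rw [add_assoc, add_assoc, zmod_two_add_self, add_zero, add_zero] at h2
    have h3 : sgn (b ⬝ᵥ a' + b' ⬝ᵥ a) = 1 := by rw [sgn_add, h2, sgn_mul_self]
    rw [sgn_eq_one_iff] at h3
    have := zmod_two_add_self (b' ⬝ᵥ a)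
    linear_combination h3 - this
  · intro h
    refine LinearEquiv.ext fun ψ => funext fun s => ?_
    rw [pauliOp_mul_apply, pauliOp_mul_apply, h, add_comm a', add_comm b']

open scoped Classical in
theorem pauliOp_eq_smul {a b a' b' : Q → ZMod 2} {μ : ℂ}
    (h : ∀ ψ, pauliOp a b ψ = μ • pauliOp a' b' ψ) : a = a' ∧ b = b' := by
  have key : ∀ t, a = a' ∧ sgn (b ⬝ᵥ t) = μ * sgn (b' ⬝ᵥ t) := by
    intro t
    -- The left side is a sign at `t + a`, whereas the right side vanishes there unless the two X
    -- parts move the basis vector to the same place.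
    have h1 := congrFun (h (Pi.single t 1)) (t + a)
    rw [pauliOp_apply, Pi.smul_apply, pauliOp_apply, add_assoc, pi_zmod_two_add_self, add_zero,
      Pi.single_eq_same, mul_one, smul_eq_mul] at h1
    by_cases ht : t + a + a' = t
    · have haa : a = a' := by
        have : a + a' = 0 := by rwa [add_assoc, add_eq_left] at ht
        rw [← add_zero a, ← pi_zmod_two_add_self a', ← add_assoc, this, zero_add]
      rw [ht, Pi.single_eq_same, mul_one] at h1
      exact ⟨haa, h1⟩
    · rw [Pi.single_eq_of_ne ht, mul_zero, mul_zero] at h1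
      exfalso
      have := sgn_mul_self (b ⬝ᵥ t)
      rw [h1] at this
      norm_num at this
  refine ⟨(key 0).1, ?_⟩
  have hμ := (key 0).2
  simp only [dotProduct_zero, sgn_zero, mul_one] at hμ
  funext q
  have h1 := (key (Pi.single q 1)).2
  simp only [← hμ, dotProduct_single, mul_one, one_mul] at h1
  rcases zmod_two_cases (b q) with h2 | h2 <;> rcases zmod_two_cases (b' q) with h3 | h3 <;>
    rw [h2, h3] at h1 ⊢ <;> norm_num [sgn] at h1

theorem pauliOp_inj {a b a' b' : Q → ZMod 2} : pauliOp a b = pauliOp a' b' ↔ a = a' ∧ b = b' := by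
  constructor
  · intro h
    exact pauliOp_eq_smul (μ := 1) fun ψ => by rw [h, one_smul]
  · rintro ⟨rfl, rfl⟩; rfl

/-- The orthogonal complement for the standard bilinear form. -/
def orthSub (W : Submodule (ZMod 2) (Q → ZMod 2)) : Submodule (ZMod 2) (Q → ZMod 2) where
  carrier := {a | ∀ b ∈ W, b ⬝ᵥ a = 0}
  add_mem' := fun h h' b hb => by rw [dotProduct_add, h b hb, h' b hb, add_zero]
  zero_mem' := fun b _ => dotProduct_zero b
  smul_mem' := fun t a h b hb => by rw [dotProduct_smul, h b hb, smul_zero]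

theorem mem_orthSub {W : Submodule (ZMod 2) (Q → ZMod 2)} {a : Q → ZMod 2} :
    a ∈ orthSub W ↔ ∀ b ∈ W, b ⬝ᵥ a = 0 := Iff.rfl

theorem mem_orthSub_span {S : Set (Q → ZMod 2)} {a : Q → ZMod 2} :
    a ∈ orthSub (Submodule.span (ZMod 2) S) ↔ ∀ b ∈ S, b ⬝ᵥ a = 0 := by
  refine ⟨fun h b hb => h b (Submodule.subset_span hb), fun h b hb => ?_⟩
  induction hb using Submodule.span_induction with
  | mem x hx => exact h x hx
  | zero => exact zero_dotProduct a
  | add x y _ _ hx hy => rw [add_dotProduct, hx, hy, add_zero]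
  | smul t x _ hx => rw [smul_dotProduct, hx, smul_zero]

open scoped Classical in
-- This identification makes the dimension formula and the double complement for nondegenerate
-- reflexive forms available for `orthSub`.
theorem orthSub_eq_orthogonal (W : Submodule (ZMod 2) (Q → ZMod 2)) :
    orthSub W = LinearMap.BilinForm.orthogonal
      (Matrix.toBilin' (1 : Matrix Q Q (ZMod 2))) W := by
  ext a
  rw [mem_orthSub, LinearMap.BilinForm.mem_orthogonal_iff]
  simp only [Matrix.toBilin'_apply', one_mulVec]

open scoped Classical in
theorem toBilin'_one_nondegenerate :
    (Matrix.toBilin' (1 : Matrix Q Q (ZMod 2))).Nondegenerate :=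
  LinearMap.BilinForm.nondegenerate_toBilin'_of_det_ne_zero' _ (by simp)

open scoped Classical in
theorem toBilin'_one_isRefl : (Matrix.toBilin' (1 : Matrix Q Q (ZMod 2))).IsRefl := by
  intro a b h
  rw [Matrix.toBilin'_apply', one_mulVec] at h ⊢
  rwa [dotProduct_comm]

theorem finrank_orthSub_add (W : Submodule (ZMod 2) (Q → ZMod 2)) :
    finrank (ZMod 2) (orthSub W) + finrank (ZMod 2) W = Fintype.card Q := by
  classical
  have h := LinearMap.BilinForm.finrank_orthogonal (toBilin'_one_nondegenerate (Q := Q)) W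
  rw [← orthSub_eq_orthogonal, finrank_fintype_fun_eq_card] at h
  have h2 := Submodule.finrank_le W
  rw [finrank_fintype_fun_eq_card] at h2
  omega

theorem orthSub_orthSub (W : Submodule (ZMod 2) (Q → ZMod 2)) : orthSub (orthSub W) = W := by
  classical
  rw [orthSub_eq_orthogonal, orthSub_eq_orthogonal,
    LinearMap.BilinForm.orthogonal_orthogonal toBilin'_one_nondegenerate toBilin'_one_isRefl]

end

/-! ### CSS codes as pairs of binary subspaces -/

namespace CSSCode

section

variable {Q : Type}

/-- The space spanned by the supports of the `X` generators. -/
noncomputable def xSpace (C : CSSCode Q) : Submodule (ZMod 2) (Q → ZMod 2) :=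
  Submodule.span (ZMod 2) (bits '' C.xSupports)

/-- The space spanned by the supports of the `Z` generators. -/
noncomputable def zSpace (C : CSSCode Q) : Submodule (ZMod 2) (Q → ZMod 2) :=
  Submodule.span (ZMod 2) (bits '' C.zSupports)

theorem xSpace_onesOf (X : Set (Q → ZMod 2)) (Z : Set (Set Q)) :
    (CSSCode.mk (onesOf '' X) Z).xSpace = Submodule.span (ZMod 2) X := by
  simp only [xSpace, Set.image_image, bits_onesOf, Set.image_id']

theorem zSpace_onesOf (X : Set (Set Q)) (Z : Set (Q → ZMod 2)) :
    (CSSCode.mk X (onesOf '' Z)).zSpace = Submodule.span (ZMod 2) Z := by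
  simp only [zSpace, Set.image_image, bits_onesOf, Set.image_id']

theorem onesOf_image_subset {S : Set (Set Q)} {T : Set (Q → ZMod 2)} (h : T ⊆ bits '' S) :
    onesOf '' T ⊆ S := by
  rintro _ ⟨_, ha, rfl⟩
  obtain ⟨A, hA, rfl⟩ := h ha
  rwa [onesOf_bits]

end

section

variable {Q : Type} [Fintype Q]

/-- The `X` and `Z` generators commute. -/
def IsOrthogonal (C : CSSCode Q) : Prop := C.xSpace ≤ orthSub C.zSpace

theorem IsOrthogonal.dotProduct {C : CSSCode Q} (hC : C.IsOrthogonal) {a b : Q → ZMod 2}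
    (ha : a ∈ C.xSpace) (hb : b ∈ C.zSpace) : b ⬝ᵥ a = 0 := hC ha b hb

theorem IsOrthogonal.mono {C C' : CSSCode Q} (hC : C.IsOrthogonal)
    (hx : C'.xSupports ⊆ C.xSupports) (hz : C'.zSupports ⊆ C.zSupports) : C'.IsOrthogonal :=
  fun _ ha b hb => hC (Submodule.span_mono (Set.image_mono hx) ha) b
    (Submodule.span_mono (Set.image_mono hz) hb)

theorem pauliX_mem_stabilizer (C : CSSCode Q) {a : Q → ZMod 2} (ha : a ∈ C.xSpace) :
    pauliOp a 0 ∈ C.stabilizer := by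
  induction ha using Submodule.span_induction with
  | mem x hx =>
    obtain ⟨S, hS, rfl⟩ := hx
    rw [← pauliX_eq]
    exact Subgroup.subset_closure (Or.inl ⟨S, hS, rfl⟩)
  | zero => rw [pauliOp_zero]; exact one_mem _
  | add x y _ _ hx hy =>
    have := mul_mem hx hy
    rwa [pauliOp_mul (zero_dotProduct _), add_zero] at this
  | smul t x _ hx =>
    rcases zmod_two_cases t with rfl | rfl
    · rw [zero_smul, pauliOp_zero]; exact one_mem _
    · rwa [one_smul]

theorem pauliZ_mem_stabilizer (C : CSSCode Q) {b : Q → ZMod 2} (hb : b ∈ C.zSpace) :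
    pauliOp 0 b ∈ C.stabilizer := by
  induction hb using Submodule.span_induction with
  | mem x hx =>
    obtain ⟨S, hS, rfl⟩ := hx
    rw [← pauliZ_eq]
    exact Subgroup.subset_closure (Or.inr ⟨S, hS, rfl⟩)
  | zero => rw [pauliOp_zero]; exact one_mem _
  | add x y _ _ hx hy =>
    have := mul_mem hx hy
    rwa [pauliOp_mul (dotProduct_zero _), add_zero] at this
  | smul t x _ hx =>
    rcases zmod_two_cases t with rfl | rfl
    · rw [zero_smul, pauliOp_zero]; exact one_mem _
    · rwa [one_smul]

/-- Orthogonality removes the sign when a Z part passes an X part, so these products are closed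
under multiplication and each is its own inverse. -/
theorem mem_stabilizer_iff {C : CSSCode Q} (hC : C.IsOrthogonal)
    {g : QState Q ≃ₗ[ℂ] QState Q} :
    g ∈ C.stabilizer ↔ ∃ a ∈ C.xSpace, ∃ b ∈ C.zSpace, g = pauliOp a b := by
  constructor
  · intro hg
    induction hg using Subgroup.closure_induction with
    | mem g hg =>
      rcases hg with ⟨S, hS, rfl⟩ | ⟨S, hS, rfl⟩
      · exact ⟨_, Submodule.subset_span ⟨S, hS, rfl⟩, 0, zero_mem _, pauliX_eq S⟩
      · exact ⟨0, zero_mem _, _, Submodule.subset_span ⟨S, hS, rfl⟩, pauliZ_eq S⟩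
    | one => exact ⟨0, zero_mem _, 0, zero_mem _, pauliOp_zero.symm⟩
    | mul g h _ _ hg hh =>
      obtain ⟨a, ha, b, hb, rfl⟩ := hg
      obtain ⟨a', ha', b', hb', rfl⟩ := hh
      exact ⟨_, add_mem ha ha', _, add_mem hb hb', pauliOp_mul (hC.dotProduct ha' hb)⟩
    | inv g _ hg =>
      obtain ⟨a, ha, b, hb, rfl⟩ := hg
      refine ⟨a, ha, b, hb, inv_eq_of_mul_eq_one_right ?_⟩
      rw [pauliOp_mul (hC.dotProduct ha hb), pi_zmod_two_add_self, pi_zmod_two_add_self,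
        pauliOp_zero]
  · rintro ⟨a, ha, b, hb, rfl⟩
    have := mul_mem (C.pauliX_mem_stabilizer ha) (C.pauliZ_mem_stabilizer hb)
    rwa [pauliOp_mul (dotProduct_zero _), add_zero, zero_add] at this

theorem pauliOp_mem_stabilizer_iff {C : CSSCode Q} (hC : C.IsOrthogonal) {a b : Q → ZMod 2} :
    pauliOp a b ∈ C.stabilizer ↔ a ∈ C.xSpace ∧ b ∈ C.zSpace := by
  rw [mem_stabilizer_iff hC]
  constructor
  · rintro ⟨a', ha, b', hb, h⟩
    obtain ⟨rfl, rfl⟩ := pauliOp_inj.1 h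
    exact ⟨ha, hb⟩
  · rintro ⟨ha, hb⟩
    exact ⟨a, ha, b, hb, rfl⟩

theorem pauliX_mem_stabilizer_iff {C : CSSCode Q} (hC : C.IsOrthogonal) {A : Set Q} :
    pauliX A ∈ C.stabilizer ↔ bits A ∈ C.xSpace := by
  rw [pauliX_eq, pauliOp_mem_stabilizer_iff hC]
  exact and_iff_left (zero_mem _)

theorem pauliZ_mem_stabilizer_iff {C : CSSCode Q} (hC : C.IsOrthogonal) {A : Set Q} :
    pauliZ A ∈ C.stabilizer ↔ bits A ∈ C.zSpace := by
  rw [pauliZ_eq, pauliOp_mem_stabilizer_iff hC]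
  exact and_iff_right (zero_mem _)

theorem stabilizer_eq_of_spaces_eq {C C' : CSSCode Q} (hC : C.IsOrthogonal)
    (hx : C'.xSpace = C.xSpace) (hz : C'.zSpace = C.zSpace) : C'.stabilizer = C.stabilizer := by
  have hC' : C'.IsOrthogonal := by rw [IsOrthogonal, hx, hz]; exact hC
  ext g
  rw [mem_stabilizer_iff hC, mem_stabilizer_iff hC', hx, hz]

theorem neg_ne_pauliOp (a b : Q → ZMod 2) : LinearEquiv.neg ℂ ≠ pauliOp a b := by
  intro h
  have h1 : ∀ ψ, pauliOp a b ψ = (-1 : ℂ) • pauliOp (0 : Q → ZMod 2) 0 ψ := fun ψ => by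
    rw [← h, pauliOp_zero]; simp
  obtain ⟨rfl, rfl⟩ := pauliOp_eq_smul h1
  have h2 := congrFun (h1 fun _ => 1) 0
  simp [pauliOp_apply, sgn_zero] at h2
  norm_num at h2

theorem IsOrthogonal.isValid {C : CSSCode Q} (hC : C.IsOrthogonal) : C.IsValid := by
  refine ⟨fun g hg h hh => ?_, fun h => ?_⟩
  · obtain ⟨a, ha, b, hb, rfl⟩ := (mem_stabilizer_iff hC).1 hg
    obtain ⟨a', ha', b', hb', rfl⟩ := (mem_stabilizer_iff hC).1 hh
    rw [pauliOp_commute_iff, hC.dotProduct ha' hb, hC.dotProduct ha hb']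
  · obtain ⟨a, _, b, _, h⟩ := (mem_stabilizer_iff hC).1 h
    exact neg_ne_pauliOp a b h

/-- Commuting with Z stabilizers constrains only the X part, and commuting with X stabilizers only
the Z part. Proportional Pauli operators have equal supports, so triviality is membership in both
subspaces. -/
theorem isLogical_iff {C : CSSCode Q} (hC : C.IsOrthogonal) {A B : Set Q} :
    C.IsLogical A B ↔ (bits A ∈ orthSub C.zSpace ∧ bits B ∈ orthSub C.xSpace) ∧
      ¬ (bits A ∈ C.xSpace ∧ bits B ∈ C.zSpace) := by
  rw [IsLogical, pauliX_mul_pauliZ]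
  refine and_congr ⟨fun h => ⟨fun b hb => ?_, fun a ha => ?_⟩, fun h g hg => ?_⟩ (not_congr ?_)
  · have := h _ (C.pauliZ_mem_stabilizer hb)
    rw [pauliOp_commute_iff, dotProduct_zero] at this
    exact this.symm
  · have := h _ (C.pauliX_mem_stabilizer ha)
    rw [pauliOp_commute_iff, zero_dotProduct] at this
    rw [dotProduct_comm]; exact this
  · obtain ⟨a, ha, b, hb, rfl⟩ := (mem_stabilizer_iff hC).1 hg
    rw [pauliOp_commute_iff, dotProduct_comm, h.2 a ha, h.1 b hb]
  · constructor
    · rintro ⟨g, hg, μ, h⟩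
      obtain ⟨a, ha, b, hb, rfl⟩ := (mem_stabilizer_iff hC).1 hg
      obtain ⟨rfl, rfl⟩ := pauliOp_eq_smul h
      exact ⟨ha, hb⟩
    · rintro h
      exact ⟨_, (pauliOp_mem_stabilizer_iff hC).2 h, 1, fun ψ => (one_smul _ _).symm⟩

theorem isLogical_x_iff {C : CSSCode Q} (hC : C.IsOrthogonal) {A : Set Q} :
    C.IsLogical A ∅ ↔ bits A ∈ orthSub C.zSpace ∧ bits A ∉ C.xSpace := by
  rw [isLogical_iff hC, bits_empty]
  simp [zero_mem]

theorem isLogical_z_iff {C : CSSCode Q} (hC : C.IsOrthogonal) {A : Set Q} :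
    C.IsLogical ∅ A ↔ bits A ∈ orthSub C.xSpace ∧ bits A ∉ C.zSpace := by
  rw [isLogical_iff hC, bits_empty]
  simp [zero_mem]

theorem mem_codeSpace_iff {C : CSSCode Q} {ψ : QState Q} :
    ψ ∈ C.codeSpace ↔ (∀ S ∈ C.xSupports, pauliX S ψ = ψ) ∧ ∀ S ∈ C.zSupports, pauliZ S ψ = ψ := by
  constructor
  · intro h
    exact ⟨fun S hS => h _ (Subgroup.subset_closure (Or.inl ⟨S, hS, rfl⟩)),
      fun S hS => h _ (Subgroup.subset_closure (Or.inr ⟨S, hS, rfl⟩))⟩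
  · rintro ⟨hx, hz⟩ g hg
    induction hg using Subgroup.closure_induction with
    | mem g hg =>
      rcases hg with ⟨S, hS, rfl⟩ | ⟨S, hS, rfl⟩
      · exact hx S hS
      · exact hz S hS
    | one => rfl
    | mul g h _ _ hg hh => rw [LinearEquiv.mul_apply, hh, hg]
    | inv g _ hg =>
      have h1 : (g⁻¹ * g) ψ = ψ := by rw [inv_mul_cancel]; rfl
      rwa [LinearEquiv.mul_apply, hg] at h1

/-- A state is encoded if and only if its coordinates are constant on the cosets of the space of
`X` stabilizers, and vanish off the orthogonal complement of the space of `Z` stabilizers. -/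
theorem mem_codeSpace_iff_coordinates {C : CSSCode Q} {ψ : QState Q} :
    ψ ∈ C.codeSpace ↔ (∀ a ∈ C.xSpace, ∀ s, ψ (s + a) = ψ s) ∧
      ∀ s, s ∉ orthSub C.zSpace → ψ s = 0 := by
  constructor
  · intro h
    refine ⟨fun a ha s => ?_, fun s hs => ?_⟩
    · have := congrFun (h _ (C.pauliX_mem_stabilizer ha)) s
      rwa [pauliOp_apply, zero_dotProduct, sgn_zero, one_mul] at this
    · rw [mem_orthSub] at hs
      push Not at hs
      obtain ⟨b, hb, hbs⟩ := hs
      have := congrFun (h _ (C.pauliZ_mem_stabilizer hb)) s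
      rw [pauliOp_apply, add_zero, (zmod_two_cases _).resolve_left hbs, sgn_one] at this
      linear_combination -this / 2
  · rintro ⟨hx, hz⟩
    refine mem_codeSpace_iff.2 ⟨fun S hS => funext fun s => ?_, fun S hS => funext fun s => ?_⟩
    · exact hx _ (Submodule.subset_span ⟨S, hS, rfl⟩) s
    · rw [pauliZ_apply]
      by_cases h : s ∈ orthSub C.zSpace
      · rw [h _ (Submodule.subset_span ⟨S, hS, rfl⟩), sgn_zero, one_mul]
      · rw [hz s h, mul_zero]

open scoped Classical in
/-- The encoded states are the functions on the quotient of the space orthogonal to the `Z`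
stabilizers by the space of `X` stabilizers. -/
noncomputable def codeSpaceEquiv {C : CSSCode Q} (hC : C.IsOrthogonal) :
    ((orthSub C.zSpace ⧸ C.xSpace.submoduleOf (orthSub C.zSpace)) → ℂ) ≃ₗ[ℂ] C.codeSpace where
  toFun f := ⟨fun s => if h : s ∈ orthSub C.zSpace then f (Submodule.Quotient.mk ⟨s, h⟩) else 0, by
    refine mem_codeSpace_iff_coordinates.2 ⟨fun a ha s => ?_, fun s hs => dif_neg hs⟩
    by_cases hs : s ∈ orthSub C.zSpace
    · rw [dif_pos hs, dif_pos (add_mem hs (hC ha))]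
      congr 1
      rw [Submodule.Quotient.eq, Submodule.submoduleOf, Submodule.mem_comap]
      simpa using ha
    · rw [dif_neg hs, dif_neg fun h => hs ((Submodule.add_mem_iff_left _ (hC ha)).1 h)]⟩
  invFun ψ := fun x => Quotient.liftOn' x (fun s => ψ.1 s.1) (by
    intro s t hst
    rw [Submodule.quotientRel_def, Submodule.submoduleOf, Submodule.mem_comap] at hst
    have := (mem_codeSpace_iff_coordinates.1 ψ.2).1 _ hst t.1
    rw [← this]
    simp)
  map_add' f g := by
    ext s
    by_cases h : s ∈ orthSub C.zSpace <;> simp [h]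
  map_smul' t f := by
    ext s
    by_cases h : s ∈ orthSub C.zSpace <;> simp [h]
  left_inv f := by
    funext x
    induction x using Submodule.Quotient.induction_on with
    | H s => exact dif_pos s.2
  right_inv ψ := by
    ext s
    by_cases h : s ∈ orthSub C.zSpace
    · exact dif_pos h
    · simp only [h, dif_neg, not_false_eq_true]
      exact ((mem_codeSpace_iff_coordinates.1 ψ.2).2 s h).symm

/-- The linear algebra behind a code with `k` logical qubits: the generators commute, and the
`X` operators commuting with the `Z` stabilizers exceed the `X` stabilizers by `k` dimensions. -/
def HasLogicalDim (C : CSSCode Q) (k : ℕ) : Prop :=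
  C.IsOrthogonal ∧ finrank (ZMod 2) (orthSub C.zSpace) = finrank (ZMod 2) C.xSpace + k

/-- The quotient has dimension `k` over the field with two elements, hence `2 ^ k` points, and the
code space is the space of functions on it. -/
theorem HasLogicalDim.encodesQubits {C : CSSCode Q} {k : ℕ} (h : C.HasLogicalDim k) :
    C.EncodesQubits k := by
  have h1 := (C.xSpace.submoduleOf (orthSub C.zSpace)).finrank_quotient_add_finrank
  have h2 : finrank (ZMod 2) (C.xSpace.submoduleOf (orthSub C.zSpace)) =
      finrank (ZMod 2) C.xSpace := (Submodule.submoduleOfEquivOfLe h.1).finrank_eq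
  have hk : finrank (ZMod 2) (orthSub C.zSpace ⧸ C.xSpace.submoduleOf (orthSub C.zSpace)) = k := by
    have := h.2
    omega
  have : Finite (orthSub C.zSpace ⧸ C.xSpace.submoduleOf (orthSub C.zSpace)) :=
    Module.finite_of_finite (ZMod 2)
  have := Fintype.ofFinite (orthSub C.zSpace ⧸ C.xSpace.submoduleOf (orthSub C.zSpace))
  rw [EncodesQubits, ← (codeSpaceEquiv h.1).finrank_eq, finrank_fintype_fun_eq_card,
    Module.card_eq_pow_finrank (K := ZMod 2), hk, ZMod.card]

theorem generators_onesOf (X Z : Set (Q → ZMod 2)) :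
    (CSSCode.mk (onesOf '' X) (onesOf '' Z)).generators =
      (fun a => pauliOp a 0) '' X ∪ (fun b => pauliOp 0 b) '' Z := by
  simp only [generators, Set.image_image, pauliX_eq, pauliZ_eq, bits_onesOf]

/-- Choose a basis of each subspace among the generating supports. Membership in the group generated
by a subfamily is membership in the spans, so no basis element can be dropped. -/
theorem IsOrthogonal.hasIndependentGenerators {C : CSSCode Q} (hC : C.IsOrthogonal) :
    C.HasIndependentGenerators
      (finrank (ZMod 2) C.xSpace + finrank (ZMod 2) C.zSpace) := by
  obtain ⟨X, hXC, hX, hXi⟩ := exists_linearIndependent (ZMod 2) (bits '' C.xSupports)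
  obtain ⟨Z, hZC, hZ, hZi⟩ := exists_linearIndependent (ZMod 2) (bits '' C.zSupports)
  have hXC' := onesOf_image_subset hXC
  have hZC' := onesOf_image_subset hZC
  have horth : (CSSCode.mk (onesOf '' X) (onesOf '' Z)).IsOrthogonal := hC.mono hXC' hZC'
  have hXf : X.Finite := Set.toFinite X
  have hZf : Z.Finite := Set.toFinite Z
  have hXcard : X.ncard = finrank (ZMod 2) C.xSpace := by
    have := Fintype.ofFinite X
    rw [xSpace, ← hX, finrank_span_set_eq_card hXi, Set.ncard_eq_toFinset_card']
  have hZcard : Z.ncard = finrank (ZMod 2) C.zSpace := by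
    have := Fintype.ofFinite Z
    rw [zSpace, ← hZ, finrank_span_set_eq_card hZi, Set.ncard_eq_toFinset_card']
  have hXinj : Function.Injective fun a : Q → ZMod 2 => pauliOp a 0 :=
    fun a a' h => (pauliOp_inj.1 h).1
  have hZinj : Function.Injective fun b : Q → ZMod 2 => pauliOp 0 b :=
    fun b b' h => (pauliOp_inj.1 h).2
  -- The identity is the only operator of both types; excluding it makes the two families disjoint,
  -- so that their sizes add.
  have hX0 : (0 : Q → ZMod 2) ∉ X := fun h => hXi.ne_zero ⟨0, h⟩ rfl
  have hsub : ∀ {X' Z' : Set (Q → ZMod 2)}, X' ⊆ X → Z' ⊆ Z →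
      (CSSCode.mk (onesOf '' X') (onesOf '' Z')).IsOrthogonal := fun hX' hZ' =>
    horth.mono (Set.image_mono hX') (Set.image_mono hZ')
  refine ⟨(CSSCode.mk (onesOf '' X) (onesOf '' Z)).generators, ?_, ?_, ?_, ?_, ?_⟩
  · exact Set.union_subset_union (Set.image_mono hXC') (Set.image_mono hZC')
  · rw [generators_onesOf]
    exact (hXf.image _).union (hZf.image _)
  · rw [generators_onesOf, Set.ncard_union_eq ?_ (hXf.image _) (hZf.image _),
      Set.ncard_image_of_injective _ hXinj, Set.ncard_image_of_injective _ hZinj, hXcard, hZcard]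
    rw [Set.disjoint_left]
    rintro _ ⟨a, ha, rfl⟩ ⟨b, _, h⟩
    exact hX0 ((pauliOp_inj.1 h).1 ▸ ha)
  · exact stabilizer_eq_of_spaces_eq hC (by rw [xSpace_onesOf, hX, xSpace])
      (by rw [zSpace_onesOf, hZ, zSpace])
  · rw [generators_onesOf]
    rintro _ (⟨a, ha, rfl⟩ | ⟨b, hb, rfl⟩) hmem
    · have h1 : pauliOp a 0 ∈
          (CSSCode.mk (onesOf '' (X \ {a})) (onesOf '' Z)).stabilizer := by
        refine Subgroup.closure_mono ?_ hmem
        rw [generators_onesOf]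
        rintro _ ⟨⟨a', ha', rfl⟩ | h, hne⟩
        · exact Or.inl ⟨a', ⟨ha', fun h => hne (by rw [h]; rfl)⟩, rfl⟩
        · exact Or.inr h
      rw [pauliOp_mem_stabilizer_iff (hsub Set.sdiff_subset subset_rfl), xSpace_onesOf] at h1
      exact (linearIndepOn_iff_notMem_span (v := id) (s := X)).1 hXi a ha (by simpa using h1.1)
    · have h1 : pauliOp 0 b ∈
          (CSSCode.mk (onesOf '' X) (onesOf '' (Z \ {b}))).stabilizer := by
        refine Subgroup.closure_mono ?_ hmem
        rw [generators_onesOf]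
        rintro _ ⟨h | ⟨b', hb', rfl⟩, hne⟩
        · exact Or.inl h
        · exact Or.inr ⟨b', ⟨hb', fun h => hne (by rw [h]; rfl)⟩, rfl⟩
      rw [pauliOp_mem_stabilizer_iff (hsub subset_rfl Set.sdiff_subset), zSpace_onesOf] at h1
      exact (linearIndepOn_iff_notMem_span (v := id) (s := Z)).1 hZi b hb (by simpa using h1.2)

/-- The rank of `zSpace` is the number of qubits minus the dimension of its complement, and that
dimension exceeds the rank of `xSpace` by `k`. -/
theorem HasLogicalDim.hasIndependentGenerators {C : CSSCode Q} {k : ℕ} (h : C.HasLogicalDim k) :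
    C.HasIndependentGenerators (Fintype.card Q - k) := by
  have h1 := h.1.hasIndependentGenerators
  have h2 := finrank_orthSub_add C.zSpace
  have h3 := h.2
  rwa [show Fintype.card Q - k = finrank (ZMod 2) C.xSpace + finrank (ZMod 2) C.zSpace by omega]

end

end CSSCode

/-! ### The cube code and the encoder -/

theorem bits_mem {Q : Type} {S : Set Q} {q : Q} (h : q ∈ S) : bits S q = 1 := by simp [bits, h]

theorem bits_notMem {Q : Type} {S : Set Q} {q : Q} (h : q ∉ S) : bits S q = 0 := by simp [bits, h]

theorem bits_dotProduct {Q : Type} [Fintype Q] {S : Set Q} {p : Q → Prop} [DecidablePred p]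
    (hp : ∀ q, q ∈ S ↔ p q) (f : Q → ZMod 2) : bits S ⬝ᵥ f = ∑ q, if p q then f q else 0 := by
  refine Finset.sum_congr rfl fun q _ => ?_
  by_cases h : p q <;> simp [bits, hp, h]

theorem bits_dotProduct_eq {Q : Type} [Fintype Q] {S : Set Q} (T : Finset Q) (f : Q → ZMod 2)
    (h : ∀ q, q ∈ S ↔ q ∈ T) : bits S ⬝ᵥ f = ∑ q ∈ T, f q := by
  classical
  rw [bits_dotProduct h, ← Finset.sum_filter]
  simp

theorem sum_colour {M : Type*} [AddCommMonoid M] (f : Colour → M) :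
    ∑ c, f c = f .r + (f .g + f .b) := by
  change ∑ c ∈ ({.r, .g, .b} : Finset Colour), f c = _
  rw [Finset.sum_insert (by decide), Finset.sum_insert (by decide), Finset.sum_singleton]

/-- The corner with given coordinates. -/
def corner (x y z : ZMod 2) : Corner
  | .r => x
  | .g => y
  | .b => z

theorem corner_eta (s : Corner) : corner (s .r) (s .g) (s .b) = s := by
  funext c; cases c <;> rfl

/-- Corners are triples of coordinates. -/
def cornerEquiv : ZMod 2 × ZMod 2 × ZMod 2 ≃ Corner where
  toFun p := corner p.1 p.2.1 p.2.2
  invFun s := (s .r, s .g, s .b)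
  left_inv _ := rfl
  right_inv := corner_eta

theorem sum_zmod_two {M : Type*} [AddCommMonoid M] (f : ZMod 2 → M) : ∑ t, f t = f 0 + f 1 :=
  Fin.sum_univ_two f

theorem sum_corner {M : Type*} [AddCommMonoid M] (f : Corner → M) :
    ∑ s, f s = ∑ x, ∑ y, ∑ z, f (corner x y z) := by
  rw [← cornerEquiv.sum_comp, Fintype.sum_prod_type]
  simp_rw [Fintype.sum_prod_type]
  rfl

theorem card_corner : Fintype.card Corner = 8 := by
  rw [← Fintype.card_congr cornerEquiv]; simp [ZMod.card]

/-- The affine function with constant term `e` and linear coefficients `x` on the corners. -/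
def cubeAffine : ZMod 2 × (Colour → ZMod 2) →ₗ[ZMod 2] (Corner → ZMod 2) where
  toFun p s := p.1 + ∑ c, p.2 c * s c
  map_add' p p' := by
    funext s
    simp only [Prod.fst_add, Prod.snd_add, Pi.add_apply, add_mul, Finset.sum_add_distrib]
    ring
  map_smul' t p := by
    funext s
    simp only [Prod.smul_fst, Prod.smul_snd, Pi.smul_apply, smul_eq_mul, RingHom.id_apply,
      mul_assoc, mul_add, Finset.mul_sum]

theorem cubeAffine_apply (e : ZMod 2) (x : Colour → ZMod 2) (s : Corner) :
    cubeAffine (e, x) s = e + ∑ c, x c * s c := rfl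

theorem cubeAffine_add_single (e : ZMod 2) (x : Colour → ZMod 2) (s : Corner) (c : Colour) :
    cubeAffine (e, x) (s + Pi.single c 1) = cubeAffine (e, x) s + x c := by
  simp only [cubeAffine_apply, Pi.add_apply, mul_add, Finset.sum_add_distrib]
  rw [Finset.sum_eq_single (f := fun c' => x c' * (Pi.single c 1 : Corner) c') c
    (by intro c' _ h; simp [h]) (by simp)]
  simp [add_assoc]

theorem cubeAffine_injective : Function.Injective cubeAffine := by
  rintro ⟨e, x⟩ ⟨e', x'⟩ h
  have h0 := congrFun h 0
  simp only [cubeAffine_apply, Pi.zero_apply, mul_zero, Finset.sum_const_zero, add_zero] at h0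
  subst h0
  have hx : x = x' := by
    funext c
    have h1 := congrFun h (0 + Pi.single c 1)
    rw [cubeAffine_add_single, cubeAffine_add_single, h] at h1
    exact add_left_cancel h1
  rw [hx]

theorem mem_cubeFace_iff {c : Colour} {k : ZMod 2} {s : Corner} : s ∈ cubeFace c k ↔ s c = k :=
  Iff.rfl

theorem bits_cubeFace (c : Colour) (k : ZMod 2) :
    bits (cubeFace c k) = cubeAffine (k + 1, Pi.single c 1) := by
  funext s
  rw [cubeAffine_apply, Finset.sum_eq_single c (by intro c' _ h; simp [h]) (by simp),
    Pi.single_eq_same, one_mul]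
  have h : ∀ a b : ZMod 2, (if a = b then 1 else 0) = b + 1 + a := by decide
  rw [← h]
  simp only [bits, mem_cubeFace_iff]

theorem cubeEdge_eq (c : Colour) (k : Corner) : cubeEdge c k = {k, k + Pi.single c 1} := by
  ext s
  simp only [cubeEdge, Set.mem_ofPred_eq, Set.mem_insert_iff, Set.mem_singleton_iff]
  have h2 : ∀ a b : ZMod 2, a = b ∨ a = b + 1 := by decide
  constructor
  · intro h
    refine (h2 (s c) (k c)).imp (fun hc => ?_) (fun hc => ?_) <;> funext c' <;>
      rcases eq_or_ne c' c with rfl | hne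
    · exact hc
    · exact h c' hne
    · simpa using hc
    · simpa [hne] using h c' hne
  · rintro (rfl | rfl) c' hne
    · rfl
    · simp [hne]

theorem ne_add_single (c : Colour) (k : Corner) : k ≠ k + Pi.single c 1 := fun h => by
  have := congrFun h c
  simp at this

/-- An edge acts as a finite difference in direction `c`. On an affine function this is the
coefficient of `c`, whichever of the parallel edges is used. -/
theorem bits_cubeEdge_dotProduct (c : Colour) (k : Corner) (t : Corner → ZMod 2) :
    bits (cubeEdge c k) ⬝ᵥ t = t k + t (k + Pi.single c 1) := by
  rw [cubeEdge_eq, bits_dotProduct_eq {k, k + Pi.single c 1} t (by simp),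
    Finset.sum_pair (ne_add_single c k)]

theorem bits_cubeFace_dotProduct (c : Colour) (k : ZMod 2) (t : Corner → ZMod 2) :
    bits (cubeFace c k) ⬝ᵥ t = ∑ s : Corner, if s c = k then t s else 0 := by
  exact bits_dotProduct (fun _ => mem_cubeFace_iff) t

/-- The functions with sum zero on each face of the cube are the affine ones. -/
theorem exists_cubeAffine_iff (t : Corner → ZMod 2) :
    (∀ c k, bits (cubeFace c k) ⬝ᵥ t = 0) ↔ ∃ p, t = cubeAffine p := by
  simp only [bits_cubeFace_dotProduct]
  constructor
  · intro h
    -- The constant term is the value at the origin, and the coefficients are the differences along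
    -- the three edges there.
    refine ⟨(t (corner 0 0 0), fun c => t (corner 0 0 0) + t (Pi.single c 1)), ?_⟩
    have e1 : (Pi.single .r 1 : Corner) = corner 1 0 0 := by funext c; cases c <;> rfl
    have e2 : (Pi.single .g 1 : Corner) = corner 0 1 0 := by funext c; cases c <;> rfl
    have e3 : (Pi.single .b 1 : Corner) = corner 0 0 1 := by funext c; cases c <;> rfl
    -- The three faces through the origin fix the values at the corners with two ones; the opposite
    -- face `.r 1` then fixes the last value.
    have hr := h .r 0
    have hg := h .g 0
    have hb := h .b 0
    have hr1 := h .r 1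
    simp [sum_corner, sum_zmod_two, corner] at hr hg hb hr1
    funext s
    rw [cubeAffine_apply, sum_colour, e1, e2, e3]
    rw [← corner_eta s]
    generalize s .r = x, s .g = y, s .b = z
    simp only [corner]
    clear h e1 e2 e3
    rcases zmod_two_cases x with rfl | rfl <;> rcases zmod_two_cases y with rfl | rfl <;>
      rcases zmod_two_cases z with rfl | rfl <;>
    generalize t (corner 0 0 0) = t0, t (corner 0 0 1) = t1, t (corner 0 1 0) = t2,
      t (corner 0 1 1) = t3, t (corner 1 0 0) = t4, t (corner 1 0 1) = t5,
      t (corner 1 1 0) = t6, t (corner 1 1 1) = t7 at * <;>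
    revert t0 t1 t2 t3 t4 t5 t6 t7 <;> decide
  · rintro ⟨⟨e, x⟩, rfl⟩ c k
    rw [sum_corner]
    simp only [sum_zmod_two, cubeAffine_apply, sum_colour, corner]
    cases c <;> rcases zmod_two_cases k with rfl | rfl <;> simp <;>
      generalize x .r = a, x .g = b, x .b = c <;> revert e a b c <;> decide

theorem cubeAmplitude_of_eq {t : Corner → ZMod 2} {x : Colour → ZMod 2} {e : ZMod 2}
    (h : t = cubeAffine (e, x)) : cubeAmplitude t x = ((1 / √2 : ℝ) : ℂ) :=
  if_pos ⟨e, fun s => congrFun h s⟩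

theorem cubeAmplitude_of_forall_ne {t : Corner → ZMod 2} {x : Colour → ZMod 2}
    (h : ∀ e, t ≠ cubeAffine (e, x)) : cubeAmplitude t x = 0 :=
  if_neg fun ⟨e, he⟩ => h e (funext he)

theorem cubeAmplitude_congr {t t' : Corner → ZMod 2} {x x' : Colour → ZMod 2}
    (h : (∃ e, t = cubeAffine (e, x)) ↔ ∃ e, t' = cubeAffine (e, x')) :
    cubeAmplitude t x = cubeAmplitude t' x' := by
  by_cases hx : ∃ e, t = cubeAffine (e, x)
  · obtain ⟨e', he'⟩ := h.1 hx
    obtain ⟨e, he⟩ := hx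
    rw [cubeAmplitude_of_eq he, cubeAmplitude_of_eq he']
  · rw [cubeAmplitude_of_forall_ne (not_exists.1 hx),
      cubeAmplitude_of_forall_ne (not_exists.1 fun h' => hx (h.2 h'))]

theorem bits_singleton {Q : Type} [DecidableEq Q] (q : Q) : bits {q} = Pi.single q 1 := by
  funext q'
  by_cases h : q' = q
  · subst h; simp [bits]
  · simp [bits, h]

/-- Adding the indicator of a `c`-face changes the coefficient of `c` and possibly the constant
term. The amplitude ignores the constant term, so both `c`-faces act alike. -/
theorem cubeAmplitude_add_bits (c : Colour) (k : ZMod 2) (t : Corner → ZMod 2)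
    (x : Colour → ZMod 2) :
    cubeAmplitude t (x + bits {c}) = cubeAmplitude (t + bits (cubeFace c k)) x := by
  have h2 : ∀ a b : Corner → ZMod 2, a + b + b = a := fun a b => by
    rw [add_assoc, pi_zmod_two_add_self, add_zero]
  refine cubeAmplitude_congr ?_
  rw [bits_singleton, bits_cubeFace]
  constructor <;> rintro ⟨e, he⟩ <;> refine ⟨e + (k + 1), ?_⟩
  · rw [he, ← map_add, Prod.mk_add_mk, add_assoc, ← bits_singleton, pi_zmod_two_add_self, add_zero]
  · rw [← h2 t, he, ← map_add, Prod.mk_add_mk]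

/-- Where the amplitude is nonzero, `t` is affine with linear part `x`, so every edge in direction
`c` reads off `x c`. -/
theorem cubeAmplitude_phase (c : Colour) (k : Corner) (t : Corner → ZMod 2)
    (x : Colour → ZMod 2) :
    cubeAmplitude t x * sgn (x c) = sgn (bits (cubeEdge c k) ⬝ᵥ t) * cubeAmplitude t x := by
  by_cases hx : ∃ e, t = cubeAffine (e, x)
  · obtain ⟨e, rfl⟩ := hx
    rw [bits_cubeEdge_dotProduct, cubeAffine_add_single, ← add_assoc, zmod_two_add_self, zero_add,
      mul_comm]
  · rw [cubeAmplitude_of_forall_ne (not_exists.1 hx), zero_mul, mul_zero]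

theorem star_cubeAmplitude (t : Corner → ZMod 2) (x : Colour → ZMod 2) :
    star (cubeAmplitude t x) = cubeAmplitude t x := by
  by_cases hx : ∃ e, t = cubeAffine (e, x)
  · obtain ⟨e, he⟩ := hx
    rw [cubeAmplitude_of_eq he]
    exact Complex.conj_ofReal _
  · rw [cubeAmplitude_of_forall_ne (not_exists.1 hx), star_zero]

/-- Each column is supported on the two affine functions with a given linear part, with squared
amplitude one half each. Different linear parts give disjoint supports. -/
theorem sum_cubeAmplitude_mul (x y : Colour → ZMod 2) :
    ∑ t, cubeAmplitude t x * cubeAmplitude t y = if x = y then 1 else 0 := by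
  classical
  split_ifs with h
  · subst h
    have hinj : Function.Injective fun e => cubeAffine (e, x) := fun e e' h =>
      congrArg Prod.fst (cubeAffine_injective h)
    rw [← Finset.sum_subset (Finset.subset_univ (Finset.univ.image fun e => cubeAffine (e, x)))]
    · rw [Finset.sum_image hinj.injOn, Finset.sum_congr rfl fun e _ => by
        rw [cubeAmplitude_of_eq rfl], Finset.sum_const, Finset.card_univ, ZMod.card,
        ← Complex.ofReal_mul, div_mul_div_comm, Real.mul_self_sqrt (by norm_num)]
      norm_num
    · intro t _ ht
      rw [cubeAmplitude_of_forall_ne, zero_mul]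
      rintro e rfl
      exact ht (Finset.mem_image_of_mem _ (Finset.mem_univ e))
  · refine Finset.sum_eq_zero fun t _ => ?_
    by_cases hx : ∃ e, t = cubeAffine (e, x)
    · obtain ⟨e, rfl⟩ := hx
      rw [cubeAmplitude_of_forall_ne (x := y), mul_zero]
      intro e' h'
      exact h (congrArg Prod.snd (cubeAffine_injective h'))
    · rw [cubeAmplitude_of_forall_ne (not_exists.1 hx), zero_mul]

theorem cubeEncoder_apply (ψ : QState Colour) (t : Corner → ZMod 2) :
    cubeEncoder ψ t = ∑ x, cubeAmplitude t x * ψ x := rfl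

theorem sum_add_bits {Q : Type} [Fintype Q] [DecidableEq Q] {M : Type*} [AddCommMonoid M]
    (S : Set Q) (f : (Q → ZMod 2) → M) : ∑ x, f (x + bits S) = ∑ x, f x :=
  Equiv.sum_comp (Equiv.addRight (bits S)) f

theorem cubeEncoder_pauliX (c : Colour) (k : ZMod 2) (ψ : QState Colour) :
    cubeEncoder (pauliX {c} ψ) = pauliX (cubeFace c k) (cubeEncoder ψ) := by
  funext t
  rw [pauliX_apply, cubeEncoder_apply, cubeEncoder_apply, ← sum_add_bits {c}]
  refine Finset.sum_congr rfl fun x _ => ?_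
  rw [pauliX_apply, add_bits_add_bits, cubeAmplitude_add_bits]

theorem cubeEncoder_pauliZ (c : Colour) (k : Corner) (ψ : QState Colour) :
    cubeEncoder (pauliZ {c} ψ) = pauliZ (cubeEdge c k) (cubeEncoder ψ) := by
  funext t
  rw [pauliZ_apply, cubeEncoder_apply, cubeEncoder_apply, Finset.mul_sum]
  refine Finset.sum_congr rfl fun x _ => ?_
  rw [pauliZ_apply, bits_singleton, single_dotProduct, one_mul, ← mul_assoc, ← mul_assoc,
    cubeAmplitude_phase c k]

theorem cubeEncoder_injective : Function.Injective cubeEncoder := by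
  have h : cubeAmplitudeᴴ * cubeAmplitude = 1 := by
    ext x y
    rw [mul_apply, one_apply, ← sum_cubeAmplitude_mul]
    simp only [conjTranspose_apply, star_cubeAmplitude]
  refine Function.LeftInverse.injective (g := cubeAmplitudeᴴ.mulVecLin) fun ψ => ?_
  rw [cubeEncoder, mulVecLin_apply, mulVecLin_apply, mulVec_mulVec, h, one_mulVec]

/-! ### Parameters of the cube code -/

theorem bits_univ_corner : bits (Set.univ : Set Corner) = cubeAffine (1, 0) := by
  funext s
  simp [bits, cubeAffine_apply]

theorem cubeCode_xSpace : cubeCode.xSpace = Submodule.span (ZMod 2) {cubeAffine (1, 0)} := by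
  rw [CSSCode.xSpace, cubeCode, Set.image_singleton, bits_univ_corner]

theorem cubeCode_orthSub_zSpace : orthSub cubeCode.zSpace = LinearMap.range cubeAffine := by
  ext t
  rw [CSSCode.zSpace, mem_orthSub_span, LinearMap.mem_range]
  simp only [eq_comm (b := t)]
  rw [← exists_cubeAffine_iff]
  constructor
  · intro h c k
    exact h _ ⟨_, ⟨c, k, rfl⟩, rfl⟩
  · rintro h _ ⟨_, ⟨c, k, rfl⟩, rfl⟩
    exact h c k

theorem cubeCode_isOrthogonal : cubeCode.IsOrthogonal := by
  rw [CSSCode.IsOrthogonal, cubeCode_orthSub_zSpace, cubeCode_xSpace,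
    Submodule.span_singleton_le_iff_mem]
  exact ⟨_, rfl⟩

theorem card_colour : Fintype.card Colour = 3 := rfl

theorem cubeCode_hasLogicalDim : cubeCode.HasLogicalDim 3 := by
  refine ⟨cubeCode_isOrthogonal, ?_⟩
  rw [cubeCode_orthSub_zSpace, LinearMap.finrank_range_of_inj cubeAffine_injective,
    cubeCode_xSpace, finrank_span_singleton, finrank_prod, finrank_fintype_fun_eq_card,
    finrank_self, card_colour]
  rw [← map_zero cubeAffine]
  exact cubeAffine_injective.ne fun h => one_ne_zero (congrArg Prod.fst h)

/-- The image is fixed by all generators, and both spaces have dimension `2 ^ 3`. -/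
theorem range_cubeEncoder : LinearMap.range cubeEncoder = cubeCode.codeSpace := by
  refine Submodule.eq_of_le_of_finrank_eq ?_ ?_
  · rintro _ ⟨ψ, rfl⟩
    refine CSSCode.mem_codeSpace_iff.2 ⟨?_, ?_⟩
    · rintro _ rfl
      -- The cube is the union of two opposite faces. Both represent the same logical X, whose
      -- square is the identity.
      have h : (pauliX Set.univ : QState Corner ≃ₗ[ℂ] _) =
          pauliX (cubeFace .r 0) * pauliX (cubeFace .r 1) := by
        rw [pauliX_eq, pauliX_eq, pauliX_eq, pauliOp_mul (zero_dotProduct _), add_zero,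
          bits_univ_corner, bits_cubeFace, bits_cubeFace, ← map_add, Prod.mk_add_mk,
          pi_zmod_two_add_self]
        rfl
      rw [h, LinearEquiv.mul_apply, ← cubeEncoder_pauliX, ← cubeEncoder_pauliX]
      congr 1
      funext x
      rw [pauliX_apply, pauliX_apply, add_bits_add_bits]
    · rintro _ ⟨c, k, rfl⟩
      funext t
      rw [pauliZ_apply, cubeEncoder_apply, Finset.mul_sum]
      refine Finset.sum_congr rfl fun x _ => ?_
      by_cases hx : ∃ e, t = cubeAffine (e, x)
      · obtain ⟨e, rfl⟩ := hx
        rw [(exists_cubeAffine_iff _).2 ⟨_, rfl⟩, sgn_zero, one_mul]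
      · rw [cubeAmplitude_of_forall_ne (not_exists.1 hx), zero_mul, mul_zero]
  · rw [cubeCode_hasLogicalDim.encodesQubits,
      LinearMap.finrank_range_of_inj cubeEncoder_injective, finrank_fintype_fun_eq_card,
      Fintype.card_fun, ZMod.card, card_colour]

/-- An edge is a logical operator of weight two. A single X is detected by a face through its
corner, and a single Z by the X stabilizer of the whole cube. -/
theorem cubeCode_hasDistance : cubeCode.HasDistance 2 := by
  constructor
  · refine ⟨∅, cubeEdge .r 0, (CSSCode.isLogical_z_iff cubeCode_isOrthogonal).2 ⟨?_, fun h => ?_⟩,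
      ?_⟩
    · rw [cubeCode_xSpace, mem_orthSub_span]
      rintro _ rfl
      rw [dotProduct_comm, bits_cubeEdge_dotProduct, cubeAffine_add_single, ← add_assoc,
        zmod_two_add_self, zero_add]
      rfl
    -- A vector orthogonal to all faces that pairs to one with the edge shows that the edge is no
    -- sum of faces.
    · have h1 : cubeAffine (0, Pi.single .r 1) ∈ orthSub cubeCode.zSpace := by
        rw [cubeCode_orthSub_zSpace]; exact ⟨_, rfl⟩
      have h2 := h1 _ h
      rw [bits_cubeEdge_dotProduct, cubeAffine_add_single, ← add_assoc, zmod_two_add_self,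
        zero_add, Pi.single_eq_same] at h2
      exact one_ne_zero h2
    · rw [Set.empty_union, cubeEdge_eq, Set.ncard_pair (ne_add_single _ _)]
  · rintro w ⟨A, B, h, rfl⟩
    rw [CSSCode.isLogical_iff cubeCode_isOrthogonal] at h
    by_contra hw
    obtain ⟨⟨hA, hB⟩, hne⟩ := h
    have hw' : (A ∪ B).ncard ≤ 1 := by omega
    rw [Set.ncard_le_one_iff_eq] at hw'
    have hA' : A = ∅ := by
      by_contra hA'
      obtain ⟨q, hq⟩ := Set.nonempty_iff_ne_empty.2 hA'
      have : A = {q} := by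
        rcases hw' with h0 | ⟨a, ha⟩
        · exact absurd (h0 ▸ Or.inl hq : q ∈ (∅ : Set Corner)) (Set.notMem_empty q)
        · have hAa : A ⊆ {a} := ha ▸ Set.subset_union_left
          obtain rfl : q = a := hAa hq
          exact Set.Subset.antisymm hAa (Set.singleton_subset_iff.2 hq)
      rw [this, bits_singleton] at hA
      have h1 := hA _ (Submodule.subset_span ⟨_, ⟨.r, q .r, rfl⟩, rfl⟩)
      rw [dotProduct_single, mul_one, bits_mem (mem_cubeFace_iff.2 rfl)] at h1
      exact one_ne_zero h1
    have hB' : B = ∅ := by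
      by_contra hB'
      obtain ⟨q, hq⟩ := Set.nonempty_iff_ne_empty.2 hB'
      have : B = {q} := by
        rcases hw' with h0 | ⟨a, ha⟩
        · exact absurd (h0 ▸ Or.inr hq : q ∈ (∅ : Set Corner)) (Set.notMem_empty q)
        · have hAa : B ⊆ {a} := ha ▸ Set.subset_union_right
          obtain rfl : q = a := hAa hq
          exact Set.Subset.antisymm hAa (Set.singleton_subset_iff.2 hq)
      rw [this, bits_singleton] at hB
      have h1 := hB _ (Submodule.subset_span ⟨_, rfl, rfl⟩)
      rw [dotProduct_single, mul_one, bits_mem (Set.mem_univ q)] at h1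
      exact one_ne_zero h1
    refine hne ?_
    rw [hA', hB', bits_empty]
    exact ⟨zero_mem _, zero_mem _⟩

/-! ### The encoder of the stack -/

theorem dotProduct_prod {V K : Type} [Fintype V] [Fintype K] (a b : V × K → ZMod 2) :
    a ⬝ᵥ b = ∑ v, (fun k => a (v, k)) ⬝ᵥ (fun k => b (v, k)) :=
  Fintype.sum_prod_type _

section

variable {d : ℕ}

open scoped Classical in
theorem bits_inCode (c : Colour) (A : Set (Vertex d)) (v : Vertex d) :
    (fun c' => bits (inCode c A) (v, c')) = if v ∈ A then bits {c} else 0 := by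
  funext c'
  split_ifs with h <;> simp [bits, inCode, h]

open scoped Classical in
theorem bits_liftX (c : Colour) (k : Vertex d → ZMod 2) (A : Set (Vertex d)) (v : Vertex d) :
    (fun s => bits (liftX c k A) (v, s)) = if v ∈ A then bits (cubeFace c (k v)) else 0 := by
  funext s
  split_ifs with h <;> simp [bits, liftX, h]

open scoped Classical in
theorem bits_liftZ (c : Colour) (k : Vertex d → Corner) (A : Set (Vertex d)) (v : Vertex d) :
    (fun s => bits (liftZ c k A) (v, s)) = if v ∈ A then bits (cubeEdge c (k v)) else 0 := by
  funext s
  split_ifs with h <;> simp [bits, liftZ, h]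

/-- The matrix elements of the encoder. -/
noncomputable def encoderAmplitude (t : Vertex d × Corner → ZMod 2)
    (x : Vertex d × Colour → ZMod 2) : ℂ :=
  ∏ v, cubeAmplitude (fun s => t (v, s)) (fun c => x (v, c))

theorem encoder_eq_mulVec (ψ : QState (Vertex d × Colour)) :
    encoder d ψ = Matrix.of encoderAmplitude *ᵥ ψ :=
  mulVecLin_apply _ _

theorem encoder_apply (ψ : QState (Vertex d × Colour)) (t : Vertex d × Corner → ZMod 2) :
    encoder d ψ t = ∑ x, encoderAmplitude t x * ψ x := by
  rw [encoder_eq_mulVec, mulVec, dotProduct]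
  simp only [of_apply]

theorem encoderAmplitude_add_bits (c : Colour) (k : Vertex d → ZMod 2) (A : Set (Vertex d))
    (t : Vertex d × Corner → ZMod 2) (x : Vertex d × Colour → ZMod 2) :
    encoderAmplitude t (x + bits (inCode c A)) = encoderAmplitude (t + bits (liftX c k A)) x := by
  refine Finset.prod_congr rfl fun v _ => ?_
  have h1 : (fun c' => (x + bits (inCode c A)) (v, c')) =
    (fun c' => x (v, c')) + fun c' => bits (inCode c A) (v, c') := rfl
  have h2 : (fun s => (t + bits (liftX c k A)) (v, s)) =
    (fun s => t (v, s)) + fun s => bits (liftX c k A) (v, s) := rfl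
  rw [h1, h2, bits_inCode, bits_liftX]
  split_ifs
  · exact cubeAmplitude_add_bits c (k v) _ _
  · rw [add_zero, add_zero]

theorem encoderAmplitude_phase (c : Colour) (k : Vertex d → Corner) (A : Set (Vertex d))
    (t : Vertex d × Corner → ZMod 2) (x : Vertex d × Colour → ZMod 2) :
    encoderAmplitude t x * sgn (bits (inCode c A) ⬝ᵥ x) =
      sgn (bits (liftZ c k A) ⬝ᵥ t) * encoderAmplitude t x := by
  rw [encoderAmplitude, dotProduct_prod, dotProduct_prod, sgn_sum, sgn_sum,
    ← Finset.prod_mul_distrib, ← Finset.prod_mul_distrib]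
  refine Finset.prod_congr rfl fun v _ => ?_
  rw [bits_inCode, bits_liftZ]
  split_ifs
  · rw [bits_singleton, single_dotProduct, one_mul, cubeAmplitude_phase c (k v)]
  · rw [zero_dotProduct, zero_dotProduct, sgn_zero, one_mul, mul_one]

theorem encoder_pauliX (c : Colour) (k : Vertex d → ZMod 2) (A : Set (Vertex d))
    (ψ : QState (Vertex d × Colour)) :
    encoder d (pauliX (inCode c A) ψ) = pauliX (liftX c k A) (encoder d ψ) := by
  funext t
  rw [pauliX_apply, encoder_apply, encoder_apply, ← sum_add_bits (inCode c A)]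
  refine Finset.sum_congr rfl fun x _ => ?_
  rw [pauliX_apply, add_bits_add_bits, encoderAmplitude_add_bits c k]

theorem encoder_pauliZ (c : Colour) (k : Vertex d → Corner) (A : Set (Vertex d))
    (ψ : QState (Vertex d × Colour)) :
    encoder d (pauliZ (inCode c A) ψ) = pauliZ (liftZ c k A) (encoder d ψ) := by
  funext t
  rw [pauliZ_apply, encoder_apply, encoder_apply, Finset.mul_sum]
  refine Finset.sum_congr rfl fun x _ => ?_
  rw [pauliZ_apply, ← mul_assoc, ← mul_assoc, encoderAmplitude_phase c k]

theorem star_encoderAmplitude (t : Vertex d × Corner → ZMod 2) (x : Vertex d × Colour → ZMod 2) :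
    star (encoderAmplitude t x) = encoderAmplitude t x := by
  rw [encoderAmplitude, star_prod]
  exact Finset.prod_congr rfl fun v _ => star_cubeAmplitude _ _

/-- The sum over all bit strings factors into one sum for each cube. -/
theorem sum_encoderAmplitude_mul (x y : Vertex d × Colour → ZMod 2) :
    ∑ t, encoderAmplitude t x * encoderAmplitude t y = if x = y then 1 else 0 := by
  have h1 : ∑ t, encoderAmplitude t x * encoderAmplitude t y =
      ∏ v, ∑ u, cubeAmplitude u (fun c => x (v, c)) * cubeAmplitude u (fun c => y (v, c)) := by
    rw [Finset.prod_univ_sum, Fintype.piFinset_univ,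
      ← (Equiv.curry (Vertex d) Corner (ZMod 2)).sum_comp]
    refine Finset.sum_congr rfl fun t _ => ?_
    rw [encoderAmplitude, encoderAmplitude, ← Finset.prod_mul_distrib]
    rfl
  rw [h1]
  simp only [sum_cubeAmplitude_mul]
  split_ifs with h
  · subst h
    simp
  · obtain ⟨⟨v, c⟩, hvc⟩ := Function.ne_iff.1 h
    exact Finset.prod_eq_zero (Finset.mem_univ v) (if_neg fun h' => hvc (congrFun h' c))

theorem encoderAmplitude_conjTranspose_mul (d : ℕ) :
    (Matrix.of (encoderAmplitude (d := d)))ᴴ * Matrix.of (encoderAmplitude (d := d)) = 1 := by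
  ext x y
  rw [mul_apply, one_apply, ← sum_encoderAmplitude_mul]
  simp only [conjTranspose_apply, of_apply, star_encoderAmplitude]

theorem encoder_isometry (φ ψ : QState (Vertex d × Colour)) :
    star (encoder d φ) ⬝ᵥ encoder d ψ = star φ ⬝ᵥ ψ := by
  rw [encoder_eq_mulVec, encoder_eq_mulVec, star_mulVec, dotProduct_mulVec, vecMul_vecMul,
    encoderAmplitude_conjTranspose_mul, vecMul_one]

theorem encoder_injective : Function.Injective (encoder d) := by
  refine Function.LeftInverse.injective (g := (Matrix.of encoderAmplitude)ᴴ.mulVecLin) fun ψ => ?_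
  rw [encoder_eq_mulVec, mulVecLin_apply, mulVec_mulVec, encoderAmplitude_conjTranspose_mul,
    one_mulVec]

/-! ### Concatenation with the cube code in terms of linear algebra -/

/-- The functions on the qubits which are affine on each cube. -/
def concatAffine (d : ℕ) : (Vertex d → ZMod 2) × (Colour → Vertex d → ZMod 2) →ₗ[ZMod 2]
    (Vertex d × Corner → ZMod 2) where
  toFun p q := cubeAffine (p.1 q.1, fun c => p.2 c q.1) q.2
  map_add' p p' := by
    funext q
    exact congrFun (map_add cubeAffine (p.1 q.1, fun c => p.2 c q.1) (p'.1 q.1, fun c => p'.2 c q.1)) q.2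
  map_smul' t p := by
    funext q
    exact congrFun (map_smul cubeAffine t (p.1 q.1, fun c => p.2 c q.1)) q.2

theorem concatAffine_row (p : (Vertex d → ZMod 2) × (Colour → Vertex d → ZMod 2)) (v : Vertex d) :
    (fun s => concatAffine d p (v, s)) = cubeAffine (p.1 v, fun c => p.2 c v) := rfl

theorem concatAffine_injective : Function.Injective (concatAffine d) := by
  rintro ⟨e, x⟩ ⟨e', x'⟩ h
  have h1 : ∀ v, (e v, fun c => x c v) = (e' v, fun c => x' c v) := fun v =>
    cubeAffine_injective (funext fun s => congrFun h (v, s))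
  exact Prod.ext (funext fun v => congrArg Prod.fst (h1 v))
    (funext fun c => funext fun v => congrFun (congrArg Prod.snd (h1 v)) c)

theorem funext_rows {K : Type} {f g : Vertex d × K → ZMod 2}
    (h : ∀ v, (fun k => f (v, k)) = fun k => g (v, k)) : f = g :=
  funext fun q => congrFun (h q.1) q.2

/-- The choice `k` of faces enters only the constant terms, and these are X stabilizers of the
cubes. -/
theorem bits_liftX_eq (c : Colour) (k : Vertex d → ZMod 2) (A : Set (Vertex d)) :
    bits (liftX c k A) = concatAffine d (fun v => (k v + 1) * bits A v, Pi.single c (bits A)) := by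
  refine funext_rows fun v => ?_
  rw [bits_liftX, concatAffine_row]
  dsimp only
  have h : (fun c' => (Pi.single c (bits A) : Colour → Vertex d → ZMod 2) c' v) =
      Pi.single c (bits A v) := by
    funext c'
    rcases eq_or_ne c' c with rfl | h
    · simp
    · simp [h]
  rw [h]
  split_ifs with hv
  · rw [bits_mem hv, mul_one, bits_cubeFace]
  · rw [bits_notMem hv, mul_zero, Pi.single_zero, ← Prod.zero_eq_mk, map_zero]

/-- A lifted Z operator sees a vector that is affine on each cube only through its coefficients of
`c`. The choice of edges disappears, and the pairing becomes one in the surface code. -/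
theorem bits_liftZ_dotProduct (c : Colour) (k : Vertex d → Corner) (A : Set (Vertex d))
    (p : (Vertex d → ZMod 2) × (Colour → Vertex d → ZMod 2)) :
    bits (liftZ c k A) ⬝ᵥ concatAffine d p = bits A ⬝ᵥ p.2 c := by
  rw [dotProduct_prod]
  refine Finset.sum_congr rfl fun v _ => ?_
  rw [bits_liftZ, concatAffine_row]
  split_ifs with hv
  · rw [bits_mem hv, bits_cubeEdge_dotProduct, cubeAffine_add_single, ← add_assoc,
      zmod_two_add_self, zero_add, one_mul]
  · rw [bits_notMem hv, zero_dotProduct, zero_mul]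

theorem bits_cube (v : Vertex d) :
    bits {q : Vertex d × Corner | q.1 = v} = concatAffine d (Pi.single v 1, 0) := by
  refine funext_rows fun v' => ?_
  rw [concatAffine_row]
  funext s
  rcases eq_or_ne v' v with rfl | h
  · simp [bits, cubeAffine_apply]
  · simp [bits, cubeAffine_apply, h]

theorem bits_face_of_cube_dotProduct (v : Vertex d) (B : Set Corner)
    (f : Vertex d × Corner → ZMod 2) :
    bits {q : Vertex d × Corner | q.1 = v ∧ q.2 ∈ B} ⬝ᵥ f = bits B ⬝ᵥ fun s => f (v, s) := by
  rw [dotProduct_prod, Finset.sum_eq_single v]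
  · congr 1
    funext s
    by_cases hs : s ∈ B <;> simp [bits, hs]
  · intro v' _ h
    have hz : (fun s => bits {q : Vertex d × Corner | q.1 = v ∧ q.2 ∈ B} (v', s)) = 0 := by
      funext s
      simp [bits, h]
    rw [hz, zero_dotProduct]
  · simp

/-- The inclusion of a product of submodules. -/
def inclusionPi {ι : Type} {R M : Type*} [Semiring R] [AddCommMonoid M] [Module R M]
    (W : ι → Submodule R M) : (∀ i, W i) →ₗ[R] (ι → M) :=
  LinearMap.pi fun i => (W i).subtype ∘ₗ LinearMap.proj i

theorem range_inclusionPi {ι : Type} {R M : Type*} [Semiring R] [AddCommMonoid M] [Module R M]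
    (W : ι → Submodule R M) : LinearMap.range (inclusionPi W) = Submodule.pi Set.univ W := by
  ext x
  constructor
  · rintro ⟨y, rfl⟩ i _
    exact (y i).2
  · intro h
    exact ⟨fun i => ⟨x i, h i trivial⟩, rfl⟩

theorem inclusionPi_injective {ι : Type} {R M : Type*} [Semiring R] [AddCommMonoid M] [Module R M]
    (W : ι → Submodule R M) : Function.Injective (inclusionPi W) := fun _ _ h =>
  funext fun i => Subtype.ext (congrFun h i)

/-- A code obtained by concatenating the surface codes with the cube code, for some choice of
representatives of the logical operators of the cube code. -/
structure IsConcatenation (C : CSSCode (Vertex d × Corner)) : Prop where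
  cube_mem : ∀ v, {q | q.1 = v} ∈ C.xSupports
  exists_liftX : ∀ c, ∀ A ∈ (surfaceCode d c).xSupports, ∃ k, liftX c k A ∈ C.xSupports
  of_mem_xSupports : ∀ S ∈ C.xSupports, (∃ v, S = {q | q.1 = v}) ∨
    ∃ c k, ∃ A ∈ (surfaceCode d c).xSupports, S = liftX c k A
  face_mem : ∀ v c k, {q | q.1 = v ∧ q.2 ∈ cubeFace c k} ∈ C.zSupports
  exists_liftZ : ∀ c, ∀ A ∈ (surfaceCode d c).zSupports, ∃ k, liftZ c k A ∈ C.zSupports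
  of_mem_zSupports : ∀ S ∈ C.zSupports, (∃ v c k, S = {q | q.1 = v ∧ q.2 ∈ cubeFace c k}) ∨
    ∃ c k, ∃ A ∈ (surfaceCode d c).zSupports, S = liftZ c k A

theorem concatenatedCode_isConcatenation (d : ℕ) : IsConcatenation (concatenatedCode d) where
  cube_mem v := Or.inl ⟨v, Set.univ, rfl, by simp⟩
  exists_liftX c A hA := ⟨0, Or.inr ⟨c, 0, A, hA, rfl⟩⟩
  of_mem_xSupports := by
    rintro S (⟨v, _, rfl, rfl⟩ | h)
    · exact Or.inl ⟨v, by simp⟩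
    · exact Or.inr h
  face_mem v c k := Or.inl ⟨v, cubeFace c k, ⟨c, k, rfl⟩, rfl⟩
  exists_liftZ c A hA := ⟨0, Or.inr ⟨c, 0, A, hA, rfl⟩⟩
  of_mem_zSupports := by
    rintro S (⟨v, _, ⟨c, k, rfl⟩, rfl⟩ | h)
    · exact Or.inl ⟨v, c, k, rfl⟩
    · exact Or.inr h

namespace IsConcatenation

variable {C : CSSCode (Vertex d × Corner)}

/-- The cubes contribute all constant terms; modulo these, a lifted cell is the cell itself in the
component of its colour. -/
theorem xSpace_eq (hC : IsConcatenation C) :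
    C.xSpace = (Submodule.prod ⊤ (Submodule.pi Set.univ fun c => (surfaceCode d c).xSpace)).map
      (concatAffine d) := by
  have hcube : ∀ e, concatAffine d (e, 0) ∈ C.xSpace := fun e => by
    have h : ((e, 0) : (Vertex d → ZMod 2) × (Colour → Vertex d → ZMod 2)) =
        ∑ v, e v • (Pi.single v 1, 0) := by
      refine Prod.ext ?_ ?_
      · rw [Prod.fst_sum]
        simp only [Prod.smul_fst]
        exact pi_eq_sum_univ' e
      · rw [Prod.snd_sum]
        simp
    rw [h, map_sum]
    refine sum_mem fun v _ => ?_
    rw [map_smul, ← bits_cube]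
    exact Submodule.smul_mem _ _ (Submodule.subset_span ⟨_, hC.cube_mem v, rfl⟩)
  refine le_antisymm (Submodule.span_le.2 ?_) ?_
  · rintro _ ⟨S, hS, rfl⟩
    rcases hC.of_mem_xSupports S hS with ⟨v, rfl⟩ | ⟨c, k, A, hA, rfl⟩
    · rw [bits_cube]
      exact ⟨_, ⟨trivial, zero_mem _⟩, rfl⟩
    · rw [bits_liftX_eq]
      refine ⟨_, ⟨trivial, fun c' _ => ?_⟩, rfl⟩
      rcases eq_or_ne c' c with rfl | h
      · simp only [Pi.single_eq_same]
        exact Submodule.subset_span ⟨A, hA, rfl⟩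
      · simp only [Pi.single_eq_of_ne h]
        exact zero_mem _
  · have hsingle : ∀ c, ∀ a ∈ (surfaceCode d c).xSpace,
        concatAffine d (0, Pi.single c a) ∈ C.xSpace := by
      intro c a ha
      induction ha using Submodule.span_induction with
      | mem a ha =>
        obtain ⟨A, hA, rfl⟩ := ha
        obtain ⟨k, hk⟩ := hC.exists_liftX c A hA
        -- Cube stabilizers remove the constant terms caused by the choice of faces `k`.
        have h1 := sub_mem (Submodule.subset_span ⟨_, hk, rfl⟩ : _ ∈ C.xSpace)
          (hcube fun v => (k v + 1) * bits A v)
        rwa [bits_liftX_eq, ← map_sub, Prod.mk_sub_mk, sub_self, sub_zero] at h1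
      | zero => rw [Pi.single_zero, ← Prod.zero_eq_mk, map_zero]; exact zero_mem _
      | add a b _ _ ha hb =>
        have h1 := add_mem ha hb
        rwa [← map_add, Prod.mk_add_mk, add_zero, ← Pi.single_add] at h1
      | smul t a _ ha =>
        have h1 := Submodule.smul_mem _ t ha
        rwa [← map_smul, Prod.smul_mk, smul_zero, ← Pi.single_smul] at h1
    rintro _ ⟨⟨e, x⟩, ⟨-, hx⟩, rfl⟩
    have h : ((e, x) : (Vertex d → ZMod 2) × (Colour → Vertex d → ZMod 2)) =
        (e, 0) + ∑ c, (0, Pi.single c (x c)) := by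
      refine Prod.ext ?_ ?_
      · rw [Prod.fst_add, Prod.fst_sum]; simp
      · rw [Prod.snd_add, Prod.snd_sum, zero_add]
        exact (Finset.univ_sum_single x).symm
    rw [h, map_add, map_sum]
    exact add_mem (hcube e) (sum_mem fun c _ => hsingle c _ (hx c trivial))

/-- The faces of the cubes force a vector to be affine on each cube; each lifted face then tests
just one of the three coefficient functions. -/
theorem orthSub_zSpace_eq (hC : IsConcatenation C) :
    orthSub C.zSpace =
      (Submodule.prod ⊤ (Submodule.pi Set.univ fun c => orthSub (surfaceCode d c).zSpace)).map
        (concatAffine d) := by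
  ext f
  rw [CSSCode.zSpace, mem_orthSub_span]
  constructor
  · intro h
    have h1 : ∀ v, ∃ p, (fun s => f (v, s)) = cubeAffine p := fun v => by
      rw [← exists_cubeAffine_iff]
      intro c k
      rw [← bits_face_of_cube_dotProduct]
      exact h _ ⟨_, hC.face_mem v c k, rfl⟩
    choose p hp using h1
    have hf : f = concatAffine d (fun v => (p v).1, fun c v => (p v).2 c) := funext_rows hp
    refine ⟨_, ⟨trivial, fun c _ => mem_orthSub_span.2 ?_⟩, hf.symm⟩
    rintro _ ⟨A, hA, rfl⟩
    obtain ⟨k, hk⟩ := hC.exists_liftZ c A hA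
    have := h _ ⟨_, hk, rfl⟩
    rwa [hf, bits_liftZ_dotProduct] at this
  · rintro ⟨⟨e, x⟩, ⟨-, hx⟩, rfl⟩ _ ⟨S, hS, rfl⟩
    rcases hC.of_mem_zSupports S hS with ⟨v, c, k, rfl⟩ | ⟨c, k, A, hA, rfl⟩
    · rw [bits_face_of_cube_dotProduct]
      exact (exists_cubeAffine_iff _).2 ⟨_, concatAffine_row _ v⟩ c k
    · rw [bits_liftZ_dotProduct]
      exact hx c trivial _ (Submodule.subset_span ⟨A, hA, rfl⟩)

/-- Both descriptions involve only the surface codes. For the Z part, equality is transferred from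
the complements by `orthSub_orthSub`. -/
theorem stabilizer_eq {C' : CSSCode (Vertex d × Corner)} (hC : IsConcatenation C)
    (hC' : IsConcatenation C') (h : C.IsOrthogonal) : C'.stabilizer = C.stabilizer := by
  refine CSSCode.stabilizer_eq_of_spaces_eq h ?_ ?_
  · rw [hC.xSpace_eq, hC'.xSpace_eq]
  · rw [← orthSub_orthSub C.zSpace, ← orthSub_orthSub C'.zSpace, hC.orthSub_zSpace_eq,
      hC'.orthSub_zSpace_eq]

theorem bits_liftX_mem_iff (W : Colour → Submodule (ZMod 2) (Vertex d → ZMod 2)) (c : Colour)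
    (k : Vertex d → ZMod 2) (A : Set (Vertex d)) :
    bits (liftX c k A) ∈ (Submodule.prod ⊤ (Submodule.pi Set.univ W)).map (concatAffine d) ↔
      bits A ∈ W c := by
  rw [bits_liftX_eq, Submodule.mem_map]
  constructor
  · rintro ⟨⟨e, x⟩, ⟨-, hx⟩, h⟩
    have h1 := congrFun (congrArg Prod.snd (concatAffine_injective h)) c
    simp only [Pi.single_eq_same] at h1
    exact h1 ▸ hx c trivial
  · intro h
    refine ⟨_, ⟨trivial, fun c' _ => ?_⟩, rfl⟩
    rcases eq_or_ne c' c with rfl | hne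
    · simpa using h
    · simp only [Pi.single_eq_of_ne hne]
      exact zero_mem _

/-- Lifted Z operators are understood only through pairings, hence the complement. With `W` itself a
family of complements, this also decides membership in `zSpace`. -/
theorem bits_liftZ_mem_iff (W : Colour → Submodule (ZMod 2) (Vertex d → ZMod 2)) (c : Colour)
    (k : Vertex d → Corner) (A : Set (Vertex d)) :
    bits (liftZ c k A) ∈
        orthSub ((Submodule.prod ⊤ (Submodule.pi Set.univ W)).map (concatAffine d)) ↔
      bits A ∈ orthSub (W c) := by
  constructor
  · intro h a ha
    have h1 : concatAffine d (0, Pi.single c a) ∈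
        (Submodule.prod ⊤ (Submodule.pi Set.univ W)).map (concatAffine d) := by
      refine ⟨_, ⟨trivial, fun c' _ => ?_⟩, rfl⟩
      rcases eq_or_ne c' c with rfl | hne
      · simpa using ha
      · simp only [Pi.single_eq_of_ne hne]
        exact zero_mem _
    have h2 := h _ h1
    rw [dotProduct_comm, bits_liftZ_dotProduct, dotProduct_comm] at h2
    simpa only [Pi.single_eq_same] using h2
  · rintro h _ ⟨⟨e, x⟩, ⟨-, hx⟩, rfl⟩
    rw [dotProduct_comm, bits_liftZ_dotProduct, dotProduct_comm]
    exact h _ (hx c trivial)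

theorem isOrthogonal (hC : IsConcatenation C) (h : ∀ c, (surfaceCode d c).IsOrthogonal) :
    C.IsOrthogonal := by
  rw [CSSCode.IsOrthogonal, hC.xSpace_eq, hC.orthSub_zSpace_eq]
  exact Submodule.map_mono (Submodule.prod_mono le_rfl (Submodule.pi_mono fun c _ => h c))

theorem liftX_mem_xSpace_iff (hC : IsConcatenation C) (c : Colour) (k : Vertex d → ZMod 2)
    (A : Set (Vertex d)) :
    bits (liftX c k A) ∈ C.xSpace ↔ bits A ∈ (surfaceCode d c).xSpace := by
  rw [hC.xSpace_eq, bits_liftX_mem_iff]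

theorem liftX_mem_orthSub_iff (hC : IsConcatenation C) (c : Colour) (k : Vertex d → ZMod 2)
    (A : Set (Vertex d)) :
    bits (liftX c k A) ∈ orthSub C.zSpace ↔ bits A ∈ orthSub (surfaceCode d c).zSpace := by
  rw [hC.orthSub_zSpace_eq, bits_liftX_mem_iff]

theorem liftZ_mem_zSpace_iff (hC : IsConcatenation C) (c : Colour) (k : Vertex d → Corner)
    (A : Set (Vertex d)) :
    bits (liftZ c k A) ∈ C.zSpace ↔ bits A ∈ (surfaceCode d c).zSpace := by
  rw [← orthSub_orthSub C.zSpace, hC.orthSub_zSpace_eq, bits_liftZ_mem_iff, orthSub_orthSub]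

theorem liftZ_mem_orthSub_iff (hC : IsConcatenation C) (c : Colour) (k : Vertex d → Corner)
    (A : Set (Vertex d)) :
    bits (liftZ c k A) ∈ orthSub C.xSpace ↔ bits A ∈ orthSub (surfaceCode d c).xSpace := by
  rw [hC.xSpace_eq, bits_liftZ_mem_iff]

theorem finrank_map_concatAffine (W : Colour → Submodule (ZMod 2) (Vertex d → ZMod 2)) :
    finrank (ZMod 2) ((Submodule.prod ⊤ (Submodule.pi Set.univ W)).map (concatAffine d)) =
      Fintype.card (Vertex d) + ∑ c, finrank (ZMod 2) (W c) := by
  rw [← range_inclusionPi, ← LinearMap.range_id, ← LinearMap.range_prodMap,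
    ← LinearMap.range_comp, LinearMap.finrank_range_of_inj, finrank_prod,
    finrank_fintype_fun_eq_card, finrank_pi_fintype]
  rw [LinearMap.coe_comp, LinearMap.coe_prodMap]
  exact concatAffine_injective.comp (Function.injective_id.prodMap (inclusionPi_injective W))

/-- The constant terms contribute the same dimension to both spaces, so only the gaps of the three
surface codes remain, and they add. -/
theorem hasLogicalDim (hC : IsConcatenation C) {k : ℕ}
    (h : ∀ c, (surfaceCode d c).HasLogicalDim k) : C.HasLogicalDim (3 * k) := by
  refine ⟨hC.isOrthogonal fun c => (h c).1, ?_⟩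
  rw [hC.xSpace_eq, hC.orthSub_zSpace_eq, finrank_map_concatAffine, finrank_map_concatAffine,
    Finset.sum_congr rfl fun c _ => (h c).2, Finset.sum_add_distrib, Finset.sum_const,
    Finset.card_univ, card_colour, smul_eq_mul, add_assoc]

end IsConcatenation

/-! ### The stack -/

/-- Reordering the arguments of a function on the qubits of the stack. -/
def stackEquiv (d : ℕ) : (Colour → Vertex d → ZMod 2) →ₗ[ZMod 2] (Vertex d × Colour → ZMod 2) where
  toFun x q := x q.2 q.1
  map_add' _ _ := rfl
  map_smul' _ _ := rfl

theorem stackEquiv_injective : Function.Injective (stackEquiv d) := fun _ _ h =>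
  funext fun c => funext fun v => congrFun h (v, c)

theorem bits_inCode_eq (c : Colour) (A : Set (Vertex d)) :
    bits (inCode c A) = stackEquiv d (Pi.single c (bits A)) := by
  funext ⟨v, c'⟩
  change _ = (Pi.single c (bits A) : Colour → Vertex d → ZMod 2) c' v
  rcases eq_or_ne c' c with rfl | h
  · by_cases hv : v ∈ A <;> simp [bits, inCode, hv]
  · simp [bits, inCode, h]

theorem bits_inCode_dotProduct (c : Colour) (A : Set (Vertex d))
    (x : Colour → Vertex d → ZMod 2) :
    bits (inCode c A) ⬝ᵥ stackEquiv d x = bits A ⬝ᵥ x c := by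
  rw [dotProduct_prod]
  refine Finset.sum_congr rfl fun v _ => ?_
  rw [bits_inCode]
  split_ifs with hv
  · rw [bits_singleton, single_dotProduct, one_mul, bits_mem hv, one_mul]
    rfl
  · rw [bits_notMem hv, zero_dotProduct, zero_mul]

theorem stackCode_xSpace (d : ℕ) : (stackCode d).xSpace =
    (Submodule.pi Set.univ fun c => (surfaceCode d c).xSpace).map (stackEquiv d) := by
  refine le_antisymm (Submodule.span_le.2 ?_) ?_
  · rintro _ ⟨_, ⟨c, A, hA, rfl⟩, rfl⟩
    rw [bits_inCode_eq]
    refine ⟨_, fun c' _ => ?_, rfl⟩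
    rcases eq_or_ne c' c with rfl | h
    · simp only [Pi.single_eq_same]
      exact Submodule.subset_span ⟨A, hA, rfl⟩
    · simp only [Pi.single_eq_of_ne h]
      exact zero_mem _
  · rintro _ ⟨x, hx, rfl⟩
    rw [← Finset.univ_sum_single x, map_sum]
    refine sum_mem fun c _ => ?_
    have := hx c trivial
    generalize x c = a at this
    induction this using Submodule.span_induction with
    | mem a ha =>
      obtain ⟨A, hA, rfl⟩ := ha
      rw [← bits_inCode_eq]
      exact Submodule.subset_span ⟨_, ⟨c, A, hA, rfl⟩, rfl⟩
    | zero => rw [Pi.single_zero, map_zero]; exact zero_mem _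
    | add a b _ _ ha hb => rw [Pi.single_add, map_add]; exact add_mem ha hb
    | smul t a _ ha => rw [Pi.single_smul, map_smul]; exact Submodule.smul_mem _ t ha

theorem stackCode_orthSub_zSpace (d : ℕ) : orthSub (stackCode d).zSpace =
    (Submodule.pi Set.univ fun c => orthSub (surfaceCode d c).zSpace).map (stackEquiv d) := by
  ext f
  rw [CSSCode.zSpace, mem_orthSub_span]
  have key : ∀ x, (∀ c, x c ∈ orthSub (surfaceCode d c).zSpace) ↔
      ∀ b ∈ bits '' (stackCode d).zSupports, b ⬝ᵥ stackEquiv d x = 0 := by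
    intro x
    constructor
    · rintro h _ ⟨_, ⟨c, A, hA, rfl⟩, rfl⟩
      rw [bits_inCode_dotProduct]
      exact h c _ (Submodule.subset_span ⟨A, hA, rfl⟩)
    · refine fun h c => mem_orthSub_span.2 ?_
      rintro _ ⟨A, hA, rfl⟩
      rw [← bits_inCode_dotProduct]
      exact h _ ⟨_, ⟨c, A, hA, rfl⟩, rfl⟩
  constructor
  · intro h
    exact ⟨fun c v => f (v, c), fun c _ => (key fun c v => f (v, c)).2 h c, rfl⟩
  · rintro ⟨x, hx, rfl⟩
    exact (key x).1 fun c => hx c trivial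

theorem stackCode_hasLogicalDim {k : ℕ} (h : ∀ c, (surfaceCode d c).HasLogicalDim k) :
    (stackCode d).HasLogicalDim (3 * k) := by
  have hfin : ∀ W : Colour → Submodule (ZMod 2) (Vertex d → ZMod 2),
      finrank (ZMod 2) ((Submodule.pi Set.univ W).map (stackEquiv d)) =
        ∑ c, finrank (ZMod 2) (W c) := fun W => by
    rw [← range_inclusionPi, ← LinearMap.range_comp, LinearMap.finrank_range_of_inj,
      finrank_pi_fintype]
    rw [LinearMap.coe_comp]
    exact stackEquiv_injective.comp (inclusionPi_injective W)
  refine ⟨?_, ?_⟩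
  · rw [CSSCode.IsOrthogonal, stackCode_xSpace, stackCode_orthSub_zSpace]
    exact Submodule.map_mono (Submodule.pi_mono fun c _ => (h c).1)
  · rw [stackCode_xSpace, stackCode_orthSub_zSpace, hfin, hfin,
      Finset.sum_congr rfl fun c _ => (h c).2, Finset.sum_add_distrib, Finset.sum_const,
      Finset.card_univ, card_colour, smul_eq_mul]

theorem encoder_mem_range_face (ψ : QState (Vertex d × Colour)) (v : Vertex d) (c : Colour)
    (k : ZMod 2) :
    pauliZ {q : Vertex d × Corner | q.1 = v ∧ q.2 ∈ cubeFace c k} (encoder d ψ) =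
      encoder d ψ := by
  funext t
  rw [pauliZ_apply, encoder_apply, Finset.mul_sum]
  refine Finset.sum_congr rfl fun x _ => ?_
  rw [bits_face_of_cube_dotProduct]
  by_cases hx : ∃ e, (fun s => t (v, s)) = cubeAffine (e, fun c => x (v, c))
  · obtain ⟨e, he⟩ := hx
    rw [he, (exists_cubeAffine_iff _).2 ⟨_, rfl⟩, sgn_zero, one_mul]
  · rw [encoderAmplitude, Finset.prod_eq_zero (Finset.mem_univ v)
      (cubeAmplitude_of_forall_ne (not_exists.1 hx)), zero_mul, mul_zero]

/-- Two opposite faces make up the cube and implement the same encoded X, so their product acts as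
its square. -/
theorem pauliX_cube_encoder (ψ : QState (Vertex d × Colour)) (v : Vertex d) :
    pauliX {q : Vertex d × Corner | q.1 = v} (encoder d ψ) = encoder d ψ := by
  have h : (pauliX {q : Vertex d × Corner | q.1 = v} : QState (Vertex d × Corner) ≃ₗ[ℂ] _) =
      pauliX (liftX .r 0 {v}) * pauliX (liftX .r 1 {v}) := by
    rw [pauliX_eq, pauliX_eq, pauliX_eq, pauliOp_mul (zero_dotProduct _), add_zero,
      bits_liftX_eq, bits_liftX_eq, ← map_add, Prod.mk_add_mk, ← Pi.single_add,
      pi_zmod_two_add_self, Pi.single_zero, bits_cube, bits_singleton]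
    congr 3
    funext v'
    simp [zmod_two_add_self]
  rw [h, LinearEquiv.mul_apply, ← encoder_pauliX, ← encoder_pauliX]
  congr 1
  funext x
  rw [pauliX_apply, pauliX_apply, add_bits_add_bits]

/-- Encoded states are fixed by all generators of the concatenation. Equality follows by dimension,
since the encoder is injective and both code spaces have dimension `2 ^ (3 * k)`. -/
theorem IsConcatenation.map_codeSpace {C : CSSCode (Vertex d × Corner)} (hC : IsConcatenation C)
    {k : ℕ} (h : ∀ c, (surfaceCode d c).HasLogicalDim k) :
    (stackCode d).codeSpace.map (encoder d) = C.codeSpace := by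
  refine Submodule.eq_of_le_of_finrank_eq ?_ ?_
  · rintro _ ⟨ψ, hψ, rfl⟩
    rw [SetLike.mem_coe, CSSCode.mem_codeSpace_iff] at hψ
    refine CSSCode.mem_codeSpace_iff.2 ⟨fun S hS => ?_, fun S hS => ?_⟩
    · rcases hC.of_mem_xSupports S hS with ⟨v, rfl⟩ | ⟨c, k, A, hA, rfl⟩
      · exact pauliX_cube_encoder ψ v
      · rw [← encoder_pauliX, hψ.1 _ ⟨c, A, hA, rfl⟩]
    · rcases hC.of_mem_zSupports S hS with ⟨v, c, k, rfl⟩ | ⟨c, k, A, hA, rfl⟩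
      · exact encoder_mem_range_face ψ v c k
      · rw [← encoder_pauliZ, hψ.2 _ ⟨c, A, hA, rfl⟩]
  · rw [← (Submodule.equivMapOfInjective _ encoder_injective _).finrank_eq, (stackCode_hasLogicalDim h).encodesQubits,
      (hC.hasLogicalDim h).encodesQubits]

end

/-! ### Geometry of the two lattices -/

/-- The sign of the direction from the centre of a cube to a face with given label. -/
def faceSign (t : ZMod 2) : ℤ := if t = 1 then 1 else -1

theorem faceSign_zero : faceSign 0 = -1 := rfl

theorem faceSign_one : faceSign 1 = 1 := rfl

theorem faceSign_injective : Function.Injective faceSign := by decide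

theorem faceSign_cases (t : ZMod 2) : faceSign t = 1 ∨ faceSign t = -1 := by
  revert t; decide

theorem exists_faceSign {a : ℤ} (h : a = 1 ∨ a = -1) : ∃ t, faceSign t = a :=
  h.elim (fun h => ⟨1, h.symm⟩) fun h => ⟨0, h.symm⟩

/-- The centre of the `c`-cell on the side `t` of the vertex `v`. -/
noncomputable def cellAt (c : Colour) (v : Point) (t : ZMod 2) : Point :=
  v + faceSign t • cellDirection c v

/-- The directions of the cells at a vertex, for the three kinds of vertices. -/
theorem cellDirection_cases {v : Point} (hv : IsVertex v) : ∃ ε : ℤ,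
    (ε = 1 ∧ (v.1 + v.2.1 + v.2.2) % 4 = 0 ∨ ε = -1 ∧ (v.1 + v.2.1 + v.2.2) % 4 = 2) ∧
    ((v.1 % 2 = 0 ∧ v.2.1 % 2 = 0 ∧ v.2.2 % 2 = 0 ∧ cellDirection .g v = (0, 0, 1) ∧
        cellDirection .r v = (1, ε, 0) ∧ cellDirection .b v = (1, -ε, 0)) ∨
      (v.1 % 2 = 1 ∧ v.2.1 % 2 = 0 ∧ v.2.2 % 2 = 1 ∧ cellDirection .g v = (1, 0, 0) ∧
        cellDirection .r v = (0, 1, ε) ∧ cellDirection .b v = (0, 1, -ε)) ∨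
      (v.1 % 2 = 0 ∧ v.2.1 % 2 = 1 ∧ v.2.2 % 2 = 1 ∧ cellDirection .g v = (0, 1, 0) ∧
        cellDirection .r v = (1, 0, ε) ∧ cellDirection .b v = (1, 0, -ε))) := by
  obtain ⟨x, y, z⟩ := v
  simp only [IsVertex, Int.even_iff, Int.odd_iff] at hv
  -- In the plane orthogonal to the octahedron axis, this sign tells which diagonal points to the
  -- `.r`-cells; the `.b`-cells lie on the other one.
  refine ⟨if (x + y + z) % 4 = 0 then 1 else -1, ?_, ?_⟩
  · dsimp only
    split_ifs <;> omega
  · rcases hv with ⟨hx, hy, hz⟩ | ⟨hx, hy, hz⟩ | ⟨hx, hy, hz⟩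
    · left
      have hr : IsCentre .r (x + 1, y + 1, z + 0) ↔ (x + y + z) % 4 = 0 := by
        simp only [IsCentre, Int.even_iff, Int.odd_iff]; omega
      have hb : IsCentre .b (x + 1, y + 1, z + 0) ↔ ¬ (x + y + z) % 4 = 0 := by
        simp only [IsCentre, Int.even_iff, Int.odd_iff]; omega
      simp only [cellDirection, Int.even_iff, Int.odd_iff, hx, hy, hz, Prod.mk_add_mk, hr, hb,
        if_true, zero_ne_one, if_false]
      by_cases h : (x + y + z) % 4 = 0 <;> simp [h]
    · right; left
      have hr : IsCentre .r (x + 0, y + 1, z + 1) ↔ (x + y + z) % 4 = 0 := by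
        simp only [IsCentre, Int.even_iff, Int.odd_iff]; omega
      have hb : IsCentre .b (x + 0, y + 1, z + 1) ↔ ¬ (x + y + z) % 4 = 0 := by
        simp only [IsCentre, Int.even_iff, Int.odd_iff]; omega
      simp only [cellDirection, Int.even_iff, Int.odd_iff, hx, hy, hz, Prod.mk_add_mk, hr, hb,
        if_true, one_ne_zero, if_false]
      by_cases h : (x + y + z) % 4 = 0 <;> simp [h]
    · right; right
      have hr : IsCentre .r (x + 1, y + 0, z + 1) ↔ (x + y + z) % 4 = 0 := by
        simp only [IsCentre, Int.even_iff, Int.odd_iff]; omega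
      have hb : IsCentre .b (x + 1, y + 0, z + 1) ↔ ¬ (x + y + z) % 4 = 0 := by
        simp only [IsCentre, Int.even_iff, Int.odd_iff]; omega
      simp only [cellDirection, Int.even_iff, Int.odd_iff, hx, hy, hz, Prod.mk_add_mk, hr, hb,
        one_ne_zero, zero_ne_one, if_false]
      by_cases h : (x + y + z) % 4 = 0 <;> simp [h]

/-- The inner product of integer vectors. -/
def innerProd (p q : Point) : ℤ := p.1 * q.1 + p.2.1 * q.2.1 + p.2.2 * q.2.2

/-- Used in each coordinate with `w` the offset of a point from a cube centre and `u` the step to a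
cell centre: `|w| ≤ 2` and `|w - 4u| ≤ 4` give `|4u| ≤ 6`. -/
theorem abs_le_one_of_sq {u w : ℤ} (h : (w - 4 * u) ^ 2 ≤ 21) (hw : w ^ 2 ≤ 5) :
    -1 ≤ u ∧ u ≤ 1 := by
  have h1 : w ≤ 2 := by nlinarith
  have h2 : -2 ≤ w := by nlinarith
  have h3 : w - 4 * u ≤ 4 := by nlinarith
  have h4 : -4 ≤ w - 4 * u := by nlinarith
  omega

theorem octahedron_direction {u₀ u₁ u₂ : ℤ} (b0 : -1 ≤ u₀ ∧ u₀ ≤ 1) (b1 : -1 ≤ u₁ ∧ u₁ ≤ 1)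
    (b2 : -1 ≤ u₂ ∧ u₂ ≤ 1) (h0 : u₀ % 2 = 1) (h1 : u₁ % 2 = 0) (h2 : u₂ % 2 = 0) :
    u₁ = 0 ∧ u₂ = 0 ∧ (u₀ = 1 ∨ u₀ = -1) := by
  omega

/-- Parity leaves the four diagonal vectors of a plane; the sum modulo four keeps one opposite pair.
-/
theorem cuboctahedron_direction {ε u₀ u₁ u₂ : ℤ} (hε : ε = 1 ∨ ε = -1)
    (b0 : -1 ≤ u₀ ∧ u₀ ≤ 1) (b1 : -1 ≤ u₁ ∧ u₁ ≤ 1) (b2 : -1 ≤ u₂ ∧ u₂ ≤ 1)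
    (h0 : u₀ % 2 = 0) (h1 : u₁ % 2 = 1) (h2 : u₂ % 2 = 1)
    (h3 : (u₀ + u₁ + u₂) % 4 = (1 + ε) % 4) :
    u₀ = 0 ∧ u₂ = u₁ * ε ∧ (u₁ = 1 ∨ u₁ = -1) := by
  rcases hε with rfl | rfl <;> omega

theorem point_ext {p q : Point} (h1 : p.1 = q.1) (h2 : p.2.1 = q.2.1) (h3 : p.2.2 = q.2.2) :
    p = q := Prod.ext h1 (Prod.ext h2 h3)

/-- A cell near a vertex is one of the two cells at this vertex. -/
theorem eq_cellAt_of_bounds {c : Colour} {v p : Point} (hv : IsVertex v) (hp : IsCentre c p)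
    (h0 : -1 ≤ p.1 - v.1 ∧ p.1 - v.1 ≤ 1) (h1 : -1 ≤ p.2.1 - v.2.1 ∧ p.2.1 - v.2.1 ≤ 1)
    (h2 : -1 ≤ p.2.2 - v.2.2 ∧ p.2.2 - v.2.2 ≤ 1) : ∃ t, p = cellAt c v t := by
  obtain ⟨ε, hε, hcases⟩ := cellDirection_cases hv
  have hε' : ε = 1 ∨ ε = -1 := hε.imp And.left And.left
  have hε'' : -ε = 1 ∨ -ε = -1 := by omega
  obtain ⟨x, y, z⟩ := v
  obtain ⟨p, q, r⟩ := p
  dsimp only at hε hcases h0 h1 h2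
  rcases hcases with ⟨hx, hy, hz, hg, hr, hb⟩ | ⟨hx, hy, hz, hg, hr, hb⟩ |
    ⟨hx, hy, hz, hg, hr, hb⟩ <;> cases c <;>
    simp only [IsCentre, Int.even_iff, Int.odd_iff] at hp <;>
    simp only [cellAt, hg, hr, hb]
  -- The bounds are permuted so that the coordinate along the octahedron axis comes first, here and
  -- in the other cases.
  · obtain ⟨e0, e2, e1⟩ := cuboctahedron_direction hε' h2 h0 h1
      (by omega) (by omega) (by omega) (by omega)
    obtain ⟨t, ht⟩ := exists_faceSign e1
    refine ⟨t, point_ext ?_ ?_ ?_⟩ <;> rw [ht] <;> simp <;> linarith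
  · obtain ⟨e0, e2, e1⟩ := octahedron_direction h2 h0 h1
      (by omega) (by omega) (by omega)
    obtain ⟨t, ht⟩ := exists_faceSign e1
    refine ⟨t, point_ext ?_ ?_ ?_⟩ <;> rw [ht] <;> simp <;> linarith
  · obtain ⟨e0, e2, e1⟩ := cuboctahedron_direction hε'' h2 h0 h1
      (by omega) (by omega) (by omega) (by omega)
    obtain ⟨t, ht⟩ := exists_faceSign e1
    refine ⟨t, point_ext ?_ ?_ ?_⟩ <;> rw [ht] <;> simp <;> linarith
  · obtain ⟨e0, e2, e1⟩ := cuboctahedron_direction hε' h0 h1 h2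
      (by omega) (by omega) (by omega) (by omega)
    obtain ⟨t, ht⟩ := exists_faceSign e1
    refine ⟨t, point_ext ?_ ?_ ?_⟩ <;> rw [ht] <;> simp <;> linarith
  · obtain ⟨e0, e2, e1⟩ := octahedron_direction h0 h1 h2
      (by omega) (by omega) (by omega)
    obtain ⟨t, ht⟩ := exists_faceSign e1
    refine ⟨t, point_ext ?_ ?_ ?_⟩ <;> rw [ht] <;> simp <;> linarith
  · obtain ⟨e0, e2, e1⟩ := cuboctahedron_direction hε'' h0 h1 h2
      (by omega) (by omega) (by omega) (by omega)
    obtain ⟨t, ht⟩ := exists_faceSign e1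
    refine ⟨t, point_ext ?_ ?_ ?_⟩ <;> rw [ht] <;> simp <;> linarith
  · obtain ⟨e0, e2, e1⟩ := cuboctahedron_direction hε' h1 h0 h2
      (by omega) (by omega) (by omega) (by omega)
    obtain ⟨t, ht⟩ := exists_faceSign e1
    refine ⟨t, point_ext ?_ ?_ ?_⟩ <;> rw [ht] <;> simp <;> linarith
  · obtain ⟨e0, e2, e1⟩ := octahedron_direction h1 h0 h2
      (by omega) (by omega) (by omega)
    obtain ⟨t, ht⟩ := exists_faceSign e1
    refine ⟨t, point_ext ?_ ?_ ?_⟩ <;> rw [ht] <;> simp <;> linarith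
  · obtain ⟨e0, e2, e1⟩ := cuboctahedron_direction hε'' h1 h0 h2
      (by omega) (by omega) (by omega) (by omega)
    obtain ⟨t, ht⟩ := exists_faceSign e1
    refine ⟨t, point_ext ?_ ?_ ?_⟩ <;> rw [ht] <;> simp <;> linarith

theorem faceSign_sq (t : ZMod 2) : faceSign t ^ 2 = 1 := by
  rcases faceSign_cases t with h | h <;> rw [h] <;> rfl

theorem sqDist_cellAt {v : Point} (hv : IsVertex v) (c : Colour) (t : ZMod 2) :
    sqDist v (cellAt c v t) = cellRadius c := by
  obtain ⟨ε, hε, hcases⟩ := cellDirection_cases hv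
  have hε' : ε ^ 2 = 1 := by rcases hε with ⟨rfl, _⟩ | ⟨rfl, _⟩ <;> rfl
  have ht := faceSign_sq t
  rcases hcases with ⟨-, -, -, hg, hr, hb⟩ | ⟨-, -, -, hg, hr, hb⟩ | ⟨-, -, -, hg, hr, hb⟩ <;>
    cases c <;> simp [cellAt, hg, hr, hb, sqDist, cellRadius, mul_pow, ht, hε']

theorem isCentre_cellAt {v : Point} (hv : IsVertex v) (c : Colour) (t : ZMod 2) :
    IsCentre c (cellAt c v t) := by
  obtain ⟨ε, hε, hcases⟩ := cellDirection_cases hv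
  rcases hcases with ⟨hx, hy, hz, hg, hr, hb⟩ | ⟨hx, hy, hz, hg, hr, hb⟩ |
    ⟨hx, hy, hz, hg, hr, hb⟩ <;>
    rcases hε with ⟨rfl, hs⟩ | ⟨rfl, hs⟩ <;> rcases faceSign_cases t with h | h <;>
    cases c <;> simp [cellAt, hg, hr, hb, IsCentre, Int.even_iff, Int.odd_iff, h] <;> omega

theorem cellDirection_ne_zero {v : Point} (hv : IsVertex v) (c : Colour) :
    cellDirection c v ≠ 0 := by
  obtain ⟨ε, hε, hcases⟩ := cellDirection_cases hv
  rcases hcases with ⟨-, -, -, hg, hr, hb⟩ | ⟨-, -, -, hg, hr, hb⟩ | ⟨-, -, -, hg, hr, hb⟩ <;>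
    cases c <;> simp [hg, hr, hb]

theorem cellAt_injective {v : Point} (hv : IsVertex v) (c : Colour) :
    Function.Injective (cellAt c v) := fun _ _ h =>
  faceSign_injective (smul_left_injective ℤ (cellDirection_ne_zero hv c) (add_left_cancel h))

theorem innerProd_cellDirection {v : Point} (hv : IsVertex v) (c : Colour) :
    innerProd (cellDirection c v) (cellDirection c v) = cellRadius c := by
  have h := sqDist_cellAt hv c 1
  rw [← h]
  simp [sqDist, cellAt, innerProd, faceSign_one]
  ring

theorem sqDist_scaled_cellAt {v : Point} (hv : IsVertex v) (c : Colour) (t : ZMod 2) (P : Point) :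
    sqDist P (scaled (cellAt c v t)) = sqDist P (scaled v) + 16 * cellRadius c -
      8 * (faceSign t * innerProd (P - scaled v) (cellDirection c v)) := by
  have ht := faceSign_sq t
  rw [← innerProd_cellDirection hv]
  simp [sqDist, cellAt, innerProd, scaled]
  linear_combination 16 * ((cellDirection c v).1 ^ 2 + (cellDirection c v).2.1 ^ 2 +
    (cellDirection c v).2.2 ^ 2) * ht

/-- The form in which `sqDist_scaled_cellAt` produces the radius: at a corner on the side of the
cell, the squared distance is `5 + 16 R - 8 R` with `R` the value of `cellRadius`. -/
theorem truncatedRadius_eq (c : Colour) : truncatedRadius c = 5 + 8 * cellRadius c := by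
  cases c <;> rfl

theorem sq_le_sqDist (P Q : Point) : (P.1 - Q.1) ^ 2 ≤ sqDist P Q ∧
    (P.2.1 - Q.2.1) ^ 2 ≤ sqDist P Q ∧ (P.2.2 - Q.2.2) ^ 2 ≤ sqDist P Q := by
  simp only [sqDist]
  refine ⟨?_, ?_, ?_⟩ <;> nlinarith

/-- A cell with a given vertex is one of the two cells at this vertex. -/
theorem eq_cellAt_of_sqDist_eq_cellRadius {c : Colour} {v p : Point} (hv : IsVertex v)
    (hp : IsCentre c p) (h : sqDist v p = cellRadius c) : ∃ t, p = cellAt c v t := by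
  have bound : ∀ u w : ℤ, (u - w) ^ 2 ≤ cellRadius c → -1 ≤ w - u ∧ w - u ≤ 1 := fun u w hu => by
    have hR : cellRadius c ≤ 2 := by cases c <;> decide
    constructor <;> nlinarith
  have hs := sq_le_sqDist v p
  rw [h] at hs
  exact eq_cellAt_of_bounds hv hp (bound _ _ hs.1) (bound _ _ hs.2.1) (bound _ _ hs.2.2)

/-- A truncated cell near the cube of a vertex replaces one of the two cells at this vertex. -/
theorem eq_cellAt_of_sqDist {c : Colour} {v p P : Point} (hv : IsVertex v) (hp : IsCentre c p)
    (h5 : sqDist P (scaled v) = 5) (h : sqDist P (scaled p) = truncatedRadius c) :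
    ∃ t, p = cellAt c v t ∧
      innerProd (P - scaled v) (cellDirection c v) = faceSign t * cellRadius c := by
  have bound : ∀ x a b : ℤ, (x - 4 * a) ^ 2 ≤ 5 → (x - 4 * b) ^ 2 ≤ truncatedRadius c →
      -1 ≤ b - a ∧ b - a ≤ 1 := fun x a b h1 h2 => by
    have hR : truncatedRadius c ≤ 21 := by cases c <;> decide
    refine abs_le_one_of_sq (w := x - 4 * a) ?_ h1
    rw [show x - 4 * a - 4 * (b - a) = x - 4 * b by ring]
    linarith
  have h1 := sq_le_sqDist P (scaled v)
  have h2 := sq_le_sqDist P (scaled p)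
  rw [h5] at h1
  rw [h] at h2
  obtain ⟨t, rfl⟩ := eq_cellAt_of_bounds hv hp (bound _ _ _ h1.1 h2.1) (bound _ _ _ h1.2.1 h2.2.1)
    (bound _ _ _ h1.2.2 h2.2.2)
  refine ⟨t, rfl, ?_⟩
  rw [sqDist_scaled_cellAt hv, h5, truncatedRadius_eq] at h
  have h3 : faceSign t * innerProd (P - scaled v) (cellDirection c v) = cellRadius c := by linarith
  rw [← h3, ← mul_assoc, ← pow_two, faceSign_sq, one_mul]

/-- The offset of the vertices of the cantitruncated lattice from the centre of their cube. -/
noncomputable def cornerOffset (v : Point) (s : Corner) : Point :=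
  ∑ c, faceSign (s c) • cellDirection c v

/-- The three directions are pairwise orthogonal, so only the summand of `c` contributes. -/
theorem innerProd_cornerOffset {v : Point} (hv : IsVertex v) (s : Corner) (c : Colour) :
    innerProd (cornerOffset v s) (cellDirection c v) = faceSign (s c) * cellRadius c := by
  obtain ⟨ε, hε, hcases⟩ := cellDirection_cases hv
  have hε' : ε * ε = 1 := by rcases hε with ⟨rfl, _⟩ | ⟨rfl, _⟩ <;> rfl
  rw [cornerOffset, sum_colour]
  rcases hcases with ⟨-, -, -, hg, hr, hb⟩ | ⟨-, -, -, hg, hr, hb⟩ | ⟨-, -, -, hg, hr, hb⟩ <;>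
    cases c <;> simp only [hg, hr, hb, innerProd, cellRadius, Prod.smul_mk, Prod.mk_add_mk,
      smul_eq_mul] <;> grind

/-- By orthogonality the squared lengths `1`, `2`, `2` of the three directions add up. -/
theorem sq_cornerOffset {v : Point} (hv : IsVertex v) (s : Corner) :
    innerProd (cornerOffset v s) (cornerOffset v s) = 5 := by
  obtain ⟨ε, hε, hcases⟩ := cellDirection_cases hv
  have hε' : ε * ε = 1 := by rcases hε with ⟨rfl, _⟩ | ⟨rfl, _⟩ <;> rfl
  have h1 := faceSign_sq (s .r)
  have h2 := faceSign_sq (s .g)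
  have h3 := faceSign_sq (s .b)
  rw [cornerOffset, sum_colour]
  rcases hcases with ⟨-, -, -, hg, hr, hb⟩ | ⟨-, -, -, hg, hr, hb⟩ | ⟨-, -, -, hg, hr, hb⟩ <;>
    simp only [hg, hr, hb, innerProd, Prod.smul_mk, Prod.mk_add_mk, smul_eq_mul] <;> grind

/-- A vector is determined by its inner products with the directions of the cells. -/
theorem eq_cornerOffset {v w : Point} (hv : IsVertex v) (s : Corner)
    (h : ∀ c, innerProd w (cellDirection c v) = faceSign (s c) * cellRadius c) :
    w = cornerOffset v s := by
  obtain ⟨ε, hε, hcases⟩ := cellDirection_cases hv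
  have hr' := h .r
  have hg' := h .g
  have hb' := h .b
  rw [cornerOffset, sum_colour]
  rcases hcases with ⟨-, -, -, hg, hr, hb⟩ | ⟨-, -, -, hg, hr, hb⟩ | ⟨-, -, -, hg, hr, hb⟩ <;>
    simp only [hg, hr, hb, innerProd, cellRadius] at hr' hg' hb' ⊢ <;>
    refine point_ext ?_ ?_ ?_ <;> simp only [Prod.smul_mk, Prod.mk_add_mk, smul_eq_mul] <;>
    rcases hε with ⟨rfl, -⟩ | ⟨rfl, -⟩ <;> linarith

/-! ### Qubits as lattice points and truncated cells as lifts -/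

section

variable {d : ℕ}

theorem mem_latticeVertices {p : Point} : p ∈ latticeVertices d ↔ InBox d p ∧ IsVertex p := by
  obtain ⟨x, y, z⟩ := p
  simp only [latticeVertices, Finset.mem_filter, Finset.mem_Icc, Prod.mk_le_mk, InBox]
  tauto

theorem Vertex.isVertex (v : Vertex d) : IsVertex v.1 := (mem_latticeVertices.1 v.2).2

theorem Vertex.inBox (v : Vertex d) : InBox d v.1 := (mem_latticeVertices.1 v.2).1

theorem position_eq (q : Vertex d × Corner) : position q = scaled q.1.1 + cornerOffset q.1.1 q.2 :=
  rfl

theorem position_sub (q : Vertex d × Corner) :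
    position q - scaled q.1.1 = cornerOffset q.1.1 q.2 := by
  rw [position_eq, add_sub_cancel_left]

theorem sqDist_eq_innerProd (P Q : Point) : sqDist P Q = innerProd (P - Q) (P - Q) := by
  simp only [sqDist, innerProd, Prod.fst_sub, Prod.snd_sub]; ring

theorem sqDist_position (q : Vertex d × Corner) : sqDist (position q) (scaled q.1.1) = 5 := by
  rw [sqDist_eq_innerProd, position_sub, sq_cornerOffset q.1.isVertex]

/-- The cube containing a vertex of the cantitruncated lattice is unique. -/
theorem eq_of_sqDist_scaled {v v' P : Point} (hv : IsVertex v) (hv' : IsVertex v')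
    (h : sqDist P (scaled v) = 5) (h' : sqDist P (scaled v') = 5) : v = v' := by
  obtain ⟨x, y, z⟩ := v
  obtain ⟨x', y', z'⟩ := v'
  obtain ⟨p, q, r⟩ := P
  simp only [IsVertex, Int.even_iff, Int.odd_iff] at hv hv'
  simp only [sqDist, scaled] at h h'
  obtain ⟨a, rfl⟩ : ∃ a, x' = x + a := ⟨x' - x, by ring⟩
  obtain ⟨b, rfl⟩ : ∃ b, y' = y + b := ⟨y' - y, by ring⟩
  obtain ⟨c, rfl⟩ : ∃ c, z' = z + c := ⟨z' - z, by ring⟩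
  obtain ⟨w₀, rfl⟩ : ∃ w, p = 4 * x + w := ⟨p - 4 * x, by ring⟩
  obtain ⟨w₁, rfl⟩ : ∃ w, q = 4 * y + w := ⟨q - 4 * y, by ring⟩
  obtain ⟨w₂, rfl⟩ : ∃ w, r = 4 * z + w := ⟨r - 4 * z, by ring⟩
  have hw : w₀ ^ 2 + w₁ ^ 2 + w₂ ^ 2 = 5 := by linarith
  have hN : w₀ * a + w₁ * b + w₂ * c = 2 * (a ^ 2 + b ^ 2 + c ^ 2) := by linarith
  -- With `u = (a, b, c)`, Cauchy–Schwarz and `w · u = 2 |u|²` give `4 |u|⁴ ≤ 5 |u|²`, hence `|u|² ≤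
  -- 1`.
  have hcs : (w₀ * a + w₁ * b + w₂ * c) ^ 2 ≤
      (w₀ ^ 2 + w₁ ^ 2 + w₂ ^ 2) * (a ^ 2 + b ^ 2 + c ^ 2) := by
    nlinarith [sq_nonneg (w₀ * b - w₁ * a), sq_nonneg (w₀ * c - w₂ * a),
      sq_nonneg (w₁ * c - w₂ * b)]
  rw [hw, hN] at hcs
  have hle : a ^ 2 + b ^ 2 + c ^ 2 ≤ 1 := by nlinarith
  have bound : ∀ u : ℤ, u ^ 2 ≤ 1 → -1 ≤ u ∧ u ≤ 1 := fun u hu => by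
    constructor <;> nlinarith
  have ha := bound a (by linarith [sq_nonneg b, sq_nonneg c])
  have hb := bound b (by linarith [sq_nonneg a, sq_nonneg c])
  have hc := bound c (by linarith [sq_nonneg a, sq_nonneg b])
  clear hcs hN hw h h' bound
  -- A unit vector never joins two vertices: any two of the three parity classes differ in exactly
  -- two coordinates.
  have key : a = 0 ∧ b = 0 ∧ c = 0 := by
    obtain ⟨ha1, ha2⟩ := ha
    obtain ⟨hb1, hb2⟩ := hb
    obtain ⟨hc1, hc2⟩ := hc
    interval_cases a <;> interval_cases b <;> interval_cases c <;> first
      | exact ⟨rfl, rfl, rfl⟩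
      | (exfalso; omega)
  obtain ⟨rfl, rfl, rfl⟩ := key
  simp

theorem mem_cubeQubits_iff {v : Point} (hv : IsVertex v) {q : Vertex d × Corner} :
    q ∈ cubeQubits d v ↔ q.1.1 = v := by
  constructor
  · exact eq_of_sqDist_scaled q.1.isVertex hv (sqDist_position q)
  · rintro rfl
    exact sqDist_position q

theorem cubeQubits_eq (v : Vertex d) : cubeQubits d v.1 = {q | q.1 = v} := by
  ext q
  rw [mem_cubeQubits_iff v.isVertex]
  exact Subtype.ext_iff.symm

/-- The truncated cells near a cube come from the two cells at its vertex, and the sign of the inner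
product with the direction tells on whose side the corner lies. -/
theorem mem_cellQubits_iff {c : Colour} {p : Point} (hp : IsCentre c p) {q : Vertex d × Corner} :
    q ∈ cellQubits d c p ↔ p = cellAt c q.1.1 (q.2 c) := by
  constructor
  · intro h
    obtain ⟨t, rfl, ht⟩ := eq_cellAt_of_sqDist q.1.isVertex hp (sqDist_position q) h
    rw [position_sub, innerProd_cornerOffset q.1.isVertex] at ht
    rw [faceSign_injective (mul_right_cancel₀ (by cases c <;> decide) ht)]
  · rintro rfl
    change sqDist _ _ = _
    rw [sqDist_scaled_cellAt q.1.isVertex, sqDist_position, position_sub,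
      innerProd_cornerOffset q.1.isVertex, truncatedRadius_eq]
    linear_combination (-8 * cellRadius c) * faceSign_sq (q.2 c)

theorem mem_cellVertices_iff {c : Colour} {p : Point} (hp : IsCentre c p) {v : Vertex d} :
    v ∈ cellVertices d c p ↔ ∃ t, p = cellAt c v.1 t := by
  constructor
  · exact eq_cellAt_of_sqDist_eq_cellRadius v.isVertex hp
  · rintro ⟨t, rfl⟩
    exact sqDist_cellAt v.isVertex c t

/-- A point determines its cube, and the truncated cells through it determine the three sides, hence
the corner. -/
theorem position_injective : Function.Injective (position : Vertex d × Corner → Point) := by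
  intro q q' h
  have h1 : q.1 = q'.1 := by
    have : q ∈ cubeQubits d q'.1.1 := by
      change sqDist _ _ = 5
      rw [h]
      exact sqDist_position q'
    rw [cubeQubits_eq] at this
    exact this
  refine Prod.ext h1 (funext fun c => ?_)
  have h2 : q ∈ cellQubits d c (cellAt c q'.1.1 (q'.2 c)) := by
    change sqDist _ _ = _
    rw [h]
    exact (mem_cellQubits_iff (isCentre_cellAt q'.1.isVertex c _)).2 rfl
  rw [mem_cellQubits_iff (isCentre_cellAt q'.1.isVertex c _), h1] at h2
  exact (cellAt_injective q'.1.isVertex c h2).symm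

theorem range_position : Set.range (position : Vertex d × Corner → Point) =
    {P | ∃ v : Vertex d, IsCubeVertex v.1 P} := by
  ext P
  constructor
  · rintro ⟨q, rfl⟩
    exact ⟨q.1, sqDist_position q, fun c => ⟨_, isCentre_cellAt q.1.isVertex c _,
      (mem_cellQubits_iff (isCentre_cellAt q.1.isVertex c (q.2 c))).2 rfl⟩⟩
  · rintro ⟨v, h5, h⟩
    have h1 : ∀ c, ∃ t, innerProd (P - scaled v.1) (cellDirection c v.1) =
        faceSign t * cellRadius c := fun c => by
      obtain ⟨p, hp, hP⟩ := h c
      obtain ⟨t, -, ht⟩ := eq_cellAt_of_sqDist v.isVertex hp h5 hP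
      exact ⟨t, ht⟩
    choose s hs using h1
    refine ⟨(v, s), ?_⟩
    rw [position_eq, ← eq_cornerOffset v.isVertex s hs]
    exact add_sub_cancel _ _

open scoped Classical in
-- The label selects the face of each cube that points towards `p`, that is, which of the two cells
-- at the vertex is `p`. Off the cell its value is immaterial.
theorem cellQubits_eq_liftX {c : Colour} {p : Point} (hp : IsCentre c p) :
    cellQubits d c p = liftX c (fun v => if p = cellAt c v.1 1 then 1 else 0)
      (cellVertices d c p) := by
  ext q
  rw [mem_cellQubits_iff hp]
  change _ ↔ q.1 ∈ cellVertices d c p ∧ q.2 c = _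
  rw [mem_cellVertices_iff hp]
  have hinj := cellAt_injective q.1.isVertex c
  constructor
  · intro h
    refine ⟨⟨_, h⟩, ?_⟩
    rw [h]
    rcases zmod_two_cases (q.2 c) with h' | h' <;> simp [h', hinj.eq_iff]
  · rintro ⟨⟨t, rfl⟩, h⟩
    rw [h]
    rcases zmod_two_cases t with h' | h' <;> simp [h', hinj.eq_iff]

theorem eq_of_ne_of_ne {c c₁ c₂ : Colour} (h₁ : c₁ ≠ c) (h₂ : c₂ ≠ c) (h : c₁ ≠ c₂) {c' : Colour}
    (h' : c' ≠ c) : c' = c₁ ∨ c' = c₂ := by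
  have key : ∀ c c₁ c₂ c' : Colour, c₁ ≠ c → c₂ ≠ c → c₁ ≠ c₂ → c' ≠ c → c' = c₁ ∨ c' = c₂ := by
    decide
  exact key c c₁ c₂ c' h₁ h₂ h h'

open scoped Classical in
-- Two faces of a cube with different colours meet in an edge along the third colour.
theorem liftX_inter_liftX {c c₁ c₂ : Colour} (h₁ : c₁ ≠ c) (h₂ : c₂ ≠ c) (h : c₁ ≠ c₂)
    (k₁ k₂ : Vertex d → ZMod 2) (A₁ A₂ : Set (Vertex d)) :
    liftX c₁ k₁ A₁ ∩ liftX c₂ k₂ A₂ =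
      liftZ c (fun v c' => if c' = c₁ then k₁ v else k₂ v) (A₁ ∩ A₂) := by
  ext q
  change (q.1 ∈ A₁ ∧ q.2 c₁ = _) ∧ (q.1 ∈ A₂ ∧ q.2 c₂ = _) ↔
    (q.1 ∈ A₁ ∧ q.1 ∈ A₂) ∧ ∀ c', c' ≠ c → q.2 c' = _
  have key : (∀ c', c' ≠ c → q.2 c' = if c' = c₁ then k₁ q.1 else k₂ q.1) ↔
      q.2 c₁ = k₁ q.1 ∧ q.2 c₂ = k₂ q.1 := by
    constructor
    · intro h'
      have e1 := h' c₁ h₁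
      have e2 := h' c₂ h₂
      rw [if_pos rfl] at e1
      rw [if_neg h.symm] at e2
      exact ⟨e1, e2⟩
    · rintro ⟨e1, e2⟩ c' hc'
      rcases eq_of_ne_of_ne h₁ h₂ h hc' with rfl | rfl
      · rw [if_pos rfl, e1]
      · rw [if_neg h.symm, e2]
  rw [key]
  tauto

theorem IsFace.isCentre {c₁ c₂ : Colour} {p₁ p₂ : Point} (h : IsFace d c₁ p₁ c₂ p₂) :
    IsCentre c₁ p₁ ∧ IsCentre c₂ p₂ := ⟨h.1.2.1, h.1.2.2.1⟩

theorem exists_third_colour {c₁ c₂ : Colour} (h : c₁ ≠ c₂) : ∃ c, c₁ ≠ c ∧ c₂ ≠ c := by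
  revert c₁ c₂; decide

theorem exists_liftZ_of_isFace {c c₁ c₂ : Colour} {p₁ p₂ : Point} (h₁ : c₁ ≠ c) (h₂ : c₂ ≠ c)
    (h : IsFace d c₁ p₁ c₂ p₂) : ∃ k, cellQubits d c₁ p₁ ∩ cellQubits d c₂ p₂ =
      liftZ c k (cellVertices d c₁ p₁ ∩ cellVertices d c₂ p₂) := by
  rw [cellQubits_eq_liftX h.isCentre.1, cellQubits_eq_liftX h.isCentre.2,
    liftX_inter_liftX h₁ h₂ h.1.1]
  exact ⟨_, rfl⟩

theorem cubeQubits_inter_cellQubits (v : Vertex d) (c : Colour) (t : ZMod 2) :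
    cubeQubits d v.1 ∩ cellQubits d c (cellAt c v.1 t) = {q | q.1 = v ∧ q.2 ∈ cubeFace c t} := by
  ext q
  rw [cubeQubits_eq, Set.mem_inter_iff, mem_cellQubits_iff (isCentre_cellAt v.isVertex c t)]
  refine and_congr_right fun (h : q.1 = v) => ?_
  rw [h, (cellAt_injective v.isVertex c).eq_iff, eq_comm]
  rfl

/-- The colour code is the concatenation of the surface codes with the cube code. -/
theorem colourCode_isConcatenation (d : ℕ) : IsConcatenation (colourCode d) where
  cube_mem v := Or.inl ⟨v, (cubeQubits_eq v).symm⟩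
  exists_liftX := by
    rintro c _ ⟨p, hp, rfl⟩
    exact ⟨_, Or.inr ⟨c, p, hp, (cellQubits_eq_liftX hp.1).symm⟩⟩
  of_mem_xSupports := by
    rintro _ (⟨v, rfl⟩ | ⟨c, p, hp, rfl⟩)
    · exact Or.inl ⟨v, cubeQubits_eq v⟩
    · exact Or.inr ⟨c, _, _, ⟨p, hp, rfl⟩, cellQubits_eq_liftX hp.1⟩
  face_mem v c k := Or.inl ⟨v, c, _, isCentre_cellAt v.isVertex c k, sqDist_cellAt v.isVertex c k,
    (cubeQubits_inter_cellQubits v c k).symm⟩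
  exists_liftZ := by
    rintro c _ ⟨c₁, p₁, c₂, p₂, h₁, h₂, h, rfl⟩
    obtain ⟨k, hk⟩ := exists_liftZ_of_isFace h₁ h₂ h
    exact ⟨k, Or.inr ⟨c₁, p₁, c₂, p₂, h, hk.symm⟩⟩
  of_mem_zSupports := by
    rintro _ (⟨v, c, p, hp, hvp, rfl⟩ | ⟨c₁, p₁, c₂, p₂, h, rfl⟩)
    · obtain ⟨t, rfl⟩ := eq_cellAt_of_sqDist_eq_cellRadius v.isVertex hp hvp
      exact Or.inl ⟨v, c, t, cubeQubits_inter_cellQubits v c t⟩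
    · obtain ⟨c, h₁, h₂⟩ := exists_third_colour h.1.1
      obtain ⟨k, hk⟩ := exists_liftZ_of_isFace h₁ h₂ h
      exact Or.inr ⟨c, k, _, ⟨c₁, p₁, c₂, p₂, h₁, h₂, h, rfl⟩, hk⟩

end

/-! ### Boundaries and edges -/

section

variable {d : ℕ}

theorem inBox_iff_coord {p : Point} : InBox d p ↔ ∀ c, 0 ≤ coord c p ∧ coord c p ≤ 2 * d - 2 := by
  constructor
  · intro h c
    cases c
    · exact h.1
    · exact h.2.2
    · exact h.2.1
  · exact fun h => ⟨h .r, h .b, h .g⟩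

/-- Displacements in the other coordinates never lose a cell: an odd coordinate of a vertex leaves
room on both sides, and the cuboctahedra one unit outside a lateral side of the other colour are
kept as flattened cells. -/
theorem isCell_cellAt_iff (v : Vertex d) (c : Colour) (t : ZMod 2) :
    IsCell d c (cellAt c v.1 t) ↔
      0 ≤ coord c (cellAt c v.1 t) ∧ coord c (cellAt c v.1 t) ≤ 2 * d - 2 := by
  refine (and_iff_right (isCentre_cellAt v.isVertex c t)).trans ?_
  obtain ⟨ε, hε, hcases⟩ := cellDirection_cases v.isVertex
  obtain ⟨⟨x0, x1⟩, ⟨y0, y1⟩, z0, z1⟩ := v.inBox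
  obtain ⟨⟨x, y, z⟩, hv⟩ := v
  dsimp only at hcases hε x0 x1 y0 y1 z0 z1
  rcases hcases with ⟨hx, hy, hz, hg, hr, hb⟩ | ⟨hx, hy, hz, hg, hr, hb⟩ |
    ⟨hx, hy, hz, hg, hr, hb⟩ <;>
    rcases hε with ⟨rfl, -⟩ | ⟨rfl, -⟩ <;> rcases faceSign_cases t with h | h <;>
    cases c <;> simp only [cellAt, hg, hr, hb, InBox, coord, h, Prod.smul_mk, Prod.mk_add_mk,
      smul_eq_mul] <;> omega

theorem coord_cellAt (v : Vertex d) (c : Colour) :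
    (coord c v.1 % 2 = 0 → ∀ t, coord c (cellAt c v.1 t) = coord c v.1 + 1 ∨
      coord c (cellAt c v.1 t) = coord c v.1 - 1) ∧
    (coord c v.1 % 2 = 1 → ∀ t, coord c (cellAt c v.1 t) = coord c v.1) ∧
    coord c (cellAt c v.1 0) + coord c (cellAt c v.1 1) = 2 * coord c v.1 := by
  obtain ⟨ε, hε, hcases⟩ := cellDirection_cases v.isVertex
  obtain ⟨⟨x, y, z⟩, hv⟩ := v
  dsimp only at hcases hε
  rcases hcases with ⟨hx, hy, hz, hg, hr, hb⟩ | ⟨hx, hy, hz, hg, hr, hb⟩ |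
    ⟨hx, hy, hz, hg, hr, hb⟩ <;>
    rcases hε with ⟨rfl, -⟩ | ⟨rfl, -⟩ <;>
    cases c <;> simp only [cellAt, hg, hr, hb, coord, Prod.smul_mk, Prod.mk_add_mk,
      smul_eq_mul, faceSign_zero, faceSign_one] <;>
    refine ⟨fun _ t => ?_, fun _ t => ?_, ?_⟩ <;>
    (try rcases faceSign_cases t with h | h <;> rw [h]) <;> omega

theorem mem_surfaceBoundary {c : Colour} {i : Bool} {v : Vertex d} :
    v ∈ surfaceBoundary d c i ↔ coord c v.1 = if i then 2 * (d : ℤ) - 2 else 0 := Iff.rfl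

/-- At a vertex on a boundary, exactly one of the two cells is missing. -/
theorem exists_not_isCell_iff (hd : 2 ≤ d) {c : Colour} {i : Bool} {v : Vertex d}
    (hv : v ∈ surfaceBoundary d c i) : ∃ k, ∀ t, ¬ IsCell d c (cellAt c v.1 t) ↔ t = k := by
  simp only [isCell_cellAt_iff]
  rw [mem_surfaceBoundary] at hv
  obtain ⟨h1, -, h2⟩ := coord_cellAt v c
  have h3 : coord c v.1 = 0 ∨ coord c v.1 = 2 * (d : ℤ) - 2 := by
    cases i <;> simp at hv <;> omega
  have h4 := h1 (by omega)
  have e0 := h4 0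
  have e1 := h4 1
  -- The two cells lie one unit on either side of the boundary value, and `2 ≤ d` prevents both from
  -- being outside.
  have key : ∃ k, ∀ t : ZMod 2, (t = 0 ∨ t = 1) → (¬ (0 ≤ coord c (cellAt c v.1 t) ∧
      coord c (cellAt c v.1 t) ≤ 2 * d - 2) ↔ t = k) := by
    by_cases h0 : 0 ≤ coord c (cellAt c v.1 0) ∧ coord c (cellAt c v.1 0) ≤ 2 * d - 2
    · refine ⟨1, ?_⟩
      rintro t (rfl | rfl)
      · simp [h0]
      · simp only [iff_true]
        omega
    · refine ⟨0, ?_⟩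
      rintro t (rfl | rfl)
      · simp [h0]
      · simp only [one_ne_zero, iff_false, not_not]
        omega
  obtain ⟨k, hk⟩ := key
  exact ⟨k, fun t => hk t (zmod_two_cases t)⟩

/-- Off the boundaries, both cells at a vertex are present. -/
theorem isCell_cellAt {c : Colour} {v : Vertex d} (hv : ∀ i, v ∉ surfaceBoundary d c i)
    (t : ZMod 2) : IsCell d c (cellAt c v.1 t) := by
  rw [isCell_cellAt_iff]
  have h0 := hv false
  have h1 := hv true
  rw [mem_surfaceBoundary] at h0 h1
  simp only [Bool.false_eq_true, if_false, if_true] at h0 h1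
  have hb := inBox_iff_coord.1 v.inBox c
  obtain ⟨e1, e2, -⟩ := coord_cellAt v c
  rcases Int.emod_two_eq_zero_or_one (coord c v.1) with h | h
  · have := e1 h t
    omega
  · rw [e2 h t]
    exact hb

theorem setOf_isCell_eq (c : Colour) (v : Vertex d) :
    {p | IsCell d c p ∧ v ∈ cellVertices d c p} =
      cellAt c v.1 '' {t | IsCell d c (cellAt c v.1 t)} := by
  ext p
  constructor
  · rintro ⟨hp, hv⟩
    obtain ⟨t, rfl⟩ := (mem_cellVertices_iff hp.1).1 hv
    exact ⟨t, hp, rfl⟩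
  · rintro ⟨t, ht, rfl⟩
    exact ⟨ht, (mem_cellVertices_iff ht.1).2 ⟨t, rfl⟩⟩

theorem ncard_cells_of_mem_surfaceBoundary (hd : 2 ≤ d) {c : Colour} {i : Bool} {v : Vertex d}
    (hv : v ∈ surfaceBoundary d c i) : {p | IsCell d c p ∧ v ∈ cellVertices d c p}.ncard = 1 := by
  obtain ⟨k, hk⟩ := exists_not_isCell_iff hd hv
  rw [setOf_isCell_eq, Set.ncard_image_of_injective _ (cellAt_injective v.isVertex c),
    Set.ncard_eq_one]
  -- The cell on side `k` is missing, so the remaining one is opposite.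
  refine ⟨k + 1, Set.ext fun t => ?_⟩
  have h2 : ∀ t k : ZMod 2, ¬ t = k ↔ t = k + 1 := by decide
  rw [Set.mem_singleton_iff, ← h2, ← hk, not_not]
  rfl

theorem ncard_cells_of_notMem_surfaceBoundary {c : Colour} {v : Vertex d}
    (hv : ∀ i, v ∉ surfaceBoundary d c i) :
    {p | IsCell d c p ∧ v ∈ cellVertices d c p}.ncard = 2 := by
  have h : {t : ZMod 2 | IsCell d c (cellAt c v.1 t)} = Set.univ :=
    Set.eq_univ_of_forall fun t => isCell_cellAt hv t
  rw [setOf_isCell_eq, Set.ncard_image_of_injective _ (cellAt_injective v.isVertex c), h,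
    Set.ncard_univ, Nat.card_zmod]

theorem forall_notMem_cellQubits_iff {c : Colour} {q : Vertex d × Corner} :
    (∀ p, IsCell d c p → q ∉ cellQubits d c p) ↔ ¬ IsCell d c (cellAt c q.1.1 (q.2 c)) := by
  constructor
  · intro h hc
    exact h _ hc ((mem_cellQubits_iff hc.1).2 rfl)
  · rintro h p hp hq
    rw [mem_cellQubits_iff hp.1] at hq
    exact h (hq ▸ hp)

theorem mem_colourBoundary {c : Colour} {i : Bool} {q : Vertex d × Corner} :
    q ∈ colourBoundary d c i ↔
      q.1 ∈ surfaceBoundary d c i ∧ ¬ IsCell d c (cellAt c q.1.1 (q.2 c)) :=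
  and_congr_right fun _ => forall_notMem_cellQubits_iff

theorem exists_mem_colourBoundary_iff (hd : 2 ≤ d) {c : Colour} {i : Bool} {v : Vertex d}
    (hv : v ∈ surfaceBoundary d c i) :
    ∃ k, ∀ s, (v, s) ∈ colourBoundary d c i ↔ s ∈ cubeFace c k := by
  obtain ⟨k, hk⟩ := exists_not_isCell_iff hd hv
  refine ⟨k, fun s => ?_⟩
  rw [mem_colourBoundary, hk, and_iff_right hv]
  rfl

theorem forall_notMem_cellQubits_iff_mem_colourBoundary {c : Colour} {q : Vertex d × Corner} :
    (∀ p, IsCell d c p → q ∉ cellQubits d c p) ↔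
      (q ∈ colourBoundary d c false ∨ q ∈ colourBoundary d c true) := by
  rw [mem_colourBoundary, mem_colourBoundary, forall_notMem_cellQubits_iff, ← or_and_right]
  refine ⟨fun h => ⟨?_, h⟩, And.right⟩
  by_contra hv
  rw [not_or] at hv
  exact h (isCell_cellAt (Bool.forall_bool.2 hv) _)

theorem disjoint_colourBoundary (hd : 2 ≤ d) (c : Colour) :
    Disjoint (colourBoundary d c false) (colourBoundary d c true) := by
  rw [Set.disjoint_left]
  intro q h0 h1
  have e0 := mem_surfaceBoundary.1 h0.1
  have e1 := mem_surfaceBoundary.1 h1.1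
  simp only [Bool.false_eq_true, if_false, if_true] at e0 e1
  omega

theorem exists_colourBoundary_eq_liftX (hd : 2 ≤ d) (c : Colour) (i : Bool) :
    ∃ k, colourBoundary d c i = liftX c k (surfaceBoundary d c i) := by
  have h : ∀ v : Vertex d, ∃ k : ZMod 2, v ∈ surfaceBoundary d c i →
      ∀ s, (v, s) ∈ colourBoundary d c i ↔ s ∈ cubeFace c k := fun v => by
    by_cases hv : v ∈ surfaceBoundary d c i
    · obtain ⟨k, hk⟩ := exists_mem_colourBoundary_iff hd hv
      exact ⟨k, fun _ => hk⟩
    · exact ⟨0, fun h => absurd h hv⟩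
  choose k hk using h
  refine ⟨k, Set.ext fun q => ⟨fun hq => ⟨hq.1, (hk q.1 hq.1 q.2).1 hq⟩, fun hq => ?_⟩⟩
  exact (hk q.1 hq.1 q.2).2 hq.2

/-! Edges of the cantitruncated lattice. -/

theorem sameCell_none_iff {q q' : Vertex d × Corner} : SameCell q q' none ↔ q.1 = q'.1 := by
  constructor
  · rintro ⟨v, hv, h, h'⟩
    rw [mem_cubeQubits_iff hv] at h h'
    exact Subtype.ext (h.trans h'.symm)
  · intro h
    exact ⟨q.1.1, q.1.isVertex, (mem_cubeQubits_iff q.1.isVertex).2 rfl,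
      (mem_cubeQubits_iff q.1.isVertex).2 (by rw [h])⟩

theorem sameCell_some_iff {q q' : Vertex d × Corner} {c : Colour} :
    SameCell q q' (some c) ↔ cellAt c q.1.1 (q.2 c) = cellAt c q'.1.1 (q'.2 c) := by
  constructor
  · rintro ⟨p, hp, h, h'⟩
    rw [mem_cellQubits_iff hp] at h h'
    exact h.symm.trans h'
  · intro h
    have hc := isCentre_cellAt q.1.isVertex c (q.2 c)
    exact ⟨_, hc, (mem_cellQubits_iff hc).2 rfl, (mem_cellQubits_iff hc).2 h⟩

/-- The qubits joined to `q` in the same cube. -/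
def cubeNeighbours (q : Vertex d × Corner) : Set (Vertex d × Corner) :=
  Set.range fun c : Colour => (q.1, q.2 + Pi.single c 1)

/-- The qubits joined to `q` in another cube. -/
def outerNeighbours (q : Vertex d × Corner) : Set (Vertex d × Corner) :=
  {q' | q ≠ q' ∧ ∀ c, cellAt c q.1.1 (q.2 c) = cellAt c q'.1.1 (q'.2 c)}

/-- The colour that need not be shared decides. If it is a cell colour, the qubits are in one cube
and differ in that coordinate; if it is `none`, they share all three cells and lie in different
cubes. -/
theorem setOf_areJoined_eq (q : Vertex d × Corner) :
    {q' | AreJoined q q'} = cubeNeighbours q ∪ outerNeighbours q := by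
  ext q'
  constructor
  · rintro ⟨hne, c₀, h⟩
    cases c₀ with
    | none => exact Or.inr ⟨hne, fun c => sameCell_some_iff.1 (h _ (by simp))⟩
    | some c =>
      left
      have hv : q.1 = q'.1 := sameCell_none_iff.1 (h _ (by simp))
      have hs : ∀ c', c' ≠ c → q.2 c' = q'.2 c' := fun c' hc' => by
        have h1 := sameCell_some_iff.1 (h (some c') (by simpa using hc'))
        rw [← hv] at h1
        exact cellAt_injective q.1.isVertex c' h1
      have hc : q.2 c ≠ q'.2 c := fun h' => hne (Prod.ext hv (funext fun c' => by
        rcases eq_or_ne c' c with rfl | hc'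
        · exact h'
        · exact hs c' hc'))
      refine ⟨c, Prod.ext hv (funext fun c' => ?_)⟩
      rcases eq_or_ne c' c with rfl | hc'
      · have h2 : ∀ a b : ZMod 2, a ≠ b → a + 1 = b := by decide
        simpa using h2 _ _ hc
      · simpa [hc'] using hs c' hc'
  · rintro (⟨c, rfl⟩ | ⟨hne, h⟩)
    · refine ⟨fun h => ne_add_single c q.2 (congrArg Prod.snd h), some c, fun c' hc' => ?_⟩
      cases c' with
      | none => exact sameCell_none_iff.2 rfl
      | some c' =>
        have hc'' : c' ≠ c := fun h => hc' (by rw [h])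
        exact sameCell_some_iff.2 (by simp [hc''])
    · refine ⟨hne, none, fun c hc => ?_⟩
      cases c with
      | none => exact absurd rfl hc
      | some c => exact sameCell_some_iff.2 (h c)

theorem ncard_cubeNeighbours (q : Vertex d × Corner) : (cubeNeighbours q).ncard = 3 := by
  rw [cubeNeighbours, ← Set.image_univ, Set.ncard_image_of_injective, Set.ncard_univ,
    Nat.card_eq_fintype_card, card_colour]
  intro c c' h
  by_contra hne
  have := congrFun (add_left_cancel (congrArg Prod.snd h)) c
  simp [hne] at this

theorem disjoint_cubeNeighbours_outerNeighbours (q : Vertex d × Corner) :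
    Disjoint (cubeNeighbours q) (outerNeighbours q) := by
  rw [Set.disjoint_left]
  rintro _ ⟨c, rfl⟩ ⟨-, h⟩
  have := cellAt_injective q.1.isVertex c (h c)
  simp at this

/-- The equations describe the vertices common to the three cells around a corner. With `q = σ₀ w₀`
their differences give `(w₁, w₂) = q (m, n)`; since `m² + n² = 1`, the first equation becomes `q (q
- 1) = 0`. -/
theorem outer_offset_unique {σ₀ σ₁ σ₂ ε m n w₀ w₁ w₂ : ℤ} (h₀ : σ₀ = 1 ∨ σ₀ = -1)
    (h₁ : σ₁ = 1 ∨ σ₁ = -1) (h₂ : σ₂ = 1 ∨ σ₂ = -1) (hε : ε = 1 ∨ ε = -1)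
    (hm : 2 * m = σ₁ + σ₂) (hn : 2 * n = ε * (σ₁ - σ₂))
    (e₀ : (w₀ - σ₀) ^ 2 + w₁ ^ 2 + w₂ ^ 2 = 1)
    (e₁ : w₀ ^ 2 + (w₁ - σ₁) ^ 2 + (w₂ - σ₁ * ε) ^ 2 = 2)
    (e₂ : w₀ ^ 2 + (w₁ - σ₂) ^ 2 + (w₂ + σ₂ * ε) ^ 2 = 2) :
    (w₀ = 0 ∧ w₁ = 0 ∧ w₂ = 0) ∨ (w₀ = σ₀ ∧ w₁ = m ∧ w₂ = n) := by
  have k₁ : w₁ = m * (σ₀ * w₀) := by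
    have : 2 * w₁ = 2 * m * (σ₀ * w₀) := by
      rw [hm]
      rcases h₀ with rfl | rfl <;> rcases h₁ with rfl | rfl <;> rcases h₂ with rfl | rfl <;>
        rcases hε with rfl | rfl <;> linarith
    linarith
  have k₂ : w₂ = n * (σ₀ * w₀) := by
    have : 2 * w₂ = 2 * n * (σ₀ * w₀) := by
      rw [hn]
      rcases h₀ with rfl | rfl <;> rcases h₁ with rfl | rfl <;> rcases h₂ with rfl | rfl <;>
        rcases hε with rfl | rfl <;> linarith
    linarith
  have hmn : m ^ 2 + n ^ 2 = 1 := by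
    have h1 : ε ^ 2 = 1 := by rcases hε with rfl | rfl <;> rfl
    have h2 : σ₁ ^ 2 = 1 := by rcases h₁ with rfl | rfl <;> rfl
    have h3 : σ₂ ^ 2 = 1 := by rcases h₂ with rfl | rfl <;> rfl
    have : 4 * (m ^ 2 + n ^ 2) = 4 := by
      linear_combination (2 * m + σ₁ + σ₂) * hm + (2 * n + ε * (σ₁ - σ₂)) * hn +
        (σ₁ - σ₂) ^ 2 * h1 + 2 * h2 + 2 * h3
    linarith
  have hs : σ₀ ^ 2 = 1 := by rcases h₀ with rfl | rfl <;> rfl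
  have hw : (σ₀ * w₀) * (σ₀ * w₀ - 1) = 0 := by
    rw [k₁, k₂] at e₀
    have : 2 * ((σ₀ * w₀) * (σ₀ * w₀ - 1)) = 0 := by
      linear_combination e₀ - (σ₀ * w₀) ^ 2 * hmn + (w₀ ^ 2 - 1) * hs
    linarith
  rcases mul_eq_zero.1 hw with h | h
  · left
    rw [k₁, k₂, h, mul_zero, mul_zero]
    refine ⟨?_, rfl, rfl⟩
    linear_combination σ₀ * h - w₀ * hs
  · right
    have h' : σ₀ * w₀ = 1 := by linarith
    rw [k₁, k₂, h', mul_one, mul_one]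
    refine ⟨?_, rfl, rfl⟩
    linear_combination σ₀ * h' - w₀ * hs

/-- The other end of the edge which leaves the cube of `v` at the corner `s`. -/
theorem exists_outerVertex {v : Point} (hv : IsVertex v) (s : Corner) : ∃ w, w ≠ v ∧ IsVertex w ∧
    (∀ c, sqDist w (cellAt c v (s c)) = cellRadius c) ∧
    (∀ v', (∀ c, sqDist v' (cellAt c v (s c)) = cellRadius c) → v' = v ∨ v' = w) ∧
    ∀ d, InBox d v → (∀ c, 0 ≤ coord c (cellAt c v (s c)) ∧
      coord c (cellAt c v (s c)) ≤ 2 * d - 2) → InBox d w := by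
  obtain ⟨ε, hε, hcases⟩ := cellDirection_cases hv
  have hε' : ε = 1 ∨ ε = -1 := hε.imp And.left And.left
  obtain ⟨x, y, z⟩ := v
  simp only [cellAt, InBox]
  have hr' := faceSign_cases (s .r)
  have hg' := faceSign_cases (s .g)
  have hb' := faceSign_cases (s .b)
  have hall : ∀ P : Colour → Prop, (∀ c, P c) ↔ P .r ∧ P .g ∧ P .b := fun P =>
    ⟨fun h => ⟨h _, h _, h _⟩, fun ⟨h1, h2, h3⟩ c => by cases c <;> assumption⟩
  simp only [hall]
  generalize faceSign (s .r) = σ₁ at *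
  generalize faceSign (s .g) = σ₀ at *
  generalize faceSign (s .b) = σ₂ at *
  -- The step to the other vertex is the signed octahedron direction plus half the sum of the two
  -- signed cuboctahedron directions; `m` and `n` are the components of that half sum.
  obtain ⟨m, hm⟩ : ∃ m, 2 * m = σ₁ + σ₂ := ⟨(σ₁ + σ₂) / 2, by omega⟩
  obtain ⟨n, hn⟩ : ∃ n, 2 * n = ε * (σ₁ - σ₂) :=
    ⟨ε * (σ₁ - σ₂) / 2, by rcases hε' with rfl | rfl <;> omega⟩
  have hu := fun w₀ w₁ w₂ => outer_offset_unique (w₀ := w₀) (w₁ := w₁) (w₂ := w₂) hg' hr' hb' hε' hm hn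
  have hmn : (m = 0 ∧ (n = 1 ∨ n = -1) ∧ σ₂ = -σ₁ ∧ n = ε * σ₁) ∨
      (n = 0 ∧ (m = 1 ∨ m = -1) ∧ σ₂ = σ₁ ∧ m = σ₁) := by
    rcases hε' with rfl | rfl <;> omega
  have hεsq : ε * ε = 1 := by rcases hε' with rfl | rfl <;> rfl
  have hσ₀ : σ₀ * σ₀ = 1 := by rcases hg' with rfl | rfl <;> rfl
  have hσ₁ : σ₁ * σ₁ = 1 := by rcases hr' with rfl | rfl <;> rfl
  dsimp only at hcases
  rcases hcases with ⟨hx, hy, hz, hg, hr, hb⟩ | ⟨hx, hy, hz, hg, hr, hb⟩ |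
    ⟨hx, hy, hz, hg, hr, hb⟩ <;>
    simp only [hg, hr, hb, sqDist, coord, cellRadius, IsVertex, Int.even_iff, Int.odd_iff,
      Prod.smul_mk, Prod.mk_add_mk, smul_eq_mul]
  · refine ⟨(x + m, y + n, z + σ₀), ?_, ?_, ?_, ?_, ?_⟩
    · simp only [ne_eq, Prod.mk.injEq]; omega
    · dsimp only; omega
    · rcases hmn with ⟨rfl, -, rfl, rfl⟩ | ⟨rfl, -, rfl, rfl⟩ <;>
        refine ⟨?_, ?_, ?_⟩ <;> grind
    · rintro ⟨x', y', z'⟩ ⟨h1, h2, h3⟩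
      refine (hu (z' - z) (x' - x) (y' - y) (by linarith) (by linarith) (by linarith)).imp ?_ ?_ <;>
        rintro ⟨h4, h5, h6⟩ <;> simp only [Prod.mk.injEq] <;> omega
    -- Each nonzero component of the step is the displacement of one of the cells in the coordinate
    -- that decides its presence. In the next two cases, components along odd coordinates have room
    -- anyway.
    · intro d hbox hc
      dsimp only at hbox hc ⊢
      rcases hε' with rfl | rfl <;> omega
  · refine ⟨(x + σ₀, y + m, z + n), ?_, ?_, ?_, ?_, ?_⟩
    · simp only [ne_eq, Prod.mk.injEq]; omega
    · dsimp only; omega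
    · rcases hmn with ⟨rfl, -, rfl, rfl⟩ | ⟨rfl, -, rfl, rfl⟩ <;>
        refine ⟨?_, ?_, ?_⟩ <;> grind
    · rintro ⟨x', y', z'⟩ ⟨h1, h2, h3⟩
      refine (hu (x' - x) (y' - y) (z' - z) (by linarith) (by linarith) (by linarith)).imp ?_ ?_ <;>
        rintro ⟨h4, h5, h6⟩ <;> simp only [Prod.mk.injEq] <;> omega
    · intro d hbox hc
      dsimp only at hbox hc ⊢
      rcases hε' with rfl | rfl <;> omega
  · refine ⟨(x + m, y + σ₀, z + n), ?_, ?_, ?_, ?_, ?_⟩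
    · simp only [ne_eq, Prod.mk.injEq]; omega
    · dsimp only; omega
    · rcases hmn with ⟨rfl, -, rfl, rfl⟩ | ⟨rfl, -, rfl, rfl⟩ <;>
        refine ⟨?_, ?_, ?_⟩ <;> grind
    · rintro ⟨x', y', z'⟩ ⟨h1, h2, h3⟩
      refine (hu (y' - y) (x' - x) (z' - z) (by linarith) (by linarith) (by linarith)).imp ?_ ?_ <;>
        rintro ⟨h4, h5, h6⟩ <;> simp only [Prod.mk.injEq] <;> omega
    · intro d hbox hc
      dsimp only at hbox hc ⊢
      rcases hε' with rfl | rfl <;> omega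

/-- The three cells at a corner have only one common vertex besides its own, so the other cube is
determined; the cells then determine the corner in it. -/
theorem outerNeighbours_subsingleton (q : Vertex d × Corner) :
    (outerNeighbours q).Subsingleton := by
  obtain ⟨w, -, -, -, hw, -⟩ := exists_outerVertex q.1.isVertex q.2
  have key : ∀ q' ∈ outerNeighbours q, q'.1.1 = w := by
    rintro q' ⟨hne, h⟩
    refine (hw q'.1.1 fun c => ?_).resolve_left fun h1 => hne ?_
    · rw [h c, sqDist_cellAt q'.1.isVertex]
    · have hv : q.1 = q'.1 := Subtype.ext h1.symm
      refine Prod.ext hv (funext fun c => ?_)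
      have h2 := h c
      rw [← hv] at h2
      exact cellAt_injective q.1.isVertex c h2
  intro q' hq' q'' hq''
  have hv : q'.1 = q''.1 := Subtype.ext ((key q' hq').trans (key q'' hq'').symm)
  refine Prod.ext hv (funext fun c => ?_)
  have h2 := (hq'.2 c).symm.trans (hq''.2 c)
  rw [← hv] at h2
  exact cellAt_injective q'.1.isVertex c h2

theorem ncard_areJoined_eq (q : Vertex d × Corner) :
    {q' | AreJoined q q'}.ncard = 3 + (outerNeighbours q).ncard := by
  rw [setOf_areJoined_eq, Set.ncard_union_eq (disjoint_cubeNeighbours_outerNeighbours q),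
    ncard_cubeNeighbours]

theorem ncard_areJoined_le (q : Vertex d × Corner) : {q' | AreJoined q q'}.ncard ≤ 4 := by
  rw [ncard_areJoined_eq]
  have := Set.ncard_le_one_iff_subsingleton.2 (outerNeighbours_subsingleton q)
  omega

/-- Off all boundaries the three cells are present, which keeps their second common vertex in the
box and supplies the fourth neighbour. -/
theorem ncard_areJoined {q : Vertex d × Corner} (hq : ∀ c i, q ∉ colourBoundary d c i) :
    {q' | AreJoined q q'}.ncard = 4 := by
  have hcell : ∀ c, IsCell d c (cellAt c q.1.1 (q.2 c)) := fun c => by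
    by_contra h
    rw [← forall_notMem_cellQubits_iff, forall_notMem_cellQubits_iff_mem_colourBoundary] at h
    exact h.elim (hq c false) (hq c true)
  obtain ⟨w, hne, hw, hdist, -, hbox⟩ := exists_outerVertex q.1.isVertex q.2
  let v' : Vertex d := ⟨w, mem_latticeVertices.2
    ⟨hbox d q.1.inBox fun c => (isCell_cellAt_iff q.1 c _).1 (hcell c), hw⟩⟩
  have h1 : ∀ c, ∃ t, cellAt c q.1.1 (q.2 c) = cellAt c w t := fun c =>
    eq_cellAt_of_sqDist_eq_cellRadius hw (hcell c).1 (hdist c)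
  choose s hs using h1
  have hmem : (v', s) ∈ outerNeighbours q :=
    ⟨fun h => hne (congrArg (fun q : Vertex d × Corner => q.1.1) h).symm, hs⟩
  rw [ncard_areJoined_eq, (outerNeighbours_subsingleton q).eq_singleton_of_mem hmem,
    Set.ncard_singleton]

end

/-! ### Functions on cells and their coboundaries -/

section

variable {d : ℕ}

open scoped Classical in
/-- Extend a function on the vertices by zero to all points. -/
noncomputable def extendZero (f : Vertex d → ZMod 2) (p : Point) : ZMod 2 :=
  if h : p ∈ latticeVertices d then f ⟨p, h⟩ else 0

theorem extendZero_of_mem (f : Vertex d → ZMod 2) {p : Point} (h : p ∈ latticeVertices d) :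
    extendZero f p = f ⟨p, h⟩ := dif_pos h

theorem extendZero_of_not_inBox (f : Vertex d → ZMod 2) {p : Point} (h : ¬ InBox d p) :
    extendZero f p = 0 := dif_neg fun hp => h (mem_latticeVertices.1 hp).1

/-- Points outside the lattice count as zero, so a face cut down by the box can be summed as if it
were complete. -/
theorem bits_dotProduct_eq_sum_extendZero {S : Set (Vertex d)} {T : Finset Point}
    (h : ∀ v : Vertex d, v ∈ S ↔ v.1 ∈ T) (f : Vertex d → ZMod 2) :
    bits S ⬝ᵥ f = ∑ p ∈ T, extendZero f p := by
  classical
  rw [bits_dotProduct_eq (T.subtype (· ∈ latticeVertices d)) f fun v => by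
    rw [Finset.mem_subtype, h]]
  rw [← Finset.sum_filter_of_ne (p := (· ∈ latticeVertices d)) fun p _ hp => by
    by_contra h'
    exact hp (dif_neg h'), ← Finset.sum_subtype_eq_sum_filter]
  exact Finset.sum_congr rfl fun v _ => (extendZero_of_mem f v.2).symm

/-- The sum of a function on `c`-centres over the two `c`-cells at a vertex. -/
noncomputable def coboundary (d : ℕ) (c : Colour) (φ : Point → ZMod 2) (v : Vertex d) : ZMod 2 :=
  φ (cellAt c v.1 0) + φ (cellAt c v.1 1)

theorem cellAt_add_cellAt (c : Colour) (v : Point) : cellAt c v 0 + cellAt c v 1 = v + v := by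
  rw [cellAt, cellAt, faceSign_zero, faceSign_one, neg_smul, one_smul]
  abel

/-- Either cell at `v` may be named first, the other being its reflection in `v`; this avoids the
labels of `cellAt`. -/
theorem coboundary_eq {c : Colour} {φ : Point → ZMod 2} {v : Vertex d} {p p' : Point}
    (hp : IsCentre c p) (h : sqDist v.1 p = cellRadius c) (h' : p + p' = v.1 + v.1) :
    coboundary d c φ v = φ p + φ p' := by
  obtain ⟨t, rfl⟩ := eq_cellAt_of_sqDist_eq_cellRadius v.isVertex hp h
  rw [← cellAt_add_cellAt c] at h'
  rcases zmod_two_cases t with rfl | rfl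
  · rw [coboundary, add_left_cancel h']
  · rw [add_comm] at h'
    rw [coboundary, add_right_cancel h', add_comm]

theorem extendZero_coboundary {c : Colour} {φ : Point → ZMod 2} {v p p' : Point}
    (hbox : InBox d v) (hv : IsVertex v) (hp : IsCentre c p) (h : sqDist v p = cellRadius c)
    (h' : p + p' = v + v) : extendZero (coboundary d c φ) v = φ p + φ p' := by
  rw [extendZero_of_mem _ (mem_latticeVertices.2 ⟨hbox, hv⟩)]
  exact coboundary_eq hp h h'

/-- The function `φ` on `c`-centres is constant beyond each of the two `c`-boundaries. -/
def IsConstantBeyond (d : ℕ) (c : Colour) (α β : ZMod 2) (φ : Point → ZMod 2) : Prop :=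
  ∀ v p, InBox d v → IsVertex v → IsCentre c p → sqDist v p = cellRadius c →
    (coord c p < 0 → φ p = α) ∧ (2 * (d : ℤ) - 2 < coord c p → φ p = β)

theorem IsFace.symm {c₁ c₂ : Colour} {p₁ p₂ : Point} (h : IsFace d c₁ p₁ c₂ p₂) :
    IsFace d c₂ p₂ c₁ p₁ := by
  obtain ⟨⟨h1, h2, h3, h4⟩, h⟩ := h
  refine ⟨⟨h1.symm, h3, h2, ?_⟩, h.imp And.symm ?_⟩
  · simp only [or_comm (a := c₂ = .g), ← h4, sqDist]
    ring
  · simp only [add_comm, imp_self]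

theorem mem_orthSub_zSpace_iff {c : Colour} {f : Vertex d → ZMod 2} :
    f ∈ orthSub (surfaceCode d c).zSpace ↔ ∀ c₁ p₁ c₂ p₂, c₁ ≠ c → c₂ ≠ c → IsFace d c₁ p₁ c₂ p₂ →
      bits (cellVertices d c₁ p₁ ∩ cellVertices d c₂ p₂) ⬝ᵥ f = 0 := by
  rw [CSSCode.zSpace, mem_orthSub_span]
  constructor
  · exact fun h c₁ p₁ c₂ p₂ h₁ h₂ hf => h _ ⟨_, ⟨c₁, p₁, c₂, p₂, h₁, h₂, hf, rfl⟩, rfl⟩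
  · rintro h _ ⟨_, ⟨c₁, p₁, c₂, p₂, h₁, h₂, hf, rfl⟩, rfl⟩
    exact h c₁ p₁ c₂ p₂ h₁ h₂ hf

/-! ### The surface codes whose cells are cuboctahedra -/

/-- Coordinates adapted to a colour of cuboctahedra: the first one is constant on the boundaries of
that colour. -/
def pt (κ : Colour) (u w z : ℤ) : Point := if κ = .b then (w, u, z) else (u, w, z)

/-- The coordinate sum modulo four of the centres of the cuboctahedra of a colour. -/
def residue (κ : Colour) : ℤ := if κ = .b then 0 else 2

/-- The other colour of cuboctahedra. -/
def partner (κ : Colour) : Colour := if κ = .b then .r else .b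

theorem exists_pt (κ : Colour) (p : Point) : ∃ u w z, p = pt κ u w z := by
  by_cases h : κ = .b
  · exact ⟨p.2.1, p.1, p.2.2, by simp [pt, h]⟩
  · exact ⟨p.1, p.2.1, p.2.2, by simp [pt, h]⟩

theorem pt_inj {κ : Colour} {u w z u' w' z' : ℤ} :
    pt κ u w z = pt κ u' w' z' ↔ u = u' ∧ w = w' ∧ z = z' := by
  unfold pt
  split_ifs
  · simp only [Prod.mk.injEq]
    tauto
  · simp only [Prod.mk.injEq]

theorem pt_add_pt (κ : Colour) (u w z u' w' z' : ℤ) :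
    pt κ u w z + pt κ u' w' z' = pt κ (u + u') (w + w') (z + z') := by
  unfold pt
  split_ifs <;> rfl

theorem sqDist_pt (κ : Colour) (u w z u' w' z' : ℤ) :
    sqDist (pt κ u w z) (pt κ u' w' z') = (u - u') ^ 2 + (w - w') ^ 2 + (z - z') ^ 2 := by
  unfold pt
  split_ifs
  · simp only [sqDist]
    ring
  · simp only [sqDist]

theorem inBox_pt {κ : Colour} {u w z : ℤ} : InBox d (pt κ u w z) ↔
    (0 ≤ u ∧ u ≤ 2 * d - 2) ∧ (0 ≤ w ∧ w ≤ 2 * d - 2) ∧ (0 ≤ z ∧ z ≤ 2 * d - 2) := by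
  unfold pt
  split_ifs
  · simp only [InBox]
    tauto
  · simp only [InBox]

theorem isVertex_pt {κ : Colour} {u w z : ℤ} : IsVertex (pt κ u w z) ↔
    (u % 2 = 0 ∧ w % 2 = 0 ∧ z % 2 = 0) ∨ (u % 2 = 1 ∧ w % 2 = 0 ∧ z % 2 = 1) ∨
      (u % 2 = 0 ∧ w % 2 = 1 ∧ z % 2 = 1) := by
  unfold pt
  split_ifs
  · simp only [IsVertex, Int.even_iff, Int.odd_iff]
    tauto
  · simp only [IsVertex, Int.even_iff, Int.odd_iff]

theorem isCentre_g_pt {κ : Colour} {u w z : ℤ} : IsCentre .g (pt κ u w z) ↔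
    u % 2 = 0 ∧ w % 2 = 0 ∧ z % 2 = 1 := by
  unfold pt
  split_ifs
  · simp only [IsCentre, Int.even_iff, Int.odd_iff]
    tauto
  · simp only [IsCentre, Int.even_iff, Int.odd_iff]

theorem isCentre_pt {κ : Colour} (hκ : κ ≠ .g) {u w z : ℤ} : IsCentre κ (pt κ u w z) ↔
    u % 2 = 1 ∧ w % 2 = 1 ∧ z % 2 = 0 ∧ (u + w + z) % 4 = residue κ := by
  cases κ
  · simp [pt, residue, IsCentre, Int.even_iff, Int.odd_iff]
  · exact absurd rfl hκ
  · simp only [pt, residue, IsCentre, Int.even_iff, Int.odd_iff, if_true]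
    omega

theorem isCentre_partner_pt {κ : Colour} (hκ : κ ≠ .g) {u w z : ℤ} :
    IsCentre (partner κ) (pt κ u w z) ↔
      u % 2 = 1 ∧ w % 2 = 1 ∧ z % 2 = 0 ∧ (u + w + z - residue κ) % 4 = 2 := by
  cases κ
  · simp only [pt, residue, partner, reduceCtorEq, if_false, IsCentre, Int.even_iff, Int.odd_iff]
    omega
  · exact absurd rfl hκ
  · simp only [pt, residue, partner, IsCentre, Int.even_iff, Int.odd_iff, if_true]
    omega

theorem isCell_g_pt {κ : Colour} {u w z : ℤ} : IsCell d .g (pt κ u w z) ↔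
    IsCentre .g (pt κ u w z) ∧ InBox d (pt κ u w z) := Iff.rfl

theorem isCell_partner_pt {κ : Colour} (hκ : κ ≠ .g) {u w z : ℤ} :
    IsCell d (partner κ) (pt κ u w z) ↔ IsCentre (partner κ) (pt κ u w z) ∧
      (-1 ≤ u ∧ u ≤ 2 * d - 1) ∧ (0 ≤ w ∧ w ≤ 2 * d - 2) ∧ (0 ≤ z ∧ z ≤ 2 * d - 2) := by
  cases κ
  · rfl
  · exact absurd rfl hκ
  · simp only [pt, partner, IsCell, if_true]
    tauto

theorem coord_pt {κ : Colour} (hκ : κ ≠ .g) (u w z : ℤ) : coord κ (pt κ u w z) = u := by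
  cases κ
  · rfl
  · exact absurd rfl hκ
  · rfl

theorem cellRadius_of_ne {κ : Colour} (hκ : κ ≠ .g) : cellRadius κ = 2 := by
  cases κ
  · rfl
  · exact absurd rfl hκ
  · rfl

theorem partner_ne {κ : Colour} : partner κ ≠ .g ∧ partner κ ≠ κ := by
  cases κ <;> decide

theorem eq_partner {κ c : Colour} (hκ : κ ≠ .g) (h : c ≠ κ) (h' : c ≠ .g) : c = partner κ := by
  revert hκ h h'
  cases κ <;> cases c <;> decide

/-- The triangle on the octahedron with centre `(u, w, z)` in direction `(a, b, c)`, which faces a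
cuboctahedron of the other colour, is a face of the lattice of distance `d`. -/
def IsTriangle (d : ℕ) (κ : Colour) (u w z a b c : ℤ) : Prop :=
  (u % 2 = 0 ∧ w % 2 = 0 ∧ z % 2 = 1) ∧ ((a = 1 ∨ a = -1) ∧ (b = 1 ∨ b = -1) ∧ (c = 1 ∨ c = -1)) ∧
    (u + w + z + a + b + c - residue κ) % 4 = 2 ∧ (0 ≤ u ∧ u ≤ 2 * d - 2) ∧
    (0 ≤ w ∧ w ≤ 2 * d - 2) ∧ (0 ≤ w + b ∧ w + b ≤ 2 * d - 2) ∧ (0 ≤ z ∧ z ≤ 2 * d - 2)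

theorem eq_one_or_of_sq_add {a b c : ℤ} (h : a ^ 2 + b ^ 2 + c ^ 2 = 3) (ha : a % 2 = 1)
    (hb : b % 2 = 1) (hc : c % 2 = 1) : (a = 1 ∨ a = -1) ∧ (b = 1 ∨ b = -1) ∧ (c = 1 ∨ c = -1) := by
  have bound : ∀ x : ℤ, x ^ 2 ≤ 3 → x % 2 = 1 → x = 1 ∨ x = -1 := fun x hx h => by
    have h1 : x ≤ 1 := by nlinarith
    have h2 : -1 ≤ x := by nlinarith
    omega
  have := sq_nonneg a
  have := sq_nonneg b
  have := sq_nonneg c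
  exact ⟨bound a (by linarith) ha, bound b (by linarith) hb, bound c (by linarith) hc⟩

/-- The offsets are odd, so a midpoint in the box already forces both cells to be present. No bound
on `u + a` is needed, because cells of the partner colour one unit outside in that direction belong
to the lattice. -/
theorem isFace_iff_exists_isTriangle {κ : Colour} (hκ : κ ≠ .g) {p₁ p₂ : Point} :
    IsFace d .g p₁ (partner κ) p₂ ↔ ∃ u w z a b c, IsTriangle d κ u w z a b c ∧
      p₁ = pt κ u w z ∧ p₂ = pt κ (u + a) (w + b) (z + c) := by
  constructor
  · rintro ⟨⟨-, h₁, h₂, h₃⟩, h⟩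
    obtain ⟨u, w, z, rfl⟩ := exists_pt κ p₁
    obtain ⟨u', w', z', rfl⟩ := exists_pt κ p₂
    rw [isCell_g_pt, inBox_pt, isCell_partner_pt hκ] at h
    rw [isCentre_g_pt] at h₁ h
    rw [isCentre_partner_pt hκ] at h₂ h
    rw [if_pos (Or.inl rfl), sqDist_pt] at h₃
    have h₄ := eq_one_or_of_sq_add h₃ (by omega) (by omega) (by omega)
    refine ⟨u, w, z, u' - u, w' - w, z' - z, ?_, rfl, by simp only [add_sub_cancel]⟩
    refine ⟨h₁, by omega, by omega, ?_⟩
    clear h₃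
    rcases h with h | h
    · omega
    · unfold pt at h
      split_ifs at h <;> dsimp only at h <;> omega
  · rintro ⟨u, w, z, a, b, c, ⟨h₁, h₂, h₃⟩, rfl, rfl⟩
    have hg : IsCentre .g (pt κ u w z) := isCentre_g_pt.2 h₁
    have hp : IsCentre (partner κ) (pt κ (u + a) (w + b) (z + c)) :=
      (isCentre_partner_pt hκ).2 (by omega)
    refine ⟨⟨partner_ne.1.symm, hg, hp, ?_⟩, Or.inl ⟨⟨hg, inBox_pt.2 (by omega)⟩,
      (isCell_partner_pt hκ).2 ⟨hp, by omega⟩⟩⟩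
    rw [if_pos (Or.inl rfl), sqDist_pt]
    obtain ⟨rfl | rfl, rfl | rfl, rfl | rfl⟩ := h₂ <;> ring

theorem triangle_vertices {x y t a b c : ℤ} (ha : a = 1 ∨ a = -1) (hb : b = 1 ∨ b = -1)
    (hc : c = 1 ∨ c = -1) : (x ^ 2 + y ^ 2 + t ^ 2 = 1 ∧
      (x - a) ^ 2 + (y - b) ^ 2 + (t - c) ^ 2 = 2) ↔
    (x = a ∧ y = 0 ∧ t = 0) ∨ (x = 0 ∧ y = b ∧ t = 0) ∨ (x = 0 ∧ y = 0 ∧ t = c) := by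
  constructor
  · rintro ⟨h1, h2⟩
    have bound : ∀ x : ℤ, x ^ 2 ≤ 1 → x = -1 ∨ x = 0 ∨ x = 1 := fun x hx => by
      have h1 : x ≤ 1 := by nlinarith
      have h2 : -1 ≤ x := by nlinarith
      omega
    have hx := bound x (by nlinarith)
    have hy := bound y (by nlinarith)
    have ht := bound t (by nlinarith)
    rcases hx with rfl | rfl | rfl <;> rcases hy with rfl | rfl | rfl <;>
      rcases ht with rfl | rfl | rfl <;> first
        | (exfalso; revert h1; decide)
        | (rcases ha with rfl | rfl <;> rcases hb with rfl | rfl <;> rcases hc with rfl | rfl <;>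
            revert h2 <;> decide)
  · rcases ha with rfl | rfl <;> rcases hb with rfl | rfl <;> rcases hc with rfl | rfl <;>
      rintro (⟨rfl, rfl, rfl⟩ | ⟨rfl, rfl, rfl⟩ | ⟨rfl, rfl, rfl⟩) <;> decide

theorem bits_triangle_dotProduct {κ : Colour} {u w z a b c : ℤ}
    (h : IsTriangle d κ u w z a b c) (f : Vertex d → ZMod 2) :
    bits (cellVertices d .g (pt κ u w z) ∩
        cellVertices d (partner κ) (pt κ (u + a) (w + b) (z + c))) ⬝ᵥ f =
      extendZero f (pt κ (u + a) w z) + extendZero f (pt κ u (w + b) z) +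
        extendZero f (pt κ u w (z + c)) := by
  obtain ⟨-, ⟨ha, hb, hc⟩, -⟩ := h
  rw [bits_dotProduct_eq_sum_extendZero
    (T := {pt κ (u + a) w z, pt κ u (w + b) z, pt κ u w (z + c)})]
  · rw [Finset.sum_insert, Finset.sum_insert, Finset.sum_singleton, add_assoc]
    · rw [Finset.mem_singleton, pt_inj]
      omega
    · rw [Finset.mem_insert, Finset.mem_singleton, pt_inj, pt_inj]
      omega
  · intro v
    obtain ⟨x, y, t, hv⟩ := exists_pt κ v.1
    have hg : cellRadius .g = 1 := rfl
    have := triangle_vertices (x := x - u) (y := y - w) (t := t - z) ha hb hc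
    simp only [cellVertices, Set.mem_inter_iff, Set.mem_ofPred_eq, hv, sqDist_pt, Finset.mem_insert,
      Finset.mem_singleton, pt_inj, cellRadius_of_ne partner_ne.1, hg, ← sub_sub]
    rw [this]
    omega

theorem mem_orthSub_iff_isTriangle {κ : Colour} (hκ : κ ≠ .g) {f : Vertex d → ZMod 2} :
    f ∈ orthSub (surfaceCode d κ).zSpace ↔ ∀ u w z a b c, IsTriangle d κ u w z a b c →
      extendZero f (pt κ (u + a) w z) + extendZero f (pt κ u (w + b) z) +
        extendZero f (pt κ u w (z + c)) = 0 := by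
  rw [mem_orthSub_zSpace_iff]
  constructor
  · intro h u w z a b c ht
    rw [← bits_triangle_dotProduct ht]
    exact h _ _ _ _ hκ.symm partner_ne.2
      ((isFace_iff_exists_isTriangle hκ).2 ⟨u, w, z, a, b, c, ht, rfl, rfl⟩)
  · intro h
    have key : ∀ p₁ p₂, IsFace d .g p₁ (partner κ) p₂ →
        bits (cellVertices d .g p₁ ∩ cellVertices d (partner κ) p₂) ⬝ᵥ f = 0 := by
      intro p₁ p₂ hf
      obtain ⟨u, w, z, a, b, c, ht, rfl, rfl⟩ := (isFace_iff_exists_isTriangle hκ).1 hf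
      rw [bits_triangle_dotProduct ht]
      exact h u w z a b c ht
    intro c₁ p₁ c₂ p₂ h₁ h₂ hf
    by_cases hg : c₁ = .g
    · subst hg
      obtain rfl := eq_partner hκ h₂ hf.1.1.symm
      exact key _ _ hf
    · obtain rfl := eq_partner hκ h₁ hg
      obtain rfl : c₂ = .g := by
        by_contra hg'
        exact hf.1.1 (eq_partner hκ h₂ hg').symm
      rw [Set.inter_comm]
      exact key _ _ hf.symm

/-- Functions on the cuboctahedra of one colour which are constant beyond the boundaries have
coboundaries that commute with the triangles. -/
theorem coboundary_mem_orthSub_of_ne {κ : Colour} (hκ : κ ≠ .g) {α β : ZMod 2}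
    {φ : Point → ZMod 2} (hφ : IsConstantBeyond d κ α β φ) :
    coboundary d κ φ ∈ orthSub (surfaceCode d κ).zSpace := by
  rw [mem_orthSub_iff_isTriangle hκ]
  rintro u w z a b c ⟨h₁, ⟨ha, hb, hc⟩, h₃, h₄⟩
  have ha' : a ^ 2 = 1 := by rcases ha with rfl | rfl <;> rfl
  have hb' : b ^ 2 = 1 := by rcases hb with rfl | rfl <;> rfl
  have hc' : c ^ 2 = 1 := by rcases hc with rfl | rfl <;> rfl
  have hτ : residue κ = 0 ∨ residue κ = 2 := by cases κ <;> simp [residue]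
  have b₂ : InBox d (pt κ u (w + b) z) := inBox_pt.2 (by omega)
  have b₃ : InBox d (pt κ u w (z + c)) := inBox_pt.2 (by omega)
  have v₁ : IsVertex (pt κ (u + a) w z) := isVertex_pt.2 (by omega)
  have v₂ : IsVertex (pt κ u (w + b) z) := isVertex_pt.2 (by omega)
  have v₃ : IsVertex (pt κ u w (z + c)) := isVertex_pt.2 (by omega)
  -- Three cuboctahedra of colour `κ` surround the triangle, at the offsets `(-a, b, c)`, `(a, -b,
  -- c)` and `(a, b, -c)`. Each vertex of the triangle lies between two of them, so each value is
  -- counted twice.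
  have q₂ : IsCentre κ (pt κ (u + a) (w - b) (z + c)) := (isCentre_pt hκ).2 (by omega)
  have q₃ : IsCentre κ (pt κ (u + a) (w + b) (z - c)) := (isCentre_pt hκ).2 (by omega)
  have d₂ : sqDist (pt κ u (w + b) z) (pt κ (u + a) (w + b) (z - c)) = cellRadius κ := by
    rw [sqDist_pt, cellRadius_of_ne hκ]
    linear_combination ha' + hc'
  have d₃ : sqDist (pt κ u w (z + c)) (pt κ (u + a) (w - b) (z + c)) = cellRadius κ := by
    rw [sqDist_pt, cellRadius_of_ne hκ]
    linear_combination ha' + hb'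
  rw [extendZero_coboundary b₂ v₂ q₃ d₂ (p' := pt κ (u - a) (w + b) (z + c))
      (by rw [pt_add_pt, pt_add_pt, pt_inj]; refine ⟨?_, ?_, ?_⟩ <;> ring),
    extendZero_coboundary b₃ v₃ q₂ d₃ (p' := pt κ (u - a) (w + b) (z + c))
      (by rw [pt_add_pt, pt_add_pt, pt_inj]; refine ⟨?_, ?_, ?_⟩ <;> ring)]
  -- Only this vertex can be cut off. Its two cuboctahedra then lie beyond the same boundary, where
  -- `φ` is constant, so both sides are zero.
  have key : extendZero (coboundary d κ φ) (pt κ (u + a) w z) =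
      φ (pt κ (u + a) (w + b) (z - c)) + φ (pt κ (u + a) (w - b) (z + c)) := by
    by_cases b₁ : InBox d (pt κ (u + a) w z)
    · refine extendZero_coboundary b₁ v₁ q₃ ?_ ?_
      · rw [sqDist_pt, cellRadius_of_ne hκ]
        linear_combination hb' + hc'
      · rw [pt_add_pt, pt_add_pt, pt_inj]
        refine ⟨?_, ?_, ?_⟩ <;> ring
    · rw [extendZero_of_not_inBox _ b₁]
      rw [inBox_pt] at b₁
      have e₂ := hφ _ _ b₂ v₂ q₃ d₂
      have e₃ := hφ _ _ b₃ v₃ q₂ d₃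
      rw [coord_pt hκ] at e₂ e₃
      rcases lt_or_ge (u + a) 0 with h | h
      · rw [e₂.1 h, e₃.1 h, zmod_two_add_self]
      · rw [e₂.2 (by omega), e₃.2 (by omega), zmod_two_add_self]
  rw [key]
  generalize φ _ = x, φ (pt κ (u + a) (w - b) (z + c)) = y, φ (pt κ (u - a) (w + b) (z + c)) = t
  revert x y t
  decide

end

/-! ### Integration along zigzag columns of cuboctahedra -/

section

variable {d : ℕ}

/-- The sum over the first `k` even sites of a column. -/
def columnSum (H : ℤ → ℤ → ℤ → ZMod 2) (k : ℕ) (w z : ℤ) : ZMod 2 :=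
  ∑ j ∈ Finset.range k, H (2 * j) w z

theorem columnSum_succ (H : ℤ → ℤ → ℤ → ZMod 2) (k : ℕ) (w z : ℤ) :
    columnSum H (k + 1) w z = columnSum H k w z + H (2 * k) w z := Finset.sum_range_succ _ _

/-- A function on the sites of the lattice which commutes with all triangles. -/
structure IsTriangleFree (d : ℕ) (κ : Colour) (H : ℤ → ℤ → ℤ → ZMod 2) : Prop where
  zero_of_lt : ∀ u w z, u < 0 → H u w z = 0
  zero_of_gt : ∀ u w z, 2 * (d : ℤ) - 2 < u → H u w z = 0
  triangle : ∀ u w z a b c, IsTriangle d κ u w z a b c →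
    H (u + a) w z + H u (w + b) z + H u w (z + c) = 0

namespace IsTriangleFree

variable {κ : Colour} {H : ℤ → ℤ → ℤ → ZMod 2}

/-- Neighbouring columns have the same sums, up to the value at a site between them. -/
theorem columnSum_add (hH : IsTriangleFree d κ H) {w z b c : ℤ} (hw : w % 2 = 0) (hz : z % 2 = 1)
    (hb : b = 1 ∨ b = -1) (hc : c = 1 ∨ c = -1) (hw' : 0 ≤ w ∧ w ≤ 2 * d - 2)
    (hwb : 0 ≤ w + b ∧ w + b ≤ 2 * d - 2) (hz' : 0 ≤ z ∧ z ≤ 2 * d - 2) :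
    ∀ k ≤ d, columnSum H k (w + b) z + columnSum H k w (z + c) =
      if (2 * (k : ℤ) - 1 + w + z + b + c - residue κ) % 4 = 2 then H (2 * k - 1) w z else 0 := by
  intro k
  have hτ : residue κ = 0 ∨ residue κ = 2 := by cases κ <;> simp [residue]
  induction k with
  | zero =>
    intro _
    -- The remainder at `2 * 0 - 1 = -1` lies outside the lattice.
    simp [columnSum, hH.zero_of_lt]
  | succ k ih =>
    intro hk
    have h := ih (by omega)
    rw [columnSum_succ, columnSum_succ, add_add_add_comm, h]
    push_cast
    -- The two zigzag paths of cuboctahedra alternately end together and apart, separated by the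
    -- site `(2k - 1, w, z)`. The triangle at `(2k, w, z)` has `a = 1` when a new remainder appears
    -- and `a = -1` when the old one is absorbed.
    by_cases hp : (2 * ((k : ℤ) + 1) - 1 + w + z + b + c - residue κ) % 4 = 2
    · rw [if_neg (by omega), if_pos hp, zero_add]
      have := hH.triangle (2 * k) w z 1 b c
        ⟨by omega, by omega, by omega, by omega, hw', hwb, hz'⟩
      rw [show 2 * ((k : ℤ) + 1) - 1 = 2 * k + 1 by ring]
      generalize H (2 * k + 1) w z = x at this ⊢
      generalize H (2 * k) (w + b) z = y, H (2 * k) w (z + c) = t at this ⊢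
      revert x y t
      decide
    · rw [if_pos (by omega), if_neg hp]
      have := hH.triangle (2 * k) w z (-1) b c
        ⟨by omega, by omega, by omega, by omega, hw', hwb, hz'⟩
      rwa [← sub_eq_add_neg, add_assoc] at this

/-- The condition makes `(2k - 1, w + b, z + c)` a centre of colour `κ`: both paths end there, and
no remainder is left. -/
theorem columnSum_eq_of_residue (hH : IsTriangleFree d κ H) {w z b c : ℤ} (hw : w % 2 = 0)
    (hz : z % 2 = 1) (hb : b = 1 ∨ b = -1) (hc : c = 1 ∨ c = -1) (hw' : 0 ≤ w ∧ w ≤ 2 * d - 2)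
    (hwb : 0 ≤ w + b ∧ w + b ≤ 2 * d - 2) (hz' : 0 ≤ z ∧ z ≤ 2 * d - 2) {k : ℕ} (hk : k ≤ d)
    (h : (2 * (k : ℤ) - 1 + w + z + b + c) % 4 = residue κ) :
    columnSum H k (w + b) z = columnSum H k w (z + c) := by
  have hτ : residue κ = 0 ∨ residue κ = 2 := by cases κ <;> simp [residue]
  have := hH.columnSum_add hw hz hb hc hw' hwb hz' k hk
  rw [if_neg (by omega)] at this
  generalize columnSum H k (w + b) z = x, columnSum H k w (z + c) = y at this ⊢
  revert x y
  decide

/-- The last possible remainder is at `2d - 1`, outside the lattice. -/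
theorem columnSum_top_eq (hH : IsTriangleFree d κ H) {w z b c : ℤ} (hw : w % 2 = 0)
    (hz : z % 2 = 1) (hb : b = 1 ∨ b = -1) (hc : c = 1 ∨ c = -1) (hw' : 0 ≤ w ∧ w ≤ 2 * d - 2)
    (hwb : 0 ≤ w + b ∧ w + b ≤ 2 * d - 2) (hz' : 0 ≤ z ∧ z ≤ 2 * d - 2) :
    columnSum H d (w + b) z = columnSum H d w (z + c) := by
  have := hH.columnSum_add hw hz hb hc hw' hwb hz' d le_rfl
  rw [hH.zero_of_gt _ _ _ (by omega), ite_self] at this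
  generalize columnSum H d (w + b) z = x, columnSum H d w (z + c) = y at this ⊢
  revert x y
  decide

/-- All full columns have the same sum. -/
theorem columnSum_top_eq_zero_zero (hH : IsTriangleFree d κ H) (hd : 2 ≤ d) {w z : ℤ}
    (hw : w % 2 = 0) (hz : z % 2 = 0) (hw' : 0 ≤ w ∧ w ≤ 2 * d - 2)
    (hz' : 0 ≤ z ∧ z ≤ 2 * d - 2) : columnSum H d w z = columnSum H d 0 0 := by
  obtain ⟨m, rfl⟩ : ∃ m : ℕ, w = 2 * m := ⟨(w / 2).toNat, by omega⟩
  obtain ⟨n, rfl⟩ : ∃ n : ℕ, z = 2 * n := ⟨(z / 2).toNat, by omega⟩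
  have hz₀ : ∀ n : ℕ, 2 * (n : ℤ) ≤ 2 * d - 2 → columnSum H d (2 * m) (2 * n) =
      columnSum H d (2 * m) 0 := by
    intro n
    induction n with
    | zero => intro _; simp
    | succ n ih =>
      intro hn
      rw [← ih (by omega)]
      push_cast at hn ⊢
      -- An odd column next to `2m`, at `2n + 1`, is adjacent to the even columns at both `2n` and
      -- `2n + 2`; `b` keeps it in the box.
      have hb : ∃ b : ℤ, (b = 1 ∨ b = -1) ∧ 0 ≤ 2 * (m : ℤ) + b ∧ 2 * (m : ℤ) + b ≤ 2 * d - 2 := by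
        by_cases h : m = 0
        · exact ⟨1, by omega⟩
        · exact ⟨-1, by omega⟩
      obtain ⟨b, hb, hb'⟩ := hb
      have h₁ := hH.columnSum_top_eq (w := 2 * m) (z := 2 * n + 1) (b := b) (c := 1) (by omega)
        (by omega) hb (Or.inl rfl) hw' hb' (by omega)
      have h₂ := hH.columnSum_top_eq (w := 2 * m) (z := 2 * n + 1) (b := b) (c := -1) (by omega)
        (by omega) hb (Or.inr rfl) hw' hb' (by omega)
      rw [show 2 * ((n : ℤ) + 1) = 2 * n + 1 + 1 by ring, ← h₁, h₂, add_neg_cancel_right]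
  have hw₀ : ∀ m : ℕ, 2 * (m : ℤ) ≤ 2 * d - 2 → columnSum H d (2 * m) 0 = columnSum H d 0 0 := by
    intro m
    induction m with
    | zero => intro _; simp
    | succ m ih =>
      intro hm
      rw [← ih (by omega)]
      push_cast at hm ⊢
      -- The odd column `(2m + 1, 1)` is adjacent to both even columns `(2m, 0)` and `(2m + 2, 0)`.
      have h₁ := hH.columnSum_top_eq (w := 2 * m) (z := 1) (b := 1) (c := -1) (by omega)
        (by omega) (Or.inl rfl) (Or.inr rfl) (by omega) (by omega) (by omega)
      have h₂ := hH.columnSum_top_eq (w := 2 * (m + 1)) (z := 1) (b := -1) (c := -1) (by omega)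
        (by omega) (Or.inr rfl) (Or.inr rfl) (by omega) (by omega) (by omega)
      rw [add_neg_cancel] at h₁ h₂
      rw [← h₁, ← h₂]
      congr 1
      ring
  rw [hz₀ n hz'.2, hw₀ m hw'.2]

/-- The function on cuboctahedra whose coboundary is `H`. -/
def potential (d : ℕ) (H : ℤ → ℤ → ℤ → ZMod 2) (u w z : ℤ) : ZMod 2 :=
  -- A cuboctahedron has an even column on each side; the one at `w + 1` is used, except beyond the
  -- far side, where only `w - 1` is in the lattice.
  columnSum H ((u + 1) / 2).toNat (if w ≤ 2 * d - 2 then w + 1 else w - 1) z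

theorem potential_of_nonpos {u : ℤ} (hu : u ≤ 0) (w z : ℤ) : potential d H u w z = 0 := by
  rw [potential, show ((u + 1) / 2).toNat = 0 by omega]
  rfl

/-- Independence of the path: the two even columns beside a cuboctahedron both agree with an odd
column between them that ends at the same cuboctahedron. -/
theorem potential_eq_horizontal (hH : IsTriangleFree d κ H) (hd : 2 ≤ d) {k : ℕ} (hk : k ≤ d)
    {w z s : ℤ} (hs : s = 1 ∨ s = -1) (hw : w % 2 = 0) (hz : z % 2 = 0)
    (hw' : 0 ≤ w ∧ w ≤ 2 * d - 2) (hz' : 0 ≤ z ∧ z ≤ 2 * d - 2)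
    (h : (2 * (k : ℤ) - 1 + (w + s) + z) % 4 = residue κ) :
    potential d H (2 * k - 1) (w + s) z = columnSum H k w z := by
  rw [potential, show ((2 * (k : ℤ) - 1 + 1) / 2).toNat = k by omega]
  -- In these cases the potential is computed with the column at `w` itself.
  by_cases hws : w + s + 1 = w ∨ 2 * (d : ℤ) - 2 < w + s
  · congr 1
    split_ifs <;> omega
  · rw [if_pos (by omega)]
    obtain rfl : s = 1 := by omega
    have hc : ∃ c : ℤ, (c = 1 ∨ c = -1) ∧ 0 ≤ z - c ∧ z - c ≤ 2 * d - 2 := by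
      by_cases h : z = 0
      · exact ⟨-1, by omega⟩
      · exact ⟨1, by omega⟩
    obtain ⟨c, hc, hc'⟩ := hc
    have h₁ := hH.columnSum_eq_of_residue (w := w) (z := z - c) (b := 1) (c := c) hw (by omega)
      (Or.inl rfl) hc hw' (by omega) hc' hk (by omega)
    have h₂ := hH.columnSum_eq_of_residue (w := w + 2) (z := z - c) (b := -1) (c := c) (by omega)
      (by omega) (Or.inr rfl) hc (by omega) (by omega) hc' hk (by omega)
    rw [sub_add_cancel] at h₁ h₂
    rw [← h₁, show w + 1 + 1 = w + 2 by ring, ← h₂]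
    congr 1
    ring

/-- The odd column ends at the same cuboctahedron as the even column at `(w + 1, z + s)`, which the
potential uses. -/
theorem potential_eq_vertical (hH : IsTriangleFree d κ H) (hd : 2 ≤ d) {k : ℕ} (hk : k ≤ d)
    {w z s : ℤ} (hs : s = 1 ∨ s = -1) (hw : w % 2 = 1) (hz : z % 2 = 1)
    (hw' : 0 ≤ w ∧ w ≤ 2 * d - 2) (hz' : 0 ≤ z ∧ z ≤ 2 * d - 2)
    (h : (2 * (k : ℤ) - 1 + w + (z + s)) % 4 = residue κ) :
    potential d H (2 * k - 1) w (z + s) = columnSum H k w z := by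
  have h₁ := hH.columnSum_eq_of_residue (w := w + 1) (z := z) (b := -1) (c := s) (by omega) hz
    (Or.inr rfl) hs (by omega) (by omega) hz' hk (by omega)
  have h₂ := hH.potential_eq_horizontal hd hk (w := w + 1) (z := z + s) (s := -1) (Or.inr rfl)
    (by omega) (by omega) (by omega) (by omega) (by omega)
  rw [add_neg_cancel_right] at h₁ h₂
  rw [h₂, ← h₁]

theorem potential_top (hH : IsTriangleFree d κ H) (hd : 2 ≤ d) {w z : ℤ} (hw : w % 2 = 1)
    (hz : z % 2 = 0) (hw' : -1 ≤ w ∧ w ≤ 2 * d - 1) (hz' : 0 ≤ z ∧ z ≤ 2 * d - 2) :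
    potential d H (2 * d - 1) w z = columnSum H d 0 0 := by
  rw [potential, show ((2 * (d : ℤ) - 1 + 1) / 2).toNat = d by omega]
  split_ifs <;> exact hH.columnSum_top_eq_zero_zero hd (by omega) hz (by omega) hz'

end IsTriangleFree

/-- Every function commuting with the triangles is the coboundary of a function on cuboctahedra. -/
theorem exists_coboundary_eq_of_ne (hd : 2 ≤ d) {κ : Colour} (hκ : κ ≠ .g) {f : Vertex d → ZMod 2}
    (hf : f ∈ orthSub (surfaceCode d κ).zSpace) :
    ∃ β φ, IsConstantBeyond d κ 0 β φ ∧ f = coboundary d κ φ := by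
  have hτ : residue κ = 0 ∨ residue κ = 2 := by cases κ <;> simp [residue]
  set H : ℤ → ℤ → ℤ → ZMod 2 := fun u w z => extendZero f (pt κ u w z) with hHdef
  have hH : IsTriangleFree d κ H := by
    refine ⟨fun u w z h => ?_, fun u w z h => ?_, (mem_orthSub_iff_isTriangle hκ).1 hf⟩ <;>
    · refine extendZero_of_not_inBox _ ?_
      rw [inBox_pt]
      omega
  set ψ := IsTriangleFree.potential d H with hψ
  have hpt : ∃ φ : Point → ZMod 2, ∀ u w z, φ (pt κ u w z) = ψ u w z := by
    by_cases h : κ = .b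
    · exact ⟨fun p => ψ p.2.1 p.1 p.2.2, fun u w z => by simp [pt, h]⟩
    · exact ⟨fun p => ψ p.1 p.2.1 p.2.2, fun u w z => by simp [pt, h]⟩
  obtain ⟨φ, hφ⟩ := hpt
  -- The constant beyond the far boundary is the common sum of all full columns.
  refine ⟨columnSum H d 0 0, φ, ?_, funext fun v => ?_⟩
  · intro v p hbox _ hp hdist
    obtain ⟨u, w, z, rfl⟩ := exists_pt κ p
    obtain ⟨x, y, t, rfl⟩ := exists_pt κ v
    have hs := sq_le_sqDist (pt κ x y t) (pt κ u w z)
    rw [coord_pt hκ, hφ]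
    rw [inBox_pt] at hbox
    rw [isCentre_pt hκ] at hp
    rw [sqDist_pt, cellRadius_of_ne hκ] at hdist
    have bound : ∀ x : ℤ, x ^ 2 ≤ 2 → -1 ≤ x ∧ x ≤ 1 := fun x hx => by constructor <;> nlinarith
    have h1 := bound (x - u) (by nlinarith [sq_nonneg (y - w), sq_nonneg (t - z)])
    have h2 := bound (y - w) (by nlinarith [sq_nonneg (x - u), sq_nonneg (t - z)])
    have h3 := bound (t - z) (by nlinarith [sq_nonneg (y - w), sq_nonneg (x - u)])
    refine ⟨fun h => IsTriangleFree.potential_of_nonpos (by omega) w z, fun h => ?_⟩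
    obtain rfl : u = 2 * d - 1 := by omega
    exact hH.potential_top hd (by omega) (by omega) (by omega) (by omega)
  · obtain ⟨x, y, t, hv⟩ := exists_pt κ v.1
    have hvert := v.isVertex
    have hbox := v.inBox
    have hfv : f v = H x y t := by
      rw [← show extendZero f v.1 = f v from extendZero_of_mem f v.2, hv]
    rw [hv, isVertex_pt] at hvert
    rw [hv, inBox_pt] at hbox
    have key : ∀ u w z u' w' z', IsCentre κ (pt κ u w z) →
        (x - u) ^ 2 + (y - w) ^ 2 + (t - z) ^ 2 = 2 →
        (u + u' = x + x ∧ w + w' = y + y ∧ z + z' = t + t) →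
        coboundary d κ φ v = ψ u w z + ψ u' w' z' := by
      intro u w z u' w' z' hp h1 h2
      rw [coboundary_eq (p := pt κ u w z) (p' := pt κ u' w' z') hp, hφ, hφ]
      · rw [hv, sqDist_pt, h1, cellRadius_of_ne hκ]
      · rw [hv, pt_add_pt, pt_add_pt, pt_inj]
        exact h2
    rw [hfv]
    rcases hvert with ⟨hx, hy, ht⟩ | ⟨hx, hy, ht⟩ | ⟨hx, hy, ht⟩
    -- The vertex is a site of its own even column: its cuboctahedra are the path ends after `k` and
    -- `k + 1` sites. The sign `s` picks the diagonal of colour `κ`.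
    · obtain ⟨k, rfl⟩ : ∃ k : ℕ, x = 2 * k := ⟨(x / 2).toNat, by omega⟩
      have hs : ∃ s : ℤ, (s = 1 ∨ s = -1) ∧ (2 * (k : ℤ) + 1 + (y + s) + t) % 4 = residue κ := by
        by_cases h : (2 * (k : ℤ) + 1 + (y + 1) + t) % 4 = residue κ
        · exact ⟨1, Or.inl rfl, h⟩
        · exact ⟨-1, Or.inr rfl, by omega⟩
      obtain ⟨s, hs, hr⟩ := hs
      rw [key (2 * k + 1) (y + s) t (2 * k - 1) (y - s) t
        ((isCentre_pt hκ).2 ⟨by omega, by omega, by omega, by omega⟩)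
        (by rcases hs with rfl | rfl <;> ring) ⟨by ring, by ring, by ring⟩]
      have h₁ := hH.potential_eq_horizontal hd (k := k + 1) (by omega) hs hy ht hbox.2.1 hbox.2.2
        (by omega)
      have h₂ := hH.potential_eq_horizontal hd (k := k) (s := -s) (by omega) (by omega) hy ht
        hbox.2.1 hbox.2.2 (by omega)
      rw [columnSum_succ] at h₁
      rw [show 2 * ((k + 1 : ℕ) : ℤ) - 1 = 2 * k + 1 by push_cast; ring] at h₁
      rw [← sub_eq_add_neg] at h₂
      rw [hψ, h₁, h₂]
      generalize columnSum H k y t = a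
      generalize H (2 * k) y t = b
      revert a b
      decide
    -- The vertex is on no column. Its cuboctahedra end the even columns `(y, t + s)` and `(y, t -
    -- s)`; comparing both with the odd column `(y + b, t)` leaves the value at the vertex exactly
    -- once.
    · obtain ⟨k, rfl⟩ : ∃ k : ℕ, x = 2 * k - 1 := ⟨((x + 1) / 2).toNat, by omega⟩
      have hs : ∃ s : ℤ, (s = 1 ∨ s = -1) ∧
          (2 * (k : ℤ) - 1 + (y + 1) + (t + s)) % 4 = residue κ := by
        by_cases h : (2 * (k : ℤ) - 1 + (y + 1) + (t + 1)) % 4 = residue κ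
        · exact ⟨1, Or.inl rfl, h⟩
        · exact ⟨-1, Or.inr rfl, by omega⟩
      obtain ⟨s, hs, hr⟩ := hs
      rw [key (2 * k - 1) (y + 1) (t + s) (2 * k - 1) (y - 1) (t - s)
        ((isCentre_pt hκ).2 ⟨by omega, by omega, by omega, by omega⟩)
        (by rcases hs with rfl | rfl <;> ring) ⟨by ring, by ring, by ring⟩]
      have h₁ := hH.potential_eq_horizontal hd (k := k) (s := 1) (w := y) (z := t + s) (by omega)
        (Or.inl rfl) hy (by omega) hbox.2.1 (by omega) (by omega)
      have h₂ := hH.potential_eq_horizontal hd (k := k) (s := -1) (w := y) (z := t - s) (by omega)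
        (Or.inr rfl) hy (by omega) hbox.2.1 (by omega) (by omega)
      rw [← sub_eq_add_neg] at h₂
      have hb : ∃ b : ℤ, (b = 1 ∨ b = -1) ∧ 0 ≤ y + b ∧ y + b ≤ 2 * d - 2 := by
        by_cases h : y = 0
        · exact ⟨1, by omega⟩
        · exact ⟨-1, by omega⟩
      obtain ⟨b, hb, hb'⟩ := hb
      have h₃ := hH.columnSum_add (w := y) (z := t) (b := b) (c := s) hy ht hb hs hbox.2.1 hb'
        hbox.2.2 k (by omega)
      have h₄ := hH.columnSum_add (w := y) (z := t) (b := b) (c := -s) hy ht hb (by omega) hbox.2.1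
        hb' hbox.2.2 k (by omega)
      rw [← sub_eq_add_neg] at h₄
      rw [hψ, h₁, h₂]
      have h₅ : columnSum H k y (t + s) + columnSum H k y (t - s) =
          (columnSum H k (y + b) t + columnSum H k y (t + s)) +
            (columnSum H k (y + b) t + columnSum H k y (t - s)) := by
        generalize columnSum H k y (t + s) = a₁, columnSum H k y (t - s) = a₂,
          columnSum H k (y + b) t = a₃
        revert a₁ a₂ a₃
        decide
      rw [h₅, h₃, h₄]
      by_cases hb1 : (2 * (k : ℤ) - 1 + y + t + b + s - residue κ) % 4 = 2
      · rw [if_pos hb1, if_neg (by omega), add_zero]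
      · rw [if_neg hb1, if_pos (by omega), zero_add]
    -- As for the first kind of vertex, but on an odd column.
    · obtain ⟨k, rfl⟩ : ∃ k : ℕ, x = 2 * k := ⟨(x / 2).toNat, by omega⟩
      have hs : ∃ s : ℤ, (s = 1 ∨ s = -1) ∧ (2 * (k : ℤ) + 1 + y + (t + s)) % 4 = residue κ := by
        by_cases h : (2 * (k : ℤ) + 1 + y + (t + 1)) % 4 = residue κ
        · exact ⟨1, Or.inl rfl, h⟩
        · exact ⟨-1, Or.inr rfl, by omega⟩
      obtain ⟨s, hs, hr⟩ := hs
      rw [key (2 * k + 1) y (t + s) (2 * k - 1) y (t - s)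
        ((isCentre_pt hκ).2 ⟨by omega, by omega, by omega, by omega⟩)
        (by rcases hs with rfl | rfl <;> ring) ⟨by ring, by ring, by ring⟩]
      have h₁ := hH.potential_eq_vertical hd (k := k + 1) (by omega) hs hy ht hbox.2.1 hbox.2.2
        (by omega)
      have h₂ := hH.potential_eq_vertical hd (k := k) (s := -s) (by omega) (by omega) hy ht
        hbox.2.1 hbox.2.2 (by omega)
      rw [columnSum_succ] at h₁
      rw [show 2 * ((k + 1 : ℕ) : ℤ) - 1 = 2 * k + 1 by push_cast; ring] at h₁
      rw [← sub_eq_add_neg] at h₂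
      rw [hψ, h₁, h₂]
      generalize columnSum H k y t = a
      generalize H (2 * k) y t = b
      revert a b
      decide

end

/-! ### The surface code whose cells are octahedra -/

section

variable {d : ℕ}

/-- The centre of a square face between two cuboctahedra, which is orthogonal to the given axis. -/
def IsSquareCentre (d : ℕ) (axis : Colour) (x y z : ℤ) : Prop :=
  ((0 ≤ x ∧ x ≤ 2 * d - 2) ∧ (0 ≤ y ∧ y ≤ 2 * d - 2) ∧ (0 ≤ z ∧ z ≤ 2 * d - 2)) ∧
    match axis with
    | .r => x % 2 = 0 ∧ y % 2 = 1 ∧ z % 2 = 0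
    | .b => x % 2 = 1 ∧ y % 2 = 0 ∧ z % 2 = 0
    | .g => x % 2 = 1 ∧ y % 2 = 1 ∧ z % 2 = 1

/-- The vertices of the square with the given centre orthogonal to the given axis. -/
def squareVertices : Colour → ℤ → ℤ → ℤ → Finset Point
  | .r, x, y, z => {(x, y + 1, z), (x, y - 1, z), (x, y, z + 1), (x, y, z - 1)}
  | .b, x, y, z => {(x + 1, y, z), (x - 1, y, z), (x, y, z + 1), (x, y, z - 1)}
  | .g, x, y, z => {(x + 1, y, z), (x - 1, y, z), (x, y + 1, z), (x, y - 1, z)}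

/-- The unit vector along an axis. -/
def unitVector : Colour → Point
  | .r => (1, 0, 0)
  | .b => (0, 1, 0)
  | .g => (0, 0, 1)

theorem sq_add_sq_eq_four {a b c : ℤ} (ha : a % 2 = 0) (hb : b % 2 = 0) (hc : c % 2 = 0)
    (h : a ^ 2 + b ^ 2 + c ^ 2 = 4) : ((a = 2 ∨ a = -2) ∧ b = 0 ∧ c = 0) ∨
      (a = 0 ∧ (b = 2 ∨ b = -2) ∧ c = 0) ∨ (a = 0 ∧ b = 0 ∧ (c = 2 ∨ c = -2)) := by
  obtain ⟨a, rfl⟩ : ∃ a', a = 2 * a' := ⟨a / 2, by omega⟩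
  obtain ⟨b, rfl⟩ : ∃ a', b = 2 * a' := ⟨b / 2, by omega⟩
  obtain ⟨c, rfl⟩ : ∃ a', c = 2 * a' := ⟨c / 2, by omega⟩
  have bound : ∀ x : ℤ, x ^ 2 ≤ 1 → x = -1 ∨ x = 0 ∨ x = 1 := fun x hx => by
    have h1 : x ≤ 1 := by nlinarith
    have h2 : -1 ≤ x := by nlinarith
    omega
  have ha := bound a (by nlinarith)
  have hb := bound b (by nlinarith)
  have hc := bound c (by nlinarith)
  rcases ha with rfl | rfl | rfl <;> rcases hb with rfl | rfl | rfl <;>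
    rcases hc with rfl | rfl | rfl <;> revert h <;> decide

/-- The squares between cuboctahedra of different colours. -/
theorem isFace_r_b_iff {p₁ p₂ : Point} : IsFace d .r p₁ .b p₂ ↔ IsCentre .r p₁ ∧ IsCentre .b p₂ ∧
    ∃ i x y z, IsSquareCentre d i x y z ∧ ∃ s : ℤ, (s = 1 ∨ s = -1) ∧
      p₁ = (x, y, z) + s • unitVector i ∧ p₂ = (x, y, z) - s • unitVector i := by
  obtain ⟨x₁, y₁, z₁⟩ := p₁
  obtain ⟨x₂, y₂, z₂⟩ := p₂
  constructor
  · rintro ⟨⟨-, h₁, h₂, h₃⟩, h⟩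
    refine ⟨h₁, h₂, ?_⟩
    rw [if_neg (by decide)] at h₃
    simp only [IsCell, IsCentre, sqDist, Int.even_iff, Int.odd_iff] at h₁ h₂ h₃ h
    rcases sq_add_sq_eq_four (by omega) (by omega) (by omega) h₃ with h₄ | h₄ | h₄
    · refine ⟨.r, x₁ - (x₁ - x₂) / 2, y₁, z₁, ?_, (x₁ - x₂) / 2, by omega, ?_⟩
      · simp only [IsSquareCentre]
        omega
      · simp only [unitVector, Prod.smul_mk, Prod.mk_add_mk, Prod.mk_sub_mk, Prod.mk.injEq,
          smul_eq_mul]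
        omega
    · refine ⟨.b, x₁, y₁ - (y₁ - y₂) / 2, z₁, ?_, (y₁ - y₂) / 2, by omega, ?_⟩
      · simp only [IsSquareCentre]
        omega
      · simp only [unitVector, Prod.smul_mk, Prod.mk_add_mk, Prod.mk_sub_mk, Prod.mk.injEq,
          smul_eq_mul]
        omega
    · refine ⟨.g, x₁, y₁, z₁ - (z₁ - z₂) / 2, ?_, (z₁ - z₂) / 2, by omega, ?_⟩
      · simp only [IsSquareCentre]
        omega
      · simp only [unitVector, Prod.smul_mk, Prod.mk_add_mk, Prod.mk_sub_mk, Prod.mk.injEq,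
          smul_eq_mul]
        omega
  · rintro ⟨h₁, h₂, i, x, y, z, h, s, hs, e₁, e₂⟩
    refine ⟨⟨by decide, h₁, h₂, ?_⟩, Or.inr ?_⟩
    · rw [if_neg (by decide), e₁, e₂]
      have hs' : s ^ 2 = 1 := by rcases hs with rfl | rfl <;> rfl
      cases i <;> simp only [unitVector, Prod.smul_mk, Prod.mk_add_mk, Prod.mk_sub_mk, sqDist,
        smul_eq_mul] <;> linear_combination 4 * hs'
    · rw [e₁, e₂]
      have := h.1
      cases i <;> simp only [unitVector, Prod.smul_mk, Prod.mk_add_mk, Prod.mk_sub_mk,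
        smul_eq_mul] <;> omega

theorem square_vertices {x y t s : ℤ} (hs : s = 1 ∨ s = -1) :
    (x ^ 2 + y ^ 2 + (t - s) ^ 2 = 2 ∧ x ^ 2 + y ^ 2 + (t + s) ^ 2 = 2) ↔
    (x = 1 ∧ y = 0 ∧ t = 0) ∨ (x = -1 ∧ y = 0 ∧ t = 0) ∨ (x = 0 ∧ y = 1 ∧ t = 0) ∨
      (x = 0 ∧ y = -1 ∧ t = 0) := by
  constructor
  · rintro ⟨h1, h2⟩
    obtain rfl : t = 0 := by rcases hs with rfl | rfl <;> linarith
    have bound : ∀ x : ℤ, x ^ 2 ≤ 1 → x = -1 ∨ x = 0 ∨ x = 1 := fun x hx => by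
      have h1 : x ≤ 1 := by nlinarith
      have h2 : -1 ≤ x := by nlinarith
      omega
    have hs' : s ^ 2 = 1 := by rcases hs with rfl | rfl <;> rfl
    have h3 : x ^ 2 + y ^ 2 = 1 := by linear_combination h1 - hs'
    have hx := bound x (by nlinarith)
    have hy := bound y (by nlinarith)
    clear h1 h2 hs' hs bound
    rcases hx with rfl | rfl | rfl <;> rcases hy with rfl | rfl | rfl <;> revert h3 <;> decide
  · rcases hs with rfl | rfl <;>
      rintro (⟨rfl, rfl, rfl⟩ | ⟨rfl, rfl, rfl⟩ | ⟨rfl, rfl, rfl⟩ | ⟨rfl, rfl, rfl⟩) <;> decide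

theorem bits_square_dotProduct {i : Colour} {x y z s : ℤ} (hs : s = 1 ∨ s = -1)
    (f : Vertex d → ZMod 2) :
    bits (cellVertices d .r ((x, y, z) + s • unitVector i) ∩
        cellVertices d .b ((x, y, z) - s • unitVector i)) ⬝ᵥ f =
      ∑ p ∈ squareVertices i x y z, extendZero f p := by
  refine bits_dotProduct_eq_sum_extendZero (fun v => ?_) f
  obtain ⟨⟨x', y', z'⟩, hv⟩ := v
  have hr : cellRadius .r = 2 := rfl
  have hb : cellRadius .b = 2 := rfl
  have key := fun a b c => square_vertices (x := a) (y := b) (t := c) hs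
  simp only [cellVertices, Set.mem_inter_iff, Set.mem_ofPred_eq, hr, hb]
  cases i
  · have e : ∀ r : ℤ, sqDist (x', y', z') ((x, y, z) + r • unitVector .r) =
        (y' - y) ^ 2 + (z' - z) ^ 2 + (x' - x - r) ^ 2 := fun r => by
      simp [sqDist, unitVector]
      ring
    rw [sub_eq_add_neg, ← neg_smul, e, e, sub_neg_eq_add, key]
    simp only [squareVertices, Finset.mem_insert, Finset.mem_singleton, Prod.mk.injEq]
    omega
  · have e : ∀ r : ℤ, sqDist (x', y', z') ((x, y, z) + r • unitVector .g) =
        (x' - x) ^ 2 + (y' - y) ^ 2 + (z' - z - r) ^ 2 := fun r => by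
      simp [sqDist, unitVector]
      ring
    rw [sub_eq_add_neg, ← neg_smul, e, e, sub_neg_eq_add, key]
    simp only [squareVertices, Finset.mem_insert, Finset.mem_singleton, Prod.mk.injEq]
    omega
  · have e : ∀ r : ℤ, sqDist (x', y', z') ((x, y, z) + r • unitVector .b) =
        (x' - x) ^ 2 + (z' - z) ^ 2 + (y' - y - r) ^ 2 := fun r => by
      simp [sqDist, unitVector]
      ring
    rw [sub_eq_add_neg, ← neg_smul, e, e, sub_neg_eq_add, key]
    simp only [squareVertices, Finset.mem_insert, Finset.mem_singleton, Prod.mk.injEq]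
    omega

theorem sum_squareVertices (i : Colour) (x y z : ℤ) (h : Point → ZMod 2) :
    ∑ p ∈ squareVertices i x y z, h p = match i with
      | .r => h (x, y + 1, z) + (h (x, y - 1, z) + (h (x, y, z + 1) + h (x, y, z - 1)))
      | .b => h (x + 1, y, z) + (h (x - 1, y, z) + (h (x, y, z + 1) + h (x, y, z - 1)))
      | .g => h (x + 1, y, z) + (h (x - 1, y, z) + (h (x, y + 1, z) + h (x, y - 1, z))) := by
  cases i <;> simp only [squareVertices] <;>
    rw [Finset.sum_insert, Finset.sum_insert, Finset.sum_insert, Finset.sum_singleton] <;>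
    simp only [Finset.mem_insert, Finset.mem_singleton, Prod.mk.injEq] <;> omega

theorem mem_orthSub_iff_isSquareCentre {f : Vertex d → ZMod 2} :
    f ∈ orthSub (surfaceCode d .g).zSpace ↔ ∀ i x y z, IsSquareCentre d i x y z →
      ∑ p ∈ squareVertices i x y z, extendZero f p = 0 := by
  rw [mem_orthSub_zSpace_iff]
  constructor
  · intro h i x y z hm
    -- The coordinate sum modulo four decides on which side of the square the `.r`-cell lies.
    have hs : ∃ s : ℤ, (s = 1 ∨ s = -1) ∧ (x + y + z + s) % 4 = 2 := by
      by_cases h : (x + y + z + 1) % 4 = 2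
      · exact ⟨1, Or.inl rfl, h⟩
      · refine ⟨-1, Or.inr rfl, ?_⟩
        have := hm.2
        cases i <;> dsimp only at this <;> omega
    obtain ⟨s, hs, hr⟩ := hs
    rw [← bits_square_dotProduct hs]
    refine h _ _ _ _ (by decide) (by decide) (isFace_r_b_iff.2 ⟨?_, ?_, i, x, y, z, hm, s, hs, rfl,
      rfl⟩) <;>
    · have := hm.2
      cases i <;> simp only [unitVector, Prod.smul_mk, Prod.mk_add_mk, Prod.mk_sub_mk, smul_eq_mul,
        IsCentre, Int.even_iff, Int.odd_iff] at this ⊢ <;> omega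
  · intro h
    have key : ∀ p₁ p₂, IsFace d .r p₁ .b p₂ →
        bits (cellVertices d .r p₁ ∩ cellVertices d .b p₂) ⬝ᵥ f = 0 := by
      intro p₁ p₂ hf
      obtain ⟨-, -, i, x, y, z, hm, s, hs, rfl, rfl⟩ := isFace_r_b_iff.1 hf
      rw [bits_square_dotProduct hs]
      exact h i x y z hm
    intro c₁ p₁ c₂ p₂ h₁ h₂ hf
    have hne := hf.1.1
    cases c₁ <;> cases c₂ <;> first
      | exact absurd rfl h₁
      | exact absurd rfl h₂
      | exact absurd rfl hne
      | exact key _ _ hf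
      | (rw [Set.inter_comm]; exact key _ _ hf.symm)

theorem isCentre_g_mk {x y z : ℤ} :
    IsCentre .g (x, y, z) ↔ x % 2 = 0 ∧ y % 2 = 0 ∧ z % 2 = 1 := by
  simp only [IsCentre, Int.even_iff, Int.odd_iff]

theorem isVertex_mk {x y z : ℤ} : IsVertex (x, y, z) ↔
    (x % 2 = 0 ∧ y % 2 = 0 ∧ z % 2 = 0) ∨ (x % 2 = 1 ∧ y % 2 = 0 ∧ z % 2 = 1) ∨
      (x % 2 = 0 ∧ y % 2 = 1 ∧ z % 2 = 1) := by
  simp only [IsVertex, Int.even_iff, Int.odd_iff]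

theorem extendZero_coboundary_mk {φ : Point → ZMod 2} {x y z x₁ y₁ z₁ x₂ y₂ z₂ : ℤ}
    (hbox : InBox d (x, y, z)) (hv : IsVertex (x, y, z)) (hp : IsCentre .g (x₁, y₁, z₁))
    (h : (x - x₁) ^ 2 + (y - y₁) ^ 2 + (z - z₁) ^ 2 = 1)
    (h' : x₁ + x₂ = x + x ∧ y₁ + y₂ = y + y ∧ z₁ + z₂ = z + z) :
    extendZero (coboundary d .g φ) (x, y, z) = φ (x₁, y₁, z₁) + φ (x₂, y₂, z₂) :=
  extendZero_coboundary hbox hv hp h (Prod.ext h'.1 (Prod.ext h'.2.1 h'.2.2))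

/-- Functions on the octahedra which are constant beyond the boundaries have coboundaries that
commute with the squares. -/
theorem coboundary_mem_orthSub_g {α β : ZMod 2} {φ : Point → ZMod 2}
    (hφ : IsConstantBeyond d .g α β φ) :
    coboundary d .g φ ∈ orthSub (surfaceCode d .g).zSpace := by
  have heq : ∀ x y x' y' z : ℤ, InBox d (x, y, z - 1) ∨ InBox d (x, y, z + 1) →
      InBox d (x', y', z - 1) ∨ InBox d (x', y', z + 1) → x % 2 = 0 → y % 2 = 0 → x' % 2 = 0 →
      y' % 2 = 0 → z % 2 = 1 → z < 0 ∨ 2 * (d : ℤ) - 2 < z → φ (x, y, z) = φ (x', y', z) := by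
    have : ∀ x y z : ℤ, InBox d (x, y, z - 1) ∨ InBox d (x, y, z + 1) → x % 2 = 0 → y % 2 = 0 →
        z % 2 = 1 → (z < 0 → φ (x, y, z) = α) ∧ (2 * (d : ℤ) - 2 < z → φ (x, y, z) = β) := by
      rintro x y z (h | h) hx hy hz
      · exact hφ (x, y, z - 1) (x, y, z) h (isVertex_mk.2 (by omega)) (isCentre_g_mk.2 ⟨hx, hy, hz⟩)
          (by simp [sqDist, cellRadius])
      · exact hφ (x, y, z + 1) (x, y, z) h (isVertex_mk.2 (by omega)) (isCentre_g_mk.2 ⟨hx, hy, hz⟩)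
          (by simp [sqDist, cellRadius])
    rintro x y x' y' z h h' hx hy hx' hy' hz (hlt | hgt)
    · rw [(this x y z h hx hy hz).1 hlt, (this x' y' z h' hx' hy' hz).1 hlt]
    · rw [(this x y z h hx hy hz).2 hgt, (this x' y' z h' hx' hy' hz).2 hgt]
  -- Four octahedra surround a square, each counted by two of its vertices.
  have hcancel : ∀ a b c e : ZMod 2, a + b + (c + e + (a + c + (b + e))) = 0 := by decide
  rw [mem_orthSub_iff_isSquareCentre]
  rintro i x y z ⟨hbox, hp⟩
  rw [sum_squareVertices]
  cases i <;> dsimp only at hp ⊢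
  -- If this vertex is cut off, its two octahedra lie beyond one boundary and have equal values, so
  -- the formula still gives zero.
  · have hside : ∀ s : ℤ, s = 1 ∨ s = -1 → extendZero (coboundary d .g φ) (x, y, z + s) =
        φ (x, y + 1, z + s) + φ (x, y - 1, z + s) := by
      intro s hs
      by_cases hin : InBox d (x, y, z + s)
      · exact extendZero_coboundary_mk hin (isVertex_mk.2 (by omega)) (isCentre_g_mk.2 (by omega))
          (by ring) (by omega)
      · rw [extendZero_of_not_inBox _ hin, heq x (y + 1) x (y - 1), zmod_two_add_self] <;>
          simp only [InBox] at hin ⊢ <;> omega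
    rw [extendZero_coboundary_mk (x₁ := x) (y₁ := y + 1) (z₁ := z + 1) (x₂ := x) (y₂ := y + 1)
        (z₂ := z - 1) (by simp only [InBox]; omega) (isVertex_mk.2 (by omega))
        (isCentre_g_mk.2 (by omega)) (by ring) (by omega),
      extendZero_coboundary_mk (x₁ := x) (y₁ := y - 1) (z₁ := z + 1) (x₂ := x) (y₂ := y - 1)
        (z₂ := z - 1) (by simp only [InBox]; omega) (isVertex_mk.2 (by omega))
        (isCentre_g_mk.2 (by omega)) (by ring) (by omega), sub_eq_add_neg z,
      hside 1 (Or.inl rfl), hside (-1) (Or.inr rfl)]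
    exact hcancel _ _ _ _
  -- The centre has odd coordinates only, so no vertex of the square is cut off.
  · rw [extendZero_coboundary_mk (x₁ := x + 1) (y₁ := y + 1) (z₁ := z) (x₂ := x + 1) (y₂ := y - 1)
        (z₂ := z) (by simp only [InBox]; omega) (isVertex_mk.2 (by omega))
        (isCentre_g_mk.2 (by omega)) (by ring) (by omega),
      extendZero_coboundary_mk (x₁ := x - 1) (y₁ := y + 1) (z₁ := z) (x₂ := x - 1) (y₂ := y - 1)
        (z₂ := z) (by simp only [InBox]; omega) (isVertex_mk.2 (by omega))
        (isCentre_g_mk.2 (by omega)) (by ring) (by omega),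
      extendZero_coboundary_mk (x₁ := x + 1) (y₁ := y + 1) (z₁ := z) (x₂ := x - 1) (y₂ := y + 1)
        (z₂ := z) (by simp only [InBox]; omega) (isVertex_mk.2 (by omega))
        (isCentre_g_mk.2 (by omega)) (by ring) (by omega),
      extendZero_coboundary_mk (x₁ := x + 1) (y₁ := y - 1) (z₁ := z) (x₂ := x - 1) (y₂ := y - 1)
        (z₂ := z) (by simp only [InBox]; omega) (isVertex_mk.2 (by omega))
        (isCentre_g_mk.2 (by omega)) (by ring) (by omega)]
    exact hcancel _ _ _ _
  · have hside : ∀ s : ℤ, s = 1 ∨ s = -1 → extendZero (coboundary d .g φ) (x, y, z + s) =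
        φ (x + 1, y, z + s) + φ (x - 1, y, z + s) := by
      intro s hs
      by_cases hin : InBox d (x, y, z + s)
      · exact extendZero_coboundary_mk hin (isVertex_mk.2 (by omega)) (isCentre_g_mk.2 (by omega))
          (by ring) (by omega)
      · rw [extendZero_of_not_inBox _ hin, heq (x + 1) y (x - 1) y, zmod_two_add_self] <;>
          simp only [InBox] at hin ⊢ <;> omega
    rw [extendZero_coboundary_mk (x₁ := x + 1) (y₁ := y) (z₁ := z + 1) (x₂ := x + 1) (y₂ := y)
        (z₂ := z - 1) (by simp only [InBox]; omega) (isVertex_mk.2 (by omega))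
        (isCentre_g_mk.2 (by omega)) (by ring) (by omega),
      extendZero_coboundary_mk (x₁ := x - 1) (y₁ := y) (z₁ := z + 1) (x₂ := x - 1) (y₂ := y)
        (z₂ := z - 1) (by simp only [InBox]; omega) (isVertex_mk.2 (by omega))
        (isCentre_g_mk.2 (by omega)) (by ring) (by omega), sub_eq_add_neg z,
      hside 1 (Or.inl rfl), hside (-1) (Or.inr rfl)]
    exact hcancel _ _ _ _

/-- Every function commuting with the squares is the coboundary of a function on octahedra. -/
theorem exists_coboundary_eq_g {f : Vertex d → ZMod 2}
    (hf : f ∈ orthSub (surfaceCode d .g).zSpace) :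
    ∃ β φ, IsConstantBeyond d .g 0 β φ ∧ f = coboundary d .g φ := by
  rw [mem_orthSub_iff_isSquareCentre] at hf
  -- The height comes first, so that `columnSum` runs along vertical columns.
  set H : ℤ → ℤ → ℤ → ZMod 2 := fun u x y => extendZero f (x, y, u) with hHdef
  have hzero : ∀ u x y, u < 0 ∨ 2 * (d : ℤ) - 2 < u → H u x y = 0 := fun u x y h => by
    refine extendZero_of_not_inBox _ ?_
    simp only [InBox]
    omega
  have hstep : ∀ a b c e s : ZMod 2, a + (b + (c + e)) = 0 → s = e → s + (a + b) = c := by decide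
  -- A ladder of squares lies between neighbouring columns: the square at height `2k` trades the
  -- rung at `2k - 1` for the one at `2k + 1`, and the lowest rung, at `-1`, is outside.
  have hx : ∀ x y : ℤ, x % 2 = 1 → y % 2 = 0 → 0 ≤ x ∧ x ≤ 2 * d - 2 → 0 ≤ y ∧ y ≤ 2 * d - 2 →
      ∀ k ≤ d, columnSum H k (x + 1) y + columnSum H k (x - 1) y = H (2 * k - 1) x y := by
    intro x y hx hy hx' hy' k
    induction k with
    | zero => intro _; simp [columnSum, hzero]
    | succ k ih =>
      intro hk
      have h := hf .b x y (2 * k) ⟨⟨hx', hy', by omega⟩, hx, hy, by omega⟩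
      rw [sum_squareVertices] at h
      rw [columnSum_succ, columnSum_succ, add_add_add_comm]
      push_cast
      rw [show 2 * ((k : ℤ) + 1) - 1 = 2 * k + 1 by ring]
      exact hstep _ _ _ _ _ h (ih (by omega))
  have hy : ∀ x y : ℤ, x % 2 = 0 → y % 2 = 1 → 0 ≤ x ∧ x ≤ 2 * d - 2 → 0 ≤ y ∧ y ≤ 2 * d - 2 →
      ∀ k ≤ d, columnSum H k x (y + 1) + columnSum H k x (y - 1) = H (2 * k - 1) x y := by
    intro x y hx hy hx' hy' k
    induction k with
    | zero => intro _; simp [columnSum, hzero]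
    | succ k ih =>
      intro hk
      have h := hf .r x y (2 * k) ⟨⟨hx', hy', by omega⟩, hx, hy, by omega⟩
      rw [sum_squareVertices] at h
      rw [columnSum_succ, columnSum_succ, add_add_add_comm]
      push_cast
      rw [show 2 * ((k : ℤ) + 1) - 1 = 2 * k + 1 by ring]
      exact hstep _ _ _ _ _ h (ih (by omega))
  have heq : ∀ a b : ZMod 2, a + b = 0 → a = b := by decide
  -- At `k = d` the rung is above the lattice, so neighbouring full columns have equal sums.
  have htop : ∀ x y : ℤ, x % 2 = 0 → y % 2 = 0 → 0 ≤ x ∧ x ≤ 2 * d - 2 → 0 ≤ y ∧ y ≤ 2 * d - 2 →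
      columnSum H d x y = columnSum H d 0 0 := by
    intro x y ex ey hx' hy'
    obtain ⟨m, rfl⟩ : ∃ m : ℕ, x = 2 * m := ⟨(x / 2).toNat, by omega⟩
    obtain ⟨n, rfl⟩ : ∃ n : ℕ, y = 2 * n := ⟨(y / 2).toNat, by omega⟩
    have h₁ : columnSum H d (2 * m) (2 * n) = columnSum H d 0 (2 * n) := by
      clear ex
      induction m with
      | zero => simp
      | succ m ih =>
        push_cast at hx' ⊢
        rw [← ih (by omega)]
        have := hx (2 * m + 1) (2 * n) (by omega) ey (by omega) hy' d le_rfl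
        rw [hzero _ _ _ (by omega), add_sub_cancel_right] at this
        rw [← heq _ _ this]
        congr 1
    have h₂ : columnSum H d 0 (2 * n) = columnSum H d 0 0 := by
      clear ey h₁
      induction n with
      | zero => simp
      | succ n ih =>
        push_cast at hy' ⊢
        rw [← ih (by omega)]
        have := hy 0 (2 * n + 1) rfl (by omega) (by omega) (by omega) d le_rfl
        rw [hzero _ _ _ (by omega), add_sub_cancel_right] at this
        rw [← heq _ _ this]
        congr 1
    rw [h₁, h₂]
  -- An octahedron at height `2k - 1` gets the sum over the `k` sites of its column below it.
  set φ : Point → ZMod 2 := fun p => columnSum H ((p.2.2 + 1) / 2).toNat p.1 p.2.1 with hφdef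
  have hφ : ∀ (x y : ℤ) (k : ℕ), φ (x, y, 2 * k - 1) = columnSum H k x y := fun x y k => by
    rw [hφdef]
    dsimp only
    congr 1
    omega
  refine ⟨columnSum H d 0 0, φ, ?_, funext fun v => ?_⟩
  · rintro ⟨x, y, z⟩ ⟨x', y', z'⟩ hbox hv hp hdist
    rw [isCentre_g_mk] at hp
    rw [isVertex_mk] at hv
    simp only [InBox, sqDist, cellRadius, coord] at hbox hdist ⊢
    have bound : ∀ x : ℤ, x ^ 2 ≤ 1 → -1 ≤ x ∧ x ≤ 1 := fun x hx => by constructor <;> nlinarith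
    have h1 := bound (z - z') (by nlinarith [sq_nonneg (x - x'), sq_nonneg (y - y')])
    refine ⟨fun h => ?_, fun h => ?_⟩
    · rw [show z' = 2 * ((0 : ℕ) : ℤ) - 1 by push_cast; omega, hφ]
      rfl
    · obtain rfl : z' = 2 * d - 1 := by omega
      -- The height difference uses up the unit distance, so the octahedron is directly above the
      -- vertex and its column lies in the lattice.
      have h2 : (z - (2 * d - 1)) ^ 2 = 1 := by
        rw [show z = 2 * d - 2 by omega]
        ring
      obtain ⟨h3, h4⟩ : x - x' = 0 ∧ y - y' = 0 := by
        constructor <;> nlinarith [sq_nonneg (x - x'), sq_nonneg (y - y')]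
      rw [hφ]
      exact htop x' y' (by omega) (by omega) (by omega) (by omega)
  · obtain ⟨⟨x, y, z⟩, hmem⟩ := v
    obtain ⟨hbox, hv⟩ := mem_latticeVertices.1 hmem
    have hfv : f ⟨(x, y, z), hmem⟩ = H z x y := (extendZero_of_mem f hmem).symm
    have key := fun x₁ y₁ z₁ x₂ y₂ z₂ => extendZero_coboundary_mk (φ := φ) (x₁ := x₁) (y₁ := y₁)
      (z₁ := z₁) (x₂ := x₂) (y₂ := y₂) (z₂ := z₂) hbox hv
    rw [hfv, ← extendZero_of_mem (coboundary d .g φ) hmem]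
    simp only [InBox] at hbox
    rw [isVertex_mk] at hv
    rcases hv with ⟨ex, ey, ez⟩ | ⟨ex, ey, ez⟩ | ⟨ex, ey, ez⟩
    · obtain ⟨k, rfl⟩ : ∃ k : ℕ, z = 2 * k := ⟨(z / 2).toNat, by omega⟩
      rw [key x y (2 * ((k + 1 : ℕ) : ℤ) - 1) x y (2 * k - 1) (isCentre_g_mk.2 (by omega))
        (by push_cast; ring) (by omega), hφ, hφ, columnSum_succ]
      generalize columnSum H k x y = a
      generalize H (2 * k) x y = b
      revert a b
      decide
    · obtain ⟨k, rfl⟩ : ∃ k : ℕ, z = 2 * k - 1 := ⟨((z + 1) / 2).toNat, by omega⟩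
      rw [key (x + 1) y (2 * k - 1) (x - 1) y (2 * k - 1) (isCentre_g_mk.2 (by omega))
        (by ring) (by omega), hφ, hφ, hx x y ex ey hbox.1 hbox.2.1 k (by omega)]
    · obtain ⟨k, rfl⟩ : ∃ k : ℕ, z = 2 * k - 1 := ⟨((z + 1) / 2).toNat, by omega⟩
      rw [key x (y + 1) (2 * k - 1) x (y - 1) (2 * k - 1) (isCentre_g_mk.2 (by omega))
        (by ring) (by omega), hφ, hφ, hy x y ex ey hbox.1 hbox.2.1 k (by omega)]

end

/-! ### Logical operators of the surface codes -/

section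

variable {d : ℕ}

theorem coboundary_mem_orthSub {c : Colour} {α β : ZMod 2} {φ : Point → ZMod 2}
    (hφ : IsConstantBeyond d c α β φ) :
    coboundary d c φ ∈ orthSub (surfaceCode d c).zSpace := by
  rcases eq_or_ne c .g with rfl | h
  · exact coboundary_mem_orthSub_g hφ
  · exact coboundary_mem_orthSub_of_ne h hφ

theorem exists_coboundary_eq (hd : 2 ≤ d) {c : Colour} {f : Vertex d → ZMod 2}
    (hf : f ∈ orthSub (surfaceCode d c).zSpace) :
    ∃ β φ, IsConstantBeyond d c 0 β φ ∧ f = coboundary d c φ := by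
  rcases eq_or_ne c .g with rfl | h
  · exact exists_coboundary_eq_g hf
  · exact exists_coboundary_eq_of_ne hd h hf

open scoped Classical in
/-- The indicator function of the points beyond a `c`-boundary. -/
noncomputable def beyond (d : ℕ) (c : Colour) (i : Bool) (p : Point) : ZMod 2 :=
  if (if i then 2 * (d : ℤ) - 2 < coord c p else coord c p < 0) then 1 else 0

/-- Exactly at the vertices of this boundary does one of the two cells lie beyond it, and never
both. -/
theorem coboundary_beyond (c : Colour) (i : Bool) :
    coboundary d c (beyond d c i) = bits (surfaceBoundary d c i) := by
  funext v
  obtain ⟨h1, h2, h3⟩ := coord_cellAt v c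
  have hbox := inBox_iff_coord.1 v.inBox c
  have h10 := fun h => h1 h 0
  have h11 := fun h => h1 h 1
  have h20 := fun h => h2 h 0
  have h21 := fun h => h2 h 1
  clear h1 h2
  simp only [coboundary, beyond, bits, mem_surfaceBoundary]
  generalize coord c (cellAt c v.1 0) = a, coord c (cellAt c v.1 1) = b, coord c v.1 = e at *
  cases i <;> simp only [Bool.false_eq_true, if_false, if_true] <;>
    split_ifs <;> first | rfl | (exfalso; omega)

theorem isConstantBeyond_beyond (hd : 2 ≤ d) (c : Colour) (i : Bool) :
    IsConstantBeyond d c (if i then 0 else 1) (if i then 1 else 0) (beyond d c i) := by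
  intro v p _ _ _ _
  simp only [beyond]
  cases i <;> simp only [Bool.false_eq_true, if_false, if_true] <;>
    refine ⟨fun h => ?_, fun h => ?_⟩ <;> first | exact if_pos h | exact if_neg (by omega)

theorem surfaceBoundary_mem_orthSub (hd : 2 ≤ d) (c : Colour) (i : Bool) :
    bits (surfaceBoundary d c i) ∈ orthSub (surfaceCode d c).zSpace := by
  rw [← coboundary_beyond]
  exact coboundary_mem_orthSub (isConstantBeyond_beyond hd c i)

theorem IsCell.coord_mem {c : Colour} {p : Point} (hp : IsCell d c p) :
    0 ≤ coord c p ∧ coord c p ≤ 2 * d - 2 := by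
  cases c
  · exact hp.2.1
  · exact hp.2.2.2
  · exact hp.2.2.1

theorem coboundary_single {c : Colour} {p : Point} (hp : IsCentre c p) :
    coboundary d c (Pi.single p 1) = bits (cellVertices d c p) := by
  funext v
  have hinj := cellAt_injective v.isVertex c
  by_cases hv : v ∈ cellVertices d c p
  · rw [bits_mem hv, coboundary]
    obtain ⟨t, rfl⟩ := (mem_cellVertices_iff hp).1 hv
    rcases zmod_two_cases t with rfl | rfl
    · rw [Pi.single_eq_same, Pi.single_eq_of_ne (hinj.ne (by decide)), add_zero]
    · rw [Pi.single_eq_same, Pi.single_eq_of_ne (hinj.ne (by decide)), zero_add]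
  · rw [bits_notMem hv, coboundary]
    rw [mem_cellVertices_iff hp, not_exists] at hv
    rw [Pi.single_eq_of_ne (Ne.symm (hv 0)), Pi.single_eq_of_ne (Ne.symm (hv 1)), add_zero]

/-- A cell is the coboundary of its own indicator function, which vanishes beyond both boundaries.
-/
theorem surfaceCode_isOrthogonal (d : ℕ) (c : Colour) : (surfaceCode d c).IsOrthogonal := by
  refine Submodule.span_le.2 ?_
  rintro _ ⟨_, ⟨p, hp, rfl⟩, rfl⟩
  rw [SetLike.mem_coe, ← coboundary_single hp.1]
  refine coboundary_mem_orthSub (α := 0) (β := 0) fun v q _ _ _ _ => ?_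
  have := hp.coord_mem
  refine ⟨fun h => Pi.single_eq_of_ne ?_ _, fun h => Pi.single_eq_of_ne ?_ _⟩ <;>
  · rintro rfl
    omega

/-- The coboundary is the sum of the cells weighted by `φ`, and only cells of the lattice have
nonzero weight. -/
theorem coboundary_mem_xSpace {c : Colour} {φ : Point → ZMod 2}
    (hφ : ∀ v : Vertex d, ∀ t, ¬ IsCell d c (cellAt c v.1 t) → φ (cellAt c v.1 t) = 0) :
    coboundary d c φ ∈ (surfaceCode d c).xSpace := by
  classical
  set P : Finset Point :=
    Finset.univ.image fun q : Vertex d × ZMod 2 => cellAt c q.1.1 q.2 with hP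
  have h : coboundary d c φ = ∑ p ∈ P, φ p • bits (cellVertices d c p) := by
    funext v
    rw [Finset.sum_apply, ← Finset.sum_subset (s₁ := Finset.univ.image (cellAt c v.1)),
      Finset.sum_image (cellAt_injective v.isVertex c).injOn]
    · have h1 : ∀ t, v ∈ cellVertices d c (cellAt c v.1 t) := fun t =>
        (mem_cellVertices_iff (isCentre_cellAt v.isVertex c t)).2 ⟨t, rfl⟩
      simp only [Pi.smul_apply, bits_mem (h1 _), smul_eq_mul, mul_one]
      exact (Fin.sum_univ_two fun t : Fin 2 => φ (cellAt c v.1 t)).symm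
    · intro p hp
      obtain ⟨t, -, rfl⟩ := Finset.mem_image.1 hp
      exact Finset.mem_image.2 ⟨(v, t), Finset.mem_univ _, rfl⟩
    · intro p hp hpv
      obtain ⟨q, -, rfl⟩ := Finset.mem_image.1 hp
      rw [Pi.smul_apply, bits_notMem, smul_zero]
      rw [mem_cellVertices_iff (isCentre_cellAt q.1.isVertex c q.2)]
      rintro ⟨t, ht⟩
      exact hpv (Finset.mem_image.2 ⟨t, Finset.mem_univ _, ht.symm⟩)
  rw [h]
  refine Submodule.sum_mem _ fun p hp => ?_
  obtain ⟨q, -, rfl⟩ := Finset.mem_image.1 hp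
  by_cases hcell : IsCell d c (cellAt c q.1.1 q.2)
  · exact Submodule.smul_mem _ _ (Submodule.subset_span ⟨_, ⟨_, hcell, rfl⟩, rfl⟩)
  · rw [hφ _ _ hcell, zero_smul]
    exact zero_mem _

/-- Subtracting its constant beyond the far boundary makes a primitive vanish on all missing cells,
at the cost of a multiple of the boundary membrane. -/
theorem orthSub_zSpace_le (hd : 2 ≤ d) (c : Colour) : orthSub (surfaceCode d c).zSpace ≤
    (surfaceCode d c).xSpace ⊔ Submodule.span (ZMod 2) {bits (surfaceBoundary d c true)} := by
  intro f hf
  obtain ⟨β, φ, hφ, rfl⟩ := exists_coboundary_eq hd hf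
  have h : coboundary d c φ = coboundary d c (φ - β • beyond d c true) +
      β • bits (surfaceBoundary d c true) := by
    rw [← coboundary_beyond]
    funext v
    simp only [coboundary, Pi.add_apply, Pi.sub_apply, Pi.smul_apply, smul_eq_mul]
    ring
  rw [h]
  refine Submodule.add_mem_sup (coboundary_mem_xSpace fun v t ht => ?_)
    (Submodule.smul_mem _ _ (Submodule.mem_span_singleton_self _))
  have h1 := hφ v.1 _ v.inBox v.isVertex (isCentre_cellAt v.isVertex c t) (sqDist_cellAt v.isVertex c t)
  have h2 := isConstantBeyond_beyond hd c true v.1 _ v.inBox v.isVertex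
    (isCentre_cellAt v.isVertex c t) (sqDist_cellAt v.isVertex c t)
  rw [isCell_cellAt_iff, not_and_or, not_le, not_le] at ht
  rw [Pi.sub_apply, Pi.smul_apply]
  rcases ht with ht | ht
  · rw [h1.1 ht, h2.1 ht]
    simp
  · rw [h1.2 ht, h2.2 ht]
    simp

/-! ### Intersection parities of strings, membranes and cells -/

theorem bits_dotProduct_bits {A B : Set (Vertex d)} {T : Finset Point}
    (hT : ∀ p ∈ T, p ∈ latticeVertices d) (h : ∀ v : Vertex d, v ∈ A ∩ B ↔ v.1 ∈ T) :
    bits A ⬝ᵥ bits B = T.card := by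
  have h1 : bits A ⬝ᵥ bits B = bits (A ∩ B) ⬝ᵥ fun _ => 1 := by
    refine Finset.sum_congr rfl fun v _ => ?_
    by_cases hA : v ∈ A <;> by_cases hB : v ∈ B <;> simp [bits, hA, hB]
  rw [h1, bits_dotProduct_eq_sum_extendZero h,
    Finset.sum_congr rfl fun p hp => extendZero_of_mem _ (hT p hp), Finset.sum_const, nsmul_one]

theorem forall_colour {P : Colour → Prop} : (∀ c, P c) ↔ P .r ∧ P .g ∧ P .b :=
  ⟨fun h => ⟨h _, h _, h _⟩, fun ⟨h1, h2, h3⟩ c => by cases c <;> assumption⟩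

/-- The line along which boundaries of the two colours other than `c` meet. -/
def boundaryLine (d : ℕ) (c : Colour) (e : Colour → Bool) : Set (Vertex d) :=
  {v | ∀ c', c' ≠ c → v ∈ surfaceBoundary d c' (e c')}

theorem boundaryLine_eq {c c₁ c₂ : Colour} (h₁ : c₁ ≠ c) (h₂ : c₂ ≠ c) (h : c₁ ≠ c₂) (i j : Bool) :
    surfaceBoundary d c₁ i ∩ surfaceBoundary d c₂ j =
      boundaryLine d c fun c' => if c' = c₁ then i else j := by
  ext v
  constructor
  · rintro ⟨hi, hj⟩ c' hc'
    dsimp only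
    split_ifs with h'
    · rwa [h']
    · obtain rfl : c' = c₂ := by
        revert h₁ h₂ h hc' h'
        clear hi hj
        revert c c₁ c₂ c'
        decide
      exact hj
  · intro hv
    have hi := hv c₁ h₁
    have hj := hv c₂ h₂
    dsimp only at hi hj
    rw [if_pos rfl] at hi
    rw [if_neg h.symm] at hj
    exact ⟨hi, hj⟩

/-- Boundaries of the three colours meet in a single vertex. -/
theorem exists_boundary_corner (hd : 2 ≤ d) (e : Colour → Bool) :
    ∃ v : Vertex d, ∀ w : Vertex d, (∀ c, w ∈ surfaceBoundary d c (e c)) ↔ w = v := by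
  have hside : ∀ i : Bool, ∃ x : ℤ, (if i then 2 * (d : ℤ) - 2 else 0) = x ∧ x % 2 = 0 ∧
      0 ≤ x ∧ x ≤ 2 * d - 2 := fun i => by cases i <;> simp <;> omega
  obtain ⟨x, hx, hx'⟩ := hside (e .r)
  obtain ⟨y, hy, hy'⟩ := hside (e .b)
  obtain ⟨z, hz, hz'⟩ := hside (e .g)
  refine ⟨⟨(x, y, z), mem_latticeVertices.2 ⟨by simp only [InBox]; omega,
    isVertex_mk.2 (by omega)⟩⟩, ?_⟩
  rintro ⟨⟨x', y', z'⟩, hw⟩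
  simp only [forall_colour, mem_surfaceBoundary, coord, hx, hy, hz, Subtype.mk.injEq, Prod.mk.injEq]
  tauto

/-- The line and the boundary meet only in a corner of the box. -/
theorem boundaryLine_dotProduct (hd : 2 ≤ d) (c : Colour) (e : Colour → Bool) (i : Bool) :
    bits (boundaryLine d c e) ⬝ᵥ bits (surfaceBoundary d c i) = 1 := by
  obtain ⟨v, hv⟩ := exists_boundary_corner hd (Function.update e c i)
  rw [bits_dotProduct_bits (T := {v.1}) (by simp), Finset.card_singleton, Nat.cast_one]
  intro w
  rw [Finset.mem_singleton, ← Subtype.ext_iff, ← hv]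
  constructor
  · rintro ⟨h1, h2⟩ c'
    rcases eq_or_ne c' c with rfl | h
    · rwa [Function.update_self]
    · rw [Function.update_of_ne h]
      exact h1 c' h
  · intro h
    refine ⟨fun c' hc' => ?_, ?_⟩
    · have := h c'
      rwa [Function.update_of_ne hc'] at this
    · have := h c
      rwa [Function.update_self] at this

theorem sq_add_sq_eq_two {a b c : ℤ} (ha : a % 2 = 1) (hb : b % 2 = 1) :
    a ^ 2 + b ^ 2 + c ^ 2 = 2 ↔ (a = 1 ∨ a = -1) ∧ (b = 1 ∨ b = -1) ∧ c = 0 := by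
  constructor
  · intro h
    have bound : ∀ x : ℤ, x ^ 2 ≤ 2 → x % 2 = 1 → x = 1 ∨ x = -1 := fun x hx h => by
      have h1 : x ≤ 1 := by nlinarith
      have h2 : -1 ≤ x := by nlinarith
      omega
    have ha' := bound a (by nlinarith [sq_nonneg b, sq_nonneg c]) ha
    have hb' := bound b (by nlinarith [sq_nonneg a, sq_nonneg c]) hb
    refine ⟨ha', hb', ?_⟩
    have : c ^ 2 = 0 := by rcases ha' with rfl | rfl <;> rcases hb' with rfl | rfl <;> linarith
    exact pow_eq_zero_iff two_ne_zero |>.1 this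
  · rintro ⟨rfl | rfl, rfl | rfl, rfl⟩ <;> rfl

theorem sq_add_sq_eq_one {a b c : ℤ} (hc : c % 2 = 1) :
    a ^ 2 + b ^ 2 + c ^ 2 = 1 ↔ a = 0 ∧ b = 0 ∧ (c = 1 ∨ c = -1) := by
  constructor
  · intro h
    have h1 : c ≤ 1 := by nlinarith [sq_nonneg a, sq_nonneg b]
    have h2 : -1 ≤ c := by nlinarith [sq_nonneg a, sq_nonneg b]
    have hc' : c = 1 ∨ c = -1 := by omega
    have h3 : a ^ 2 + b ^ 2 = 0 := by rcases hc' with rfl | rfl <;> linarith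
    exact ⟨by nlinarith [sq_nonneg a, sq_nonneg b], by nlinarith [sq_nonneg a, sq_nonneg b], hc'⟩
  · rintro ⟨rfl, rfl, rfl | rfl⟩ <;> rfl

/-- A `c`-cell that meets the line does so in exactly two vertices, one step before and one step
after its centre in the direction of the line. -/
theorem boundaryLine_mem_orthSub (c : Colour) (e : Colour → Bool) :
    bits (boundaryLine d c e) ∈ orthSub (surfaceCode d c).xSpace := by
  classical
  rw [CSSCode.xSpace, mem_orthSub_span]
  rintro _ ⟨_, ⟨p, hp, rfl⟩, rfl⟩
  have hside : ∀ c' i, ∃ x : ℤ, x % 2 = 0 ∧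
      ∀ v : Vertex d, v ∈ surfaceBoundary d c' i ↔ coord c' v.1 = x := fun c' i => by
    refine ⟨if i then 2 * (d : ℤ) - 2 else 0, ?_, fun _ => Iff.rfl⟩
    split_ifs <;> omega
  obtain ⟨X, hX, hX'⟩ := hside .r (e .r)
  obtain ⟨Y, hY, hY'⟩ := hside .b (e .b)
  obtain ⟨Z, hZ, hZ'⟩ := hside .g (e .g)
  have hline : ∀ v : Vertex d, v ∈ boundaryLine d c e ↔ (.r ≠ c → v.1.1 = X) ∧
      (.g ≠ c → v.1.2.2 = Z) ∧ (.b ≠ c → v.1.2.1 = Y) := fun v => by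
    have : v ∈ boundaryLine d c e ↔ ∀ c', c' ≠ c → v ∈ surfaceBoundary d c' (e c') := Iff.rfl
    rw [this, forall_colour, hX', hY', hZ']
    rfl
  obtain ⟨px, py, pz⟩ := p
  have hbox := hp.coord_mem
  have hcen := hp.1
  by_cases hne : (cellVertices d c (px, py, pz) ∩ boundaryLine d c e).Nonempty
  -- Along the line such a centre has an odd coordinate within the box, so neither of the two
  -- vertices is cut off.
  · have hpair : ∃ p₁ p₂ : Point, p₁ ≠ p₂ ∧ (∀ v : Vertex d,
        v ∈ cellVertices d c (px, py, pz) ∩ boundaryLine d c e ↔ v.1 = p₁ ∨ v.1 = p₂) ∧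
        p₁ ∈ latticeVertices d ∧ p₂ ∈ latticeVertices d := by
      obtain ⟨⟨⟨x, y, z⟩, hv⟩, h1, h2⟩ := hne
      obtain ⟨hvbox, hvert⟩ := mem_latticeVertices.1 hv
      simp only [cellVertices, Set.mem_inter_iff, Set.mem_ofPred_eq, hline] at h1 h2 ⊢
      rw [isVertex_mk] at hvert
      simp only [mem_latticeVertices, InBox] at hvbox ⊢
      cases c <;> simp only [coord, IsCentre, Int.even_iff, Int.odd_iff, ne_eq, reduceCtorEq,
        not_false_eq_true, not_true_eq_false, true_implies, false_implies, true_and, and_true,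
        cellRadius, sqDist] at hbox hcen h1 h2 ⊢
      · rw [sq_add_sq_eq_two (by omega) (by omega)] at h1
        refine ⟨(px - 1, Y, Z), (px + 1, Y, Z), by simp; omega, ?_, ⟨by dsimp only; omega,
          isVertex_mk.2 (by omega)⟩, by dsimp only; omega, isVertex_mk.2 (by omega)⟩
        rintro ⟨⟨x', y', z'⟩, hv'⟩
        have hvert' := isVertex_mk.1 (mem_latticeVertices.1 hv').2
        simp only [Prod.mk.injEq]
        constructor
        · rintro ⟨h3, h4⟩
          rw [sq_add_sq_eq_two (by omega) (by omega)] at h3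
          omega
        · intro h3
          refine ⟨(sq_add_sq_eq_two (by omega) (by omega)).2 (by omega), by omega⟩
      · rw [sq_add_sq_eq_one (by omega)] at h1
        refine ⟨(X, Y, pz - 1), (X, Y, pz + 1), by simp; omega, ?_, ⟨by dsimp only; omega,
          isVertex_mk.2 (by omega)⟩, by dsimp only; omega, isVertex_mk.2 (by omega)⟩
        rintro ⟨⟨x', y', z'⟩, hv'⟩
        have hvert' := isVertex_mk.1 (mem_latticeVertices.1 hv').2
        simp only [Prod.mk.injEq]
        constructor
        · rintro ⟨h3, h4⟩
          rw [sq_add_sq_eq_one (by omega)] at h3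
          omega
        · intro h3
          refine ⟨(sq_add_sq_eq_one (by omega)).2 (by omega), by omega⟩
      · rw [sq_add_sq_eq_two (by omega) (by omega)] at h1
        refine ⟨(X, py - 1, Z), (X, py + 1, Z), by simp; omega, ?_, ⟨by dsimp only; omega,
          isVertex_mk.2 (by omega)⟩, by dsimp only; omega, isVertex_mk.2 (by omega)⟩
        rintro ⟨⟨x', y', z'⟩, hv'⟩
        have hvert' := isVertex_mk.1 (mem_latticeVertices.1 hv').2
        simp only [Prod.mk.injEq]
        constructor
        · rintro ⟨h3, h4⟩
          rw [sq_add_sq_eq_two (by omega) (by omega)] at h3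
          omega
        · intro h3
          refine ⟨(sq_add_sq_eq_two (by omega) (by omega)).2 (by omega), by omega⟩
    obtain ⟨p₁, p₂, hne', hmem, hp₁, hp₂⟩ := hpair
    rw [bits_dotProduct_bits (T := {p₁, p₂}) (by simp [hp₁, hp₂])
      (by simpa only [Finset.mem_insert, Finset.mem_singleton] using hmem), Finset.card_pair hne']
    rfl
  · rw [Set.not_nonempty_iff_eq_empty] at hne
    rw [bits_dotProduct_bits (T := ∅) (by simp) (by simp [hne])]
    rfl

/-- Sums of cells meet the line evenly, whereas the boundary meets it once. -/
theorem surfaceBoundary_notMem_xSpace (hd : 2 ≤ d) (c : Colour) (i : Bool) :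
    bits (surfaceBoundary d c i) ∉ (surfaceCode d c).xSpace := fun h => by
  have h1 := boundaryLine_mem_orthSub c (fun _ => true) _ h
  rw [dotProduct_comm, boundaryLine_dotProduct hd] at h1
  exact one_ne_zero h1

theorem boundaryLine_notMem_zSpace (hd : 2 ≤ d) (c : Colour) (e : Colour → Bool) :
    bits (boundaryLine d c e) ∉ (surfaceCode d c).zSpace := fun h => by
  have h1 := surfaceBoundary_mem_orthSub hd c true _ h
  rw [boundaryLine_dotProduct hd] at h1
  exact one_ne_zero h1

/-- The complement of `zSpace` is `xSpace` enlarged by one independent vector, the boundary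
membrane. -/
theorem surfaceCode_hasLogicalDim (hd : 2 ≤ d) (c : Colour) : (surfaceCode d c).HasLogicalDim 1 := by
  refine ⟨surfaceCode_isOrthogonal d c, ?_⟩
  have h : orthSub (surfaceCode d c).zSpace = (surfaceCode d c).xSpace ⊔
      Submodule.span (ZMod 2) {bits (surfaceBoundary d c true)} := by
    refine le_antisymm (orthSub_zSpace_le hd c) (sup_le (surfaceCode_isOrthogonal d c) ?_)
    rw [Submodule.span_singleton_le_iff_mem]
    exact surfaceBoundary_mem_orthSub hd c true
  rw [h, Submodule.finrank_sup_span_singleton (surfaceBoundary_notMem_xSpace hd c true)]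

end

/-! ### The number of vertices -/

section

variable {d : ℕ}

theorem cast_card_vertex (hd : 2 ≤ d) :
    (Fintype.card (Vertex d) : ℤ) = 3 * d ^ 3 - 4 * d ^ 2 + 2 * d := by
  classical
  set E : Finset ℤ := (Finset.range d).image fun k : ℕ => 2 * (k : ℤ)
  set O : Finset ℤ := (Finset.range (d - 1)).image fun k : ℕ => 2 * (k : ℤ) + 1
  have hE : ∀ x, x ∈ E ↔ x % 2 = 0 ∧ 0 ≤ x ∧ x ≤ 2 * d - 2 := fun x => by
    simp only [E, Finset.mem_image, Finset.mem_range]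
    exact ⟨by rintro ⟨k, hk, rfl⟩; omega, fun h => ⟨(x / 2).toNat, by omega, by omega⟩⟩
  have hO : ∀ x, x ∈ O ↔ x % 2 = 1 ∧ 0 ≤ x ∧ x ≤ 2 * d - 2 := fun x => by
    simp only [O, Finset.mem_image, Finset.mem_range]
    exact ⟨by rintro ⟨k, hk, rfl⟩; omega, fun h => ⟨(x / 2).toNat, by omega, by omega⟩⟩
  have cE : E.card = d := by
    rw [Finset.card_image_of_injective _ fun a b h => by simpa using h, Finset.card_range]
  have cO : O.card = d - 1 := by
    rw [Finset.card_image_of_injective _ fun a b h => by simpa using h, Finset.card_range]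
  -- The three parity classes have `d³`, `d (d - 1)²` and `d (d - 1)²` points.
  have h : latticeVertices d = (E ×ˢ E ×ˢ E ∪ O ×ˢ E ×ˢ O) ∪ E ×ˢ O ×ˢ O := by
    ext ⟨x, y, z⟩
    simp only [mem_latticeVertices, isVertex_mk, InBox, Finset.mem_union, Finset.mem_product, hE, hO]
    omega
  rw [Fintype.card_coe, h, Finset.card_union_of_disjoint, Finset.card_union_of_disjoint]
  · simp only [Finset.card_product, cE, cO]
    push_cast [Nat.cast_sub (show 1 ≤ d by omega)]
    ring
  all_goals
    rw [Finset.disjoint_left]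
    rintro ⟨x, y, z⟩
    simp only [Finset.mem_union, Finset.mem_product, hE, hO]
    omega

theorem card_vertex_prod_corner : Fintype.card (Vertex d × Corner) = 8 * Fintype.card (Vertex d) := by
  rw [Fintype.card_prod, card_corner, mul_comm]

/-! ### Logical operators of the colour code -/

theorem pauliX_mul_pauliZ_eq {Q : Type} [Fintype Q] (A B : Set Q) : pauliX A * pauliZ B =
    (if bits B ⬝ᵥ bits A = 1 then LinearEquiv.neg ℂ else 1) * (pauliZ B * pauliX A) := by
  refine LinearEquiv.ext fun ψ => funext fun s => ?_
  rw [LinearEquiv.mul_apply, LinearEquiv.mul_apply, LinearEquiv.mul_apply, pauliX_apply,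
    pauliZ_apply, dotProduct_add, sgn_add]
  rcases zmod_two_cases (bits B ⬝ᵥ bits A) with h | h
  · rw [h, if_neg zero_ne_one, LinearEquiv.coe_one, id_eq, pauliZ_apply, pauliX_apply, sgn_zero,
      mul_one]
  · rw [h, if_pos rfl, LinearEquiv.neg_apply, Pi.neg_apply, pauliZ_apply, pauliX_apply, sgn_one]
    ring

/-- Within a cube, an edge along `c` meets a `c`-face once, and a face of another colour in zero or
two corners. -/
theorem bits_liftZ_dotProduct_liftX (c c' : Colour) (k : Vertex d → Corner) (k' : Vertex d → ZMod 2)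
    (A B : Set (Vertex d)) : bits (liftZ c k A) ⬝ᵥ bits (liftX c' k' B) =
      if c' = c then bits A ⬝ᵥ bits B else 0 := by
  rw [bits_liftX_eq, bits_liftZ_dotProduct]
  dsimp only
  split_ifs with h
  · rw [h, Pi.single_eq_same]
  · rw [Pi.single_eq_of_ne (Ne.symm h), dotProduct_zero]

theorem colourCode_hasLogicalDim (hd : 2 ≤ d) : (colourCode d).HasLogicalDim 3 :=
  (colourCode_isConcatenation d).hasLogicalDim (surfaceCode_hasLogicalDim hd)

theorem isLogical_liftX_iff (hd : 2 ≤ d) (c : Colour) (k : Vertex d → ZMod 2)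
    (A : Set (Vertex d)) :
    (surfaceCode d c).IsLogical A ∅ ↔ (colourCode d).IsLogical (liftX c k A) ∅ := by
  rw [CSSCode.isLogical_x_iff (surfaceCode_isOrthogonal d c),
    CSSCode.isLogical_x_iff (colourCode_hasLogicalDim hd).1,
    (colourCode_isConcatenation d).liftX_mem_xSpace_iff,
    (colourCode_isConcatenation d).liftX_mem_orthSub_iff]

theorem isLogical_liftZ_iff (hd : 2 ≤ d) (c : Colour) (k : Vertex d → Corner)
    (A : Set (Vertex d)) :
    (surfaceCode d c).IsLogical ∅ A ↔ (colourCode d).IsLogical ∅ (liftZ c k A) := by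
  rw [CSSCode.isLogical_z_iff (surfaceCode_isOrthogonal d c),
    CSSCode.isLogical_z_iff (colourCode_hasLogicalDim hd).1,
    (colourCode_isConcatenation d).liftZ_mem_zSpace_iff,
    (colourCode_isConcatenation d).liftZ_mem_orthSub_iff]

theorem pauliX_liftX_mem_stabilizer_iff (hd : 2 ≤ d) (c : Colour) (k : Vertex d → ZMod 2)
    (A : Set (Vertex d)) : pauliX A ∈ (surfaceCode d c).stabilizer ↔
      pauliX (liftX c k A) ∈ (colourCode d).stabilizer := by
  rw [CSSCode.pauliX_mem_stabilizer_iff (surfaceCode_isOrthogonal d c),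
    CSSCode.pauliX_mem_stabilizer_iff (colourCode_hasLogicalDim hd).1,
    (colourCode_isConcatenation d).liftX_mem_xSpace_iff]

theorem pauliZ_liftZ_mem_stabilizer_iff (hd : 2 ≤ d) (c : Colour) (k : Vertex d → Corner)
    (A : Set (Vertex d)) : pauliZ A ∈ (surfaceCode d c).stabilizer ↔
      pauliZ (liftZ c k A) ∈ (colourCode d).stabilizer := by
  rw [CSSCode.pauliZ_mem_stabilizer_iff (surfaceCode_isOrthogonal d c),
    CSSCode.pauliZ_mem_stabilizer_iff (colourCode_hasLogicalDim hd).1,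
    (colourCode_isConcatenation d).liftZ_mem_zSpace_iff]

theorem isLogical_surfaceBoundary (hd : 2 ≤ d) (c : Colour) (i : Bool) :
    (surfaceCode d c).IsLogical (surfaceBoundary d c i) ∅ :=
  (CSSCode.isLogical_x_iff (surfaceCode_isOrthogonal d c)).2
    ⟨surfaceBoundary_mem_orthSub hd c i, surfaceBoundary_notMem_xSpace hd c i⟩

theorem isLogical_boundaryLine (hd : 2 ≤ d) (c : Colour) (e : Colour → Bool) :
    (surfaceCode d c).IsLogical ∅ (boundaryLine d c e) :=
  (CSSCode.isLogical_z_iff (surfaceCode_isOrthogonal d c)).2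
    ⟨boundaryLine_mem_orthSub c e, boundaryLine_notMem_zSpace hd c e⟩

theorem exists_colourBoundary_inter_eq_liftZ (hd : 2 ≤ d) {c c₁ c₂ : Colour} (h₁ : c₁ ≠ c)
    (h₂ : c₂ ≠ c) (h : c₁ ≠ c₂) (i j : Bool) :
    ∃ k, colourBoundary d c₁ i ∩ colourBoundary d c₂ j =
      liftZ c k (surfaceBoundary d c₁ i ∩ surfaceBoundary d c₂ j) := by
  obtain ⟨k₁, e₁⟩ := exists_colourBoundary_eq_liftX hd c₁ i
  obtain ⟨k₂, e₂⟩ := exists_colourBoundary_eq_liftX hd c₂ j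
  rw [e₁, e₂, liftX_inter_liftX h₁ h₂ h]
  exact ⟨_, rfl⟩

/-- At a corner of the box one cell of each colour is missing; the sides of the missing cells single
out a corner of the cube there. -/
theorem colourBoundary_inter_nonempty (hd : 2 ≤ d) (e : Colour → Bool) :
    ∃ q : Vertex d × Corner, ∀ c, q ∈ colourBoundary d c (e c) := by
  obtain ⟨v, hv⟩ := exists_boundary_corner hd e
  have hv' := (hv v).2 rfl
  have h : ∀ c, ∃ t, ¬ IsCell d c (cellAt c v.1 t) := fun c => by
    obtain ⟨k, hk⟩ := exists_not_isCell_iff hd (hv' c)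
    exact ⟨k, (hk k).2 rfl⟩
  choose s hs using h
  exact ⟨(v, s), fun c => mem_colourBoundary.2 ⟨hv' c, hs c⟩⟩

end

/-! ### The main theorem -/

theorem mainTheorem4 (d : ℕ) (hd : 2 ≤ d) (n : ℕ) (hn : n = Fintype.card (Vertex d)) :
    -- The surface codes have `n` qubits, `n - 1` independent generators, one logical qubit.
    ((n : ℤ) = 3 * d ^ 3 - 4 * d ^ 2 + 2 * d ∧
      ∀ c, (surfaceCode d c).IsValid ∧ (surfaceCode d c).HasIndependentGenerators (n - 1) ∧
        (surfaceCode d c).EncodesQubits 1) ∧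
    -- The cube code is an [[8,3,2]] code, and the cube encoder encodes three qubits into it.
    (Fintype.card Corner = 8 ∧ cubeCode.IsValid ∧ cubeCode.HasIndependentGenerators 5 ∧
      cubeCode.EncodesQubits 3 ∧ cubeCode.HasDistance 2 ∧
      LinearMap.range cubeEncoder = cubeCode.codeSpace ∧
      (∀ c k ψ, cubeEncoder (pauliX {c} ψ) = pauliX (cubeFace c k) (cubeEncoder ψ)) ∧
      (∀ c k ψ, cubeEncoder (pauliZ {c} ψ) = pauliZ (cubeEdge c k) (cubeEncoder ψ))) ∧
    -- The qubits of the colour code are the vertices of a cantitruncated cubic lattice, which is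
    -- four-colourable and (off the boundaries) four-valent.
    (Function.Injective (position : Vertex d × Corner → Point) ∧
      Set.range (position : Vertex d × Corner → Point) =
        {P | ∃ v : Vertex d, IsCubeVertex v.1 P} ∧
      (∀ q : Vertex d × Corner, ∃! v : Vertex d, q ∈ cubeQubits d v.1) ∧
      (∀ (q : Vertex d × Corner) c p p', IsCell d c p → IsCell d c p' →
        q ∈ cellQubits d c p → q ∈ cellQubits d c p' → p = p') ∧
      (∀ q : Vertex d × Corner, {q' | AreJoined q q'}.ncard ≤ 4) ∧
      (∀ q : Vertex d × Corner, (∀ c i, q ∉ colourBoundary d c i) →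
        {q' | AreJoined q q'}.ncard = 4)) ∧
    -- The encoder is an isometry that takes the stack of surface codes to the colour code.
    ((∀ φ ψ, star (encoder d φ) ⬝ᵥ encoder d ψ = star φ ⬝ᵥ ψ) ∧
      (stackCode d).codeSpace.map (encoder d) = (colourCode d).codeSpace ∧
      (concatenatedCode d).stabilizer = (colourCode d).stabilizer) ∧
    -- The colour code has `8n` qubits and `8n - 3` independent generators: three logical qubits.
    (Fintype.card (Vertex d × Corner) = 8 * n ∧ (colourCode d).IsValid ∧
      (colourCode d).HasIndependentGenerators (8 * n - 3) ∧ (colourCode d).EncodesQubits 3) ∧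
    -- Stabilizers of cells and faces become stabilizers of the corresponding cells and faces.
    ((∀ c p, IsCell d c p →
        (∃ k, cellQubits d c p = liftX c k (cellVertices d c p)) ∧
        ∀ ψ, encoder d (pauliX (inCode c (cellVertices d c p)) ψ) =
          pauliX (cellQubits d c p) (encoder d ψ)) ∧
      (∀ c c₁ p₁ c₂ p₂, c₁ ≠ c → c₂ ≠ c → IsFace d c₁ p₁ c₂ p₂ →
        (∃ k, cellQubits d c₁ p₁ ∩ cellQubits d c₂ p₂ =
          liftZ c k (cellVertices d c₁ p₁ ∩ cellVertices d c₂ p₂)) ∧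
        ∀ ψ, encoder d
            (pauliZ (inCode c (cellVertices d c₁ p₁ ∩ cellVertices d c₂ p₂)) ψ) =
          pauliZ (cellQubits d c₁ p₁ ∩ cellQubits d c₂ p₂) (encoder d ψ))) ∧
    -- Boundaries become boundaries of the same colour.
    ((∀ c i, ∀ v ∈ surfaceBoundary d c i,
        {p | IsCell d c p ∧ v ∈ cellVertices d c p}.ncard = 1) ∧
      (∀ c v, (∀ i, v ∉ surfaceBoundary d c i) →
        {p | IsCell d c p ∧ v ∈ cellVertices d c p}.ncard = 2) ∧
      (∀ c i, ∀ v ∈ surfaceBoundary d c i, ∃ k, ∀ s,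
        (v, s) ∈ colourBoundary d c i ↔ s ∈ cubeFace c k) ∧
      (∀ c q, (∀ p, IsCell d c p → q ∉ cellQubits d c p) ↔
        (q ∈ colourBoundary d c false ∨ q ∈ colourBoundary d c true)) ∧
      (∀ c, Disjoint (colourBoundary d c false) (colourBoundary d c true))) ∧
    -- Logical operators become logical operators.
    ((∀ c k A, (∀ ψ, encoder d (pauliX (inCode c A) ψ) = pauliX (liftX c k A) (encoder d ψ)) ∧
        (pauliX A ∈ (surfaceCode d c).stabilizer ↔
          pauliX (liftX c k A) ∈ (colourCode d).stabilizer) ∧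
        ((surfaceCode d c).IsLogical A ∅ ↔ (colourCode d).IsLogical (liftX c k A) ∅)) ∧
      (∀ c k A, (∀ ψ, encoder d (pauliZ (inCode c A) ψ) = pauliZ (liftZ c k A) (encoder d ψ)) ∧
        (pauliZ A ∈ (surfaceCode d c).stabilizer ↔
          pauliZ (liftZ c k A) ∈ (colourCode d).stabilizer) ∧
        ((surfaceCode d c).IsLogical ∅ A ↔ (colourCode d).IsLogical ∅ (liftZ c k A)))) ∧
    -- The membranes on `c`-boundaries and the strings along which the other two boundaries meet.
    ((∀ c i, (surfaceCode d c).IsLogical (surfaceBoundary d c i) ∅ ∧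
        (colourCode d).IsLogical (colourBoundary d c i) ∅ ∧
        ∀ ψ, encoder d (pauliX (inCode c (surfaceBoundary d c i)) ψ) =
          pauliX (colourBoundary d c i) (encoder d ψ)) ∧
      (∀ c c₁ c₂ i j, c₁ ≠ c → c₂ ≠ c → c₁ ≠ c₂ →
        (surfaceCode d c).IsLogical ∅ (surfaceBoundary d c₁ i ∩ surfaceBoundary d c₂ j) ∧
        (colourCode d).IsLogical ∅ (colourBoundary d c₁ i ∩ colourBoundary d c₂ j) ∧
        (∀ ψ, encoder d
            (pauliZ (inCode c (surfaceBoundary d c₁ i ∩ surfaceBoundary d c₂ j)) ψ) =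
          pauliZ (colourBoundary d c₁ i ∩ colourBoundary d c₂ j) (encoder d ψ)) ∧
        ∀ c' k, pauliX (colourBoundary d c' k) *
            pauliZ (colourBoundary d c₁ i ∩ colourBoundary d c₂ j) =
          (if c' = c then LinearEquiv.neg ℂ else 1) *
            (pauliZ (colourBoundary d c₁ i ∩ colourBoundary d c₂ j) *
              pauliX (colourBoundary d c' k))) ∧
      (∀ i j k, (colourBoundary d .r i ∩ colourBoundary d .g j ∩
        colourBoundary d .b k).Nonempty)) := by
  subst hn
  have hS := surfaceCode_hasLogicalDim hd
  have hC := colourCode_isConcatenation d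
  have hL := colourCode_hasLogicalDim hd
  refine ⟨⟨cast_card_vertex hd, fun c => ⟨(hS c).1.isValid, (hS c).hasIndependentGenerators,
      (hS c).encodesQubits⟩⟩,
    ⟨card_corner, cubeCode_isOrthogonal.isValid, ?_, cubeCode_hasLogicalDim.encodesQubits,
      cubeCode_hasDistance, range_cubeEncoder, cubeEncoder_pauliX, cubeEncoder_pauliZ⟩,
    ⟨position_injective, range_position, fun q => ?_, fun q c p p' hp hp' hq hq' => ?_,
      ncard_areJoined_le, fun q => ncard_areJoined⟩,
    ⟨encoder_isometry, hC.map_codeSpace hS,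
      hC.stabilizer_eq (concatenatedCode_isConcatenation d) hL.1⟩,
    ⟨card_vertex_prod_corner, hL.1.isValid, ?_, hL.encodesQubits⟩,
    ⟨fun c p hp => ?_, fun c c₁ p₁ c₂ p₂ h₁ h₂ hf => ?_⟩,
    ⟨fun c i v => ncard_cells_of_mem_surfaceBoundary hd, fun c v =>
      ncard_cells_of_notMem_surfaceBoundary, fun c i v => exists_mem_colourBoundary_iff hd,
      fun c q => forall_notMem_cellQubits_iff_mem_colourBoundary, disjoint_colourBoundary hd⟩,
    ⟨fun c k A => ⟨encoder_pauliX c k A, pauliX_liftX_mem_stabilizer_iff hd c k A,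
      isLogical_liftX_iff hd c k A⟩, fun c k A => ⟨encoder_pauliZ c k A,
      pauliZ_liftZ_mem_stabilizer_iff hd c k A, isLogical_liftZ_iff hd c k A⟩⟩,
    fun c i => ?_, fun c c₁ c₂ i j h₁ h₂ h => ?_, fun i j k => ?_⟩
  · have := cubeCode_hasLogicalDim.hasIndependentGenerators
    rwa [card_corner] at this
  · refine ⟨q.1, ?_, fun v hv => ?_⟩
    · dsimp only
      rw [cubeQubits_eq]
      rfl
    · dsimp only at hv
      rw [cubeQubits_eq] at hv
      exact Eq.symm hv
  · rw [(mem_cellQubits_iff hp.1).1 hq, (mem_cellQubits_iff hp'.1).1 hq']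
  · have := hL.hasIndependentGenerators
    rwa [card_vertex_prod_corner] at this
  · have hk := cellQubits_eq_liftX (d := d) hp.1
    refine ⟨⟨_, hk⟩, fun ψ => ?_⟩
    rw [hk]
    exact encoder_pauliX c _ _ ψ
  · obtain ⟨k, hk⟩ := exists_liftZ_of_isFace h₁ h₂ hf
    refine ⟨⟨k, hk⟩, fun ψ => ?_⟩
    rw [hk]
    exact encoder_pauliZ c _ _ ψ
  · obtain ⟨k, hk⟩ := exists_colourBoundary_eq_liftX hd c i
    refine ⟨isLogical_surfaceBoundary hd c i, ?_, fun ψ => ?_⟩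
    · rw [hk, ← isLogical_liftX_iff hd]
      exact isLogical_surfaceBoundary hd c i
    · rw [hk]
      exact encoder_pauliX c _ _ ψ
  · obtain ⟨k, hk⟩ := exists_colourBoundary_inter_eq_liftZ hd h₁ h₂ h i j
    rw [hk, boundaryLine_eq h₁ h₂ h, ← isLogical_liftZ_iff hd]
    refine ⟨isLogical_boundaryLine hd c _, isLogical_boundaryLine hd c _, encoder_pauliZ c k _,
      fun c' l => ?_⟩
    obtain ⟨k', hk'⟩ := exists_colourBoundary_eq_liftX hd c' l
    -- The sign is the parity of the overlap: zero for different colours, and for equal ones the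
    -- single crossing of line and boundary in the surface code.
    rw [pauliX_mul_pauliZ_eq, hk', bits_liftZ_dotProduct_liftX]
    congr 1
    by_cases hc : c' = c
    · subst hc
      rw [if_pos rfl, if_pos rfl, if_pos (boundaryLine_dotProduct hd c' _ l)]
    · rw [if_neg hc, if_neg hc, if_neg zero_ne_one]
  · obtain ⟨q, hq⟩ := colourBoundary_inter_nonempty hd fun c => match c with
      | .r => i
      | .g => j
      | .b => k
    exact ⟨q, ⟨hq .r, hq .g⟩, hq .b⟩
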